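/- Let $M$ be a smooth surface and let $x:M\to\mathbb{R}^3$ be a smooth immersion whose position vector is everywhere transversal to the tangent plane (a centroaffine surface). For $\varepsilon\in\{1,-1\}$ let the induced connection $\nabla$ and the centroaffine metric $h$ be defined by the Gauss formula $D_X x_*(Y)=x_*(\nabla_XY)+h(X,Y)(-\varepsilon x)$, where $D$ is the standard flat connection of $\mathbb{R}^3$. Assume that $x$ is locally strongly convex, i.e. that $\varepsilon$ can be, and is, chosen so that $h$ is positive definite. Let $\hat\nabla$ be the Levi-Civita connection of $h$ and $C=\nabla h$ the cubic form, and assume that $C$ is parallel: $\hat\nabla C=0$. Then, on each connected component of $M$, $x$ is locally centroaffinely equivalent to one of the following surfaces (the same surface for all points of the component): 1. a non-degenerate quadric centred at the origin, $\{x\in\mathbb{R}^3: x^{\top}Qx=1\}$ with $Q$ symmetric and $\det Q\ne0$; in this case $C=0$ on the component; 2. $x_1^{\alpha_1}x_2^{\alpha_2}x_3^{\alpha_3}=1$ ($x_1,x_2,x_3>0$), where either $\alpha_1,\alpha_2,\alpha_3>0$, or $\alpha_1<0$, $\alpha_2,\alpha_3>0$ and $\alpha_1+\alpha_2+\alpha_3<0$;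 3. $x_1^{\alpha_1}(x_2^2+x_3^2)^{\alpha_2}\exp\bigl(\alpha_3\arctan\tfrac{x_2}{x_3}\bigr)=1$ ($x_1>0$, $x_3\neq0$), where $\alpha_1<0$ and $\alpha_1+2\alpha_2>0$; 4. $x_3=x_1(\ln x_1-\alpha_2\ln x_2)$ ($x_1,x_2>0$), where $0<\alpha_2<1$; 5. $x_3=\tfrac{1}{2x_1}x_2^2+x_1\ln x_1$ ($x_1>0$). Here $\alpha_1,\alpha_2,\alpha_3$ are real constants, and $x$ is locally centroaffinely equivalent to a surface $S$ on a subset of $M$ if every point of that subset has an open neighbourhood $U$ in $M$ on which $x$ is injective, together with some $A\in GL(3,\mathbb{R})$ such that $A(x(U))$ is a relatively open subset of $S$. -/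

import Mathlib

open scoped Manifold ContDiff Matrix

noncomputable section

namespace Centroaffine

/-- The Euclidean coordinate space `ℝⁿ`. -/
abbrev E (n : ℕ) : Type := EuclideanSpace ℝ (Fin n)

section Local

variable {n : ℕ}

/-- The `i`-th partial derivative of a map on `ℝⁿ`. -/
def pd {F : Type*} [NormedAddCommGroup F] [NormedSpace ℝ F] (i : Fin n) (f : E n → F) (u : E n) :
    F :=
  fderiv ℝ f u (EuclideanSpace.single i 1)

/-- The matrix whose rows are the coordinate vectors `∂₁f, …, ∂ₙf` and, as last row, the
centroaffine normal `-ε f`, of a local parametrization `f` of a centroaffine hypersurface. -/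
def frame (ε : ℝ) (f : E n → E (n + 1)) (u : E n) : Matrix (Fin (n + 1)) (Fin (n + 1)) ℝ :=
  Matrix.of fun a b => Fin.lastCases (motive := fun _ => ℝ) (-ε * f u b) (fun k => pd k f u b) a

/-- The coefficients of `∂ᵢ∂ⱼf` in the frame `∂₁f, …, ∂ₙf, -ε f` (see `gauss_formula`). -/
def gaussCoeff (ε : ℝ) (f : E n → E (n + 1)) (i j : Fin n) (u : E n) : Fin (n + 1) → ℝ :=
  (fun b => pd i (pd j f) u b) ᵥ* (frame ε f u)⁻¹

/-- Christoffel symbol `Γᵏᵢⱼ` of the induced connection `∇`, where `∇_{∂ᵢ}∂ⱼ = ∑ₖ Γᵏᵢⱼ ∂ₖ`. -/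
def inducedChristoffel (ε : ℝ) (f : E n → E (n + 1)) (k i j : Fin n) (u : E n) : ℝ :=
  gaussCoeff ε f i j u k.castSucc

/-- Component `hᵢⱼ` of the centroaffine metric (with respect to the normal `-ε f`). -/
def metric (ε : ℝ) (f : E n → E (n + 1)) (i j : Fin n) (u : E n) : ℝ :=
  gaussCoeff ε f i j u (Fin.last n)

/-- The centroaffine formula of Gauss, `D_X f_*(Y) = f_*(∇_X Y) + h(X, Y) (-ε f)`, in coordinates;
it determines `∇` and `h` when the frame is a basis. -/
theorem gauss_formula (ε : ℝ) (f : E n → E (n + 1)) (u : E n) (hu : IsUnit (frame ε f u).det)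
    (i j : Fin n) :
    pd i (pd j f) u =
      ∑ k, inducedChristoffel ε f k i j u • pd k f u + metric ε f i j u • ((-ε) • f u) := by
  have h : gaussCoeff ε f i j u ᵥ* frame ε f u = fun b => pd i (pd j f) u b := by
    rw [gaussCoeff, Matrix.vecMul_vecMul, Matrix.nonsing_inv_mul _ hu, Matrix.vecMul_one]
  ext b
  have hb := congrFun h b
  rw [Matrix.vecMul, dotProduct, Fin.sum_univ_castSucc] at hb
  simp only [frame, Matrix.of_apply, Fin.lastCases_castSucc, Fin.lastCases_last] at hb
  simp [← hb, inducedChristoffel, metric]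

/-- The matrix `(hᵢⱼ)` of the centroaffine metric. -/
def metricMatrix (ε : ℝ) (f : E n → E (n + 1)) (u : E n) : Matrix (Fin n) (Fin n) ℝ :=
  Matrix.of fun i j => metric ε f i j u

/-- Christoffel symbol `Γ̂ᵏᵢⱼ = ½ ∑ₗ hᵏˡ (∂ᵢhⱼₗ + ∂ⱼhᵢₗ - ∂ₗhᵢⱼ)` of the Levi-Civita connection `∇̂`
of the centroaffine metric. -/
def leviCivitaChristoffel (ε : ℝ) (f : E n → E (n + 1)) (k i j : Fin n) (u : E n) : ℝ :=
  (1 / 2) * ∑ l, (metricMatrix ε f u)⁻¹ k l *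
    (pd i (metric ε f j l) u + pd j (metric ε f i l) u - pd l (metric ε f i j) u)

/-- Component `C(∂ᵢ, ∂ⱼ, ∂ₖ) = (∇_{∂ᵢ} h)(∂ⱼ, ∂ₖ)` of the cubic form `C = ∇h`. -/
def cubicForm (ε : ℝ) (f : E n → E (n + 1)) (i j k : Fin n) (u : E n) : ℝ :=
  pd i (metric ε f j k) u
    - ∑ l, inducedChristoffel ε f l i j u * metric ε f l k u
    - ∑ l, inducedChristoffel ε f l i k u * metric ε f j l u

/-- Component `(∇̂_{∂ₗ} C)(∂ᵢ, ∂ⱼ, ∂ₖ)` of the Levi-Civita covariant derivative of the cubic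
form. -/
def covDerivCubicForm (ε : ℝ) (f : E n → E (n + 1)) (l i j k : Fin n) (u : E n) : ℝ :=
  pd l (cubicForm ε f i j k) u
    - ∑ m, leviCivitaChristoffel ε f m l i u * cubicForm ε f m j k u
    - ∑ m, leviCivitaChristoffel ε f m l j u * cubicForm ε f i m k u
    - ∑ m, leviCivitaChristoffel ε f m l k u * cubicForm ε f i j m u

end Local

section Hypersurface

variable {n : ℕ} {M : Type*} [TopologicalSpace M] [ChartedSpace (E n) M]

/-- `x : Mⁿ → ℝⁿ⁺¹` is a centroaffine hypersurface: a smooth immersion whose position vector is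
everywhere transversal to the tangent hyperplane. -/
structure IsCentroaffine (x : M → E (n + 1)) : Prop where
  smooth : ContMDiff (𝓡 n) 𝓘(ℝ, E (n + 1)) ∞ x
  immersion : ∀ p : M, Function.Injective (mfderiv (𝓡 n) 𝓘(ℝ, E (n + 1)) x p)
  transversal : ∀ (p : M) (v : TangentSpace (𝓡 n) p),
    mfderiv (𝓡 n) 𝓘(ℝ, E (n + 1)) x p v ≠ x p

/-- The centroaffine metric of `x` with respect to the normal `-ε x` is positive definite. -/
def MetricPosDef (ε : ℝ) (x : M → E (n + 1)) : Prop :=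
  ∀ φ ∈ atlas (E n) M, ∀ u ∈ φ.target, (metricMatrix ε (x ∘ φ.symm) u).PosDef

/-- The cubic form of `x` is parallel with respect to the Levi-Civita connection of the
centroaffine metric, `∇̂C = 0`. -/
def HasParallelCubicForm (ε : ℝ) (x : M → E (n + 1)) : Prop :=
  ∀ φ ∈ atlas (E n) M, ∀ u ∈ φ.target, ∀ l i j k : Fin n,
    covDerivCubicForm ε (x ∘ φ.symm) l i j k u = 0

/-- The cubic form of `x` vanishes at every point of `W`. -/
def CubicFormVanishesOn (ε : ℝ) (x : M → E (n + 1)) (W : Set M) : Prop :=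
  ∀ φ ∈ atlas (E n) M, ∀ u ∈ φ.target, φ.symm u ∈ W → ∀ i j k : Fin n,
    cubicForm ε (x ∘ φ.symm) i j k u = 0

/-- On `W`, the hypersurface `x` is locally centroaffinely equivalent to the hypersurface `S` of
`ℝⁿ⁺¹`: near each point of `W` the map `x` is injective and is carried by some `A ∈ GL(n+1, ℝ)`
onto a (relatively) open piece of `S`. -/
def LocallyEquivalentOn (x : M → E (n + 1)) (W : Set M) (S : Set (E (n + 1))) : Prop :=
  ∀ p ∈ W, ∃ (U : Set M) (V : Set (E (n + 1))) (A : E (n + 1) ≃L[ℝ] E (n + 1)),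
    IsOpen U ∧ p ∈ U ∧ IsOpen V ∧ Set.InjOn x U ∧ (fun q => A (x q)) '' U = S ∩ V

end Hypersurface

/-! The model surfaces of `ℝ³`; the coordinates `x₁, x₂, x₃` are `y 0, y 1, y 2`. -/

/-- The quadric `∑ Qᵢⱼ xᵢ xⱼ = 1`, centred at the origin. -/
def quadric (Q : Matrix (Fin 3) (Fin 3) ℝ) : Set (E 3) :=
  {y | ∑ i, ∑ j, Q i j * y i * y j = 1}

/-- `x₁^α₁ x₂^α₂ x₃^α₃ = 1`, on `x₁, x₂, x₃ > 0`. -/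
def powerSurface (α₁ α₂ α₃ : ℝ) : Set (E 3) :=
  {y | 0 < y 0 ∧ 0 < y 1 ∧ 0 < y 2 ∧ y 0 ^ α₁ * y 1 ^ α₂ * y 2 ^ α₃ = 1}

/-- `x₁^α₁ (x₂² + x₃²)^α₂ exp(α₃ arctan(x₂/x₃)) = 1`, on `x₁ > 0`, `x₃ ≠ 0`. -/
def spiralSurface (α₁ α₂ α₃ : ℝ) : Set (E 3) :=
  {y | 0 < y 0 ∧ y 2 ≠ 0 ∧
    y 0 ^ α₁ * (y 1 ^ 2 + y 2 ^ 2) ^ α₂ * Real.exp (α₃ * Real.arctan (y 1 / y 2)) = 1}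

/-- `x₃ = x₁ (ln x₁ - α₂ ln x₂)`, on `x₁, x₂ > 0`. -/
def logSurface (α₂ : ℝ) : Set (E 3) :=
  {y | 0 < y 0 ∧ 0 < y 1 ∧ y 2 = y 0 * (Real.log (y 0) - α₂ * Real.log (y 1))}

/-- `x₃ = x₂² / (2 x₁) + x₁ ln x₁`, on `x₁ > 0`. -/
def logParaboloid : Set (E 3) :=
  {y | 0 < y 0 ∧ y 2 = y 1 ^ 2 / (2 * y 0) + y 0 * Real.log (y 0)}

end Centroaffine

end

/-!
The statement is about local parametrizations `f = x ∘ φ⁻¹`. Write `K = ∇ - ∇̂`; lowering an index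
of `K` gives `-C/2`, so `K` is parallel together with `C`. At each parameter let `Xᵢ` be the
operator on `ℝ³` with `f Xᵢ = ∂ᵢf` and `∂ⱼf Xᵢ = ∑ₖ Kᵏᵢⱼ ∂ₖf - ε hᵢⱼ f`, where operators act on
row vectors from the right (`mult`, `multSpace`).

Where `C ≠ 0` the metric is flat: by the Ricci identity the curvature, a multiple of an
infinitesimal rotation in dimension two, annihilates `C`, and a cubic form killed by a rotation
vanishes (`IsParallelPatch.curvature_eq_zero`). With the equation of Gauss, flatness says that the
`Xᵢ` commute and that `1, X₁, X₂` span a commutative algebra; with `∇̂K = 0` it gives `∂ⱼXᵢ = ∑ₖ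
Γ̂ᵏⱼᵢ Xₖ`. This is a linear system, so by uniqueness of its solutions the plane `W` spanned by
`X₁, X₂` is locally constant (`IsParallelPatch.eventually_multSpace_eq`). The plane does not
depend on the parametrization (`IsReparametrization.multSpace_eq`), and where `C` vanishes it
vanishes nearby by the same uniqueness argument. Hence on each component either `C = 0`, or `C`
has no zero and `W` is one fixed plane (`multType_eq_of_mem_connectedComponent`); this is why one
model serves the whole component.

If `C = 0`, the quadratic form with the Gram matrix `diag(ε h, 1)` in the frame `(∂₁f, ∂₂f, -ε f)`
has constant coefficients, and `f` lies on the quadric where it is `1`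
(`IsConvexPatch.exists_mem_quadric`).

If `C ≠ 0`, rotating an orthonormal frame makes one component of `C` vanish, so `W` has a basis
`E₁, E₂` with a multiplication table in parameters `a, c, d` with `a c = c² + ε`
(`IsParallelPatch.exists_isNormalPair`). The relation `∂ᵢf ∈ f W` makes `f` a piece of an orbit of
the group `exp W`. The characters of the algebra give linear coordinates in which the orbit is
explicit: three real characters give `powerSurface`, one real and a pair of complex ones
`spiralSurface`, a double one `logSurface` and a triple one `logParaboloid`; the signs of `c² - ε`
and of `d² + 4 (c² - ε)` decide between them and yield the restrictions on the exponents
(`exists_isModel`).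

Finally, all the models meet each ray from the origin at most once. Hence a patch that maps into a
model maps onto an open piece of it: `(u, s) ↦ eˢ f(u)` is a local diffeomorphism of `ℝ³`, and its
values in the model are those with `s = 0` (`exists_image_eq_inter`).
-/

open Filter Topology

namespace Centroaffine

/-! ### Calculus of partial derivatives -/

section Calculus

variable {n : ℕ} {F : Type*} [NormedAddCommGroup F] [NormedSpace ℝ F]

theorem _root_.ContDiffAt.differentiableAt_infty {V : Type*} [NormedAddCommGroup V]
    [NormedSpace ℝ V] {f : V → F} {u : V} (hf : ContDiffAt ℝ ∞ f u) : DifferentiableAt ℝ f u :=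
  hf.differentiableAt (by simp)

theorem contDiffAt_pd {f : E n → F} {u : E n} (hf : ContDiffAt ℝ ∞ f u) (i : Fin n) :
    ContDiffAt ℝ ∞ (pd i f) u :=
  (hf.fderiv_right (m := ∞) (by simp)).clm_apply contDiffAt_const

theorem contDiffAt_coord {m : ℕ} {f : E n → E m} {u : E n} (hf : ContDiffAt ℝ ∞ f u) (b : Fin m) :
    ContDiffAt ℝ ∞ (fun v => f v b) u :=
  (EuclideanSpace.proj (𝕜 := ℝ) b).contDiff.contDiffAt.comp u hf

theorem differentiableAt_coord {m : ℕ} {f : E n → E m} {u : E n} (hf : DifferentiableAt ℝ f u)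
    (b : Fin m) : DifferentiableAt ℝ (fun v => f v b) u :=
  ((EuclideanSpace.proj (𝕜 := ℝ) b).hasFDerivAt.comp u hf.hasFDerivAt).differentiableAt

theorem differentiableAt_div {a b : E n → ℝ} {u : E n} (ha : DifferentiableAt ℝ a u)
    (hb : DifferentiableAt ℝ b u) (h0 : b u ≠ 0) : DifferentiableAt ℝ (fun v => a v / b v) u := by
  simpa only [div_eq_mul_inv] using ha.fun_mul (hb.fun_inv h0)

theorem pd_congr {f g : E n → F} {u : E n} (h : f =ᶠ[𝓝 u] g) (i : Fin n) : pd i f u = pd i g u := by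
  rw [pd, pd, h.fderiv_eq]

theorem pd_coord {m : ℕ} {f : E n → E m} {u : E n} (hf : DifferentiableAt ℝ f u) (i : Fin n)
    (b : Fin m) : pd i (fun v => f v b) u = pd i f u b := by
  have := ((EuclideanSpace.proj (𝕜 := ℝ) b).hasFDerivAt.comp u hf.hasFDerivAt).fderiv
  rw [pd, pd]
  exact congrArg (fun L => L (EuclideanSpace.single i 1)) this

theorem pd_const (c : F) (i : Fin n) (u : E n) : pd i (fun _ => c) u = 0 := by simp [pd]

theorem pd_add {f g : E n → F} {u : E n} (hf : DifferentiableAt ℝ f u)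
    (hg : DifferentiableAt ℝ g u) (i : Fin n) :
    pd i (fun v => f v + g v) u = pd i f u + pd i g u := by
  rw [pd, fderiv_fun_add hf hg]; rfl

theorem pd_sub {f g : E n → F} {u : E n} (hf : DifferentiableAt ℝ f u)
    (hg : DifferentiableAt ℝ g u) (i : Fin n) :
    pd i (fun v => f v - g v) u = pd i f u - pd i g u := by
  rw [pd, fderiv_fun_sub hf hg]; rfl

theorem pd_smul {a : E n → ℝ} {f : E n → F} {u : E n} (ha : DifferentiableAt ℝ a u)
    (hf : DifferentiableAt ℝ f u) (i : Fin n) :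
    pd i (fun v => a v • f v) u = pd i a u • f u + a u • pd i f u := by
  rw [pd, fderiv_fun_smul ha hf]; simp [pd, add_comm]

theorem pd_mul {a b : E n → ℝ} {u : E n} (ha : DifferentiableAt ℝ a u)
    (hb : DifferentiableAt ℝ b u) (i : Fin n) :
    pd i (fun v => a v * b v) u = pd i a u * b u + a u * pd i b u :=
  pd_smul ha hb i

theorem pd_const_mul {a : E n → ℝ} {u : E n} (ha : DifferentiableAt ℝ a u) (c : ℝ) (i : Fin n) :
    pd i (fun v => c * a v) u = c * pd i a u := by
  rw [pd_mul (by fun_prop) ha, pd_const]; ring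

theorem pd_const_smul {f : E n → F} {u : E n} (hf : DifferentiableAt ℝ f u) (c : ℝ) (i : Fin n) :
    pd i (fun v => c • f v) u = c • pd i f u := by
  rw [pd_smul (by fun_prop) hf, pd_const]; simp

theorem pd_sum {ι : Type*} (s : Finset ι) {f : ι → E n → F} {u : E n}
    (hf : ∀ k ∈ s, DifferentiableAt ℝ (f k) u) (i : Fin n) :
    pd i (fun v => ∑ k ∈ s, f k v) u = ∑ k ∈ s, pd i (f k) u := by
  rw [pd, fderiv_fun_sum hf]; simp [pd]

theorem pd_comm {f : E n → F} {u : E n} (hf : ContDiffAt ℝ ∞ f u) (i j : Fin n) :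
    pd i (pd j f) u = pd j (pd i f) u := by
  have hd : DifferentiableAt ℝ (fderiv ℝ f) u :=
    (hf.fderiv_right (m := ∞) (by simp)).differentiableAt_infty
  have key (k l : Fin n) : pd k (pd l f) u =
      fderiv ℝ (fderiv ℝ f) u (EuclideanSpace.single k 1) (EuclideanSpace.single l 1) := by
    have : pd l f = fun v => fderiv ℝ f v (EuclideanSpace.single l 1) := rfl
    rw [pd, this, fderiv_clm_apply hd (by fun_prop)]
    simp
  rw [key, key]
  have h2 : ((2 : ℕ∞) : WithTop ℕ∞) ≤ ∞ := WithTop.coe_le_coe.2 le_top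
  exact hf.isSymmSndFDerivAt (by simpa using h2) _ _

/-- A derivative is determined by the partial derivatives. -/
theorem fderiv_eq_sum_pd (f : E n → F) (u v : E n) : fderiv ℝ f u v = ∑ i, v i • pd i f u := by
  have hv : v = ∑ i, v i • (EuclideanSpace.single i (1 : ℝ) : E n) := by
    ext j
    simp [Finset.sum_apply, Pi.single_apply]
  conv_lhs => rw [hv]
  simp [pd]

theorem pd_comp {m : ℕ} {g : E m → F} {τ : E n → E m} {u : E n}
    (hg : DifferentiableAt ℝ g (τ u)) (hτ : DifferentiableAt ℝ τ u) (i : Fin n) :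
    pd i (fun v => g (τ v)) u = ∑ k, pd i τ u k • pd k g (τ u) := by
  rw [pd, fderiv_fun_comp u hg hτ, ContinuousLinearMap.comp_apply, fderiv_eq_sum_pd g]
  rfl

theorem pd_comp_real {φ : ℝ → ℝ} {φ' : ℝ} {y : E n → ℝ} {u : E n} (hφ : HasDerivAt φ φ' (y u))
    (hy : DifferentiableAt ℝ y u) (i : Fin n) : pd i (fun v => φ (y v)) u = φ' * pd i y u := by
  have := (hφ.comp_hasFDerivAt u hy.hasFDerivAt).fderiv
  rw [pd]
  exact congrArg (fun L => L (EuclideanSpace.single i 1)) this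

theorem pd_div {a b : E n → ℝ} {u : E n} (ha : DifferentiableAt ℝ a u)
    (hb : DifferentiableAt ℝ b u) (h0 : b u ≠ 0) (i : Fin n) :
    pd i (fun v => a v / b v) u = (pd i a u * b u - a u * pd i b u) / b u ^ 2 := by
  simp only [div_eq_mul_inv]
  rw [pd_mul ha (hb.fun_inv h0), pd_comp_real (hasDerivAt_inv h0) hb]
  field_simp
  ring

theorem pd_log {y : E n → ℝ} {u : E n} (hy : DifferentiableAt ℝ y u) (h0 : y u ≠ 0) (i : Fin n) :
    pd i (fun v => Real.log (y v)) u = pd i y u / y u := by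
  rw [pd_comp_real (Real.hasDerivAt_log h0) hy, div_eq_inv_mul]

/-- Uniqueness for linear total differential systems: a solution of `∂ᵢ y = mᵢ y` that vanishes at
a point vanishes near it, by Grönwall's inequality along the rays from the point. -/
theorem eventually_eq_zero_of_pd_eq {ι : Type*} [Fintype ι] {Ω : Set (E n)} (hΩ : IsOpen Ω)
    {u₀ : E n} (hu₀ : u₀ ∈ Ω) {y : ι → E n → ℝ} {m : Fin n → ι → ι → E n → ℝ}
    (hy : ∀ a, ∀ u ∈ Ω, DifferentiableAt ℝ (y a) u)
    (hm : ∀ i a b, ∀ u ∈ Ω, ContinuousAt (m i a b) u)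
    (hpd : ∀ i a, ∀ u ∈ Ω, pd i (y a) u = ∑ b, m i a b u * y b u) (h0 : ∀ a, y a u₀ = 0) :
    ∀ᶠ u in 𝓝 u₀, ∀ a, y a u = 0 := by
  obtain ⟨r, hr, hball⟩ := Metric.isOpen_iff.1 hΩ u₀ hu₀
  filter_upwards [Metric.ball_mem_nhds u₀ hr] with u hu
  set v := u - u₀ with hv
  have hseg : ∀ t ∈ Set.Icc (0 : ℝ) 1, u₀ + t • v ∈ Ω := by
    intro t ht
    apply hball
    rw [Metric.mem_ball, dist_eq_norm] at hu ⊢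
    rw [add_sub_cancel_left, norm_smul, Real.norm_of_nonneg ht.1]
    calc t * ‖v‖ ≤ 1 * ‖v‖ := by gcongr; exact ht.2
      _ < r := by rwa [one_mul]
  have hγ : ∀ t : ℝ, HasDerivAt (fun t : ℝ => u₀ + t • v) v t := fun t => by
    simpa using ((hasDerivAt_id t).smul_const v).const_add u₀
  let g : ℝ → ι → ℝ := fun t a => y a (u₀ + t • v)
  let g' : ℝ → ι → ℝ := fun t a => ∑ i, v i * ∑ b, m i a b (u₀ + t • v) * g t b
  have hg : ∀ t ∈ Set.Icc (0 : ℝ) 1, HasDerivAt g (g' t) t := by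
    intro t ht
    rw [hasDerivAt_pi]
    intro a
    have := ((hy a _ (hseg t ht)).hasFDerivAt.comp_hasDerivAt t (hγ t))
    rw [fderiv_eq_sum_pd] at this
    refine this.congr_deriv ?_
    simp only [g', smul_eq_mul]
    exact Finset.sum_congr rfl fun i _ => by rw [hpd i a _ (hseg t ht)]
  -- A bound for the operator norms along the segment from `u₀` to `u`.
  let κ : ℝ → ℝ := fun t => ∑ i, |v i| * ∑ a, ∑ b, |m i a b (u₀ + t • v)|
  have hκ : ContinuousOn κ (Set.Icc 0 1) := by
    intro t ht
    apply ContinuousAt.continuousWithinAt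
    have (i : Fin n) (a b : ι) : ContinuousAt (fun t : ℝ => m i a b (u₀ + t • v)) t :=
      ContinuousAt.comp (f := fun t : ℝ => u₀ + t • v) (hm i a b _ (hseg t ht))
        (hγ t).continuousAt
    exact tendsto_finsetSum _ fun i _ => tendsto_const_nhds.mul <|
      tendsto_finsetSum _ fun a _ => tendsto_finsetSum _ fun b _ => (this i a b).abs
  obtain ⟨K, hK⟩ := isCompact_Icc.bddAbove_image hκ
  have hbound : ∀ t ∈ Set.Ico (0 : ℝ) 1, ‖g' t‖ ≤ K * ‖g t‖ := by
    intro t ht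
    have hκK : κ t ≤ K := hK ⟨t, ⟨ht.1, ht.2.le⟩, rfl⟩
    refine le_trans ?_ (mul_le_mul_of_nonneg_right hκK (norm_nonneg _))
    refine (pi_norm_le_iff_of_nonneg (by positivity)).2 fun a => ?_
    simp only [g', κ, Finset.sum_mul, Real.norm_eq_abs]
    refine (Finset.abs_sum_le_sum_abs _ _).trans (Finset.sum_le_sum fun i _ => ?_)
    rw [abs_mul, mul_assoc]
    gcongr
    have hterm (b : ι) : |m i a b (u₀ + t • v) * g t b| ≤ |m i a b (u₀ + t • v)| * ‖g t‖ := by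
      rw [abs_mul]
      gcongr
      exact norm_le_pi_norm (g t) b
    calc |∑ b, m i a b (u₀ + t • v) * g t b|
        ≤ ∑ b, |m i a b (u₀ + t • v)| * ‖g t‖ :=
          (Finset.abs_sum_le_sum_abs _ _).trans (Finset.sum_le_sum fun b _ => hterm b)
      _ = (∑ b, |m i a b (u₀ + t • v)|) * ‖g t‖ := by rw [Finset.sum_mul]
      _ ≤ (∑ a, ∑ b, |m i a b (u₀ + t • v)|) * ‖g t‖ := by
          refine mul_le_mul_of_nonneg_right ?_ (norm_nonneg _)
          exact Finset.single_le_sum (f := fun a => ∑ b, |m i a b (u₀ + t • v)|)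
            (fun _ _ => Finset.sum_nonneg fun _ _ => abs_nonneg _) (Finset.mem_univ a)
  have := eq_zero_of_abs_deriv_le_mul_abs_self_of_eq_zero_right
    (fun t ht => (hg t ht).continuousAt.continuousWithinAt)
    (fun t ht => (hg t ⟨ht.1, ht.2.le⟩).hasDerivWithinAt)
    (by funext a; simp [g, h0]) hbound 1 (by simp)
  intro a
  simpa [g, hv] using congrFun this a

/-- A function whose partial derivatives vanish near a point is constant near it. -/
theorem eventually_eq_of_pd_eq_zero {u₀ : E n} {y : E n → ℝ}
    (hy : ∀ᶠ u in 𝓝 u₀, DifferentiableAt ℝ y u) (hpd : ∀ᶠ u in 𝓝 u₀, ∀ i, pd i y u = 0) :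
    ∀ᶠ u in 𝓝 u₀, y u = y u₀ := by
  obtain ⟨Ω, hsub, hΩ, hu₀⟩ := eventually_nhds_iff.1 (hy.and hpd)
  have := eventually_eq_zero_of_pd_eq (ι := Unit) hΩ hu₀ (y := fun _ u => y u - y u₀)
    (m := fun _ _ _ _ => 0) (fun _ u hu => (hsub u hu).1.sub_const _)
    (fun _ _ _ _ _ => continuousAt_const)
    (fun i _ u hu => by
      rw [pd_sub (hsub u hu).1 (by fun_prop), (hsub u hu).2 i, pd_const]; simp)
    (fun _ => sub_self _)
  filter_upwards [this] with u hu using sub_eq_zero.1 (hu ())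

end Calculus

/-! ### The frame and the smoothness of the structure coefficients -/

section Frame

variable {n : ℕ} {ε : ℝ} {f : E n → E (n + 1)} {u : E n}

theorem vecMul_frame (c : Fin (n + 1) → ℝ) :
    c ᵥ* frame ε f u = fun b =>
      (∑ k : Fin n, c k.castSucc • pd k f u + c (Fin.last n) • ((-ε) • f u)) b := by
  ext b
  simp [Matrix.vecMul, dotProduct, Fin.sum_univ_castSucc, frame]

/-- The vectors of the frame are linearly independent. -/
theorem frame_coeff_unique (hu : IsUnit (frame ε f u).det) {a a' : Fin n → ℝ} {b b' : ℝ}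
    (h : ∑ k, a k • pd k f u + b • ((-ε) • f u) = ∑ k, a' k • pd k f u + b' • ((-ε) • f u)) :
    a = a' ∧ b = b' := by
  have key : (Fin.snoc a b : Fin (n + 1) → ℝ) ᵥ* frame ε f u =
      (Fin.snoc a' b' : Fin (n + 1) → ℝ) ᵥ* frame ε f u := by
    rw [vecMul_frame, vecMul_frame]
    simp only [Fin.snoc_castSucc, Fin.snoc_last]
    rw [h]
  have := Matrix.vecMul_injective_of_isUnit ((Matrix.isUnit_iff_isUnit_det _).2 hu) key
  exact ⟨funext fun k => by simpa using congrFun this k.castSucc,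
    by simpa using congrFun this (Fin.last n)⟩

theorem contDiffAt_det {V m : Type*} [NormedAddCommGroup V] [NormedSpace ℝ V] [Fintype m]
    [DecidableEq m] {A : V → Matrix m m ℝ} {v : V}
    (hA : ∀ a b, ContDiffAt ℝ ∞ (fun w => A w a b) v) : ContDiffAt ℝ ∞ (fun w => (A w).det) v := by
  simp only [Matrix.det_apply]
  exact ContDiffAt.sum fun σ _ => (contDiffAt_prod fun i _ => hA _ _).const_smul _

theorem contDiffAt_matrix_inv {V m : Type*} [NormedAddCommGroup V] [NormedSpace ℝ V] [Fintype m]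
    [DecidableEq m] {A : V → Matrix m m ℝ} {v : V}
    (hA : ∀ a b, ContDiffAt ℝ ∞ (fun w => A w a b) v) (hdet : IsUnit (A v).det) (a b : m) :
    ContDiffAt ℝ ∞ (fun w => (A w)⁻¹ a b) v := by
  simp only [Matrix.inv_def, Matrix.smul_apply, Ring.inverse_eq_inv', smul_eq_mul,
    Matrix.adjugate_apply]
  refine ((contDiffAt_det hA).inv hdet.ne_zero).mul (contDiffAt_det fun c d => ?_)
  by_cases hc : c = b
  · subst hc
    simpa using contDiffAt_const
  · simpa [Matrix.updateRow_ne hc] using hA c d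

theorem contDiffAt_frame (hf : ContDiffAt ℝ ∞ f u) (a b : Fin (n + 1)) :
    ContDiffAt ℝ ∞ (fun v => frame ε f v a b) u := by
  simp only [frame, Matrix.of_apply]
  induction a using Fin.lastCases with
  | last => simpa using (contDiffAt_const (c := -ε)).mul (contDiffAt_coord hf b)
  | cast k => simpa using contDiffAt_coord (contDiffAt_pd hf k) b

theorem contDiffAt_gaussCoeff (hf : ContDiffAt ℝ ∞ f u) (hu : IsUnit (frame ε f u).det)
    (i j : Fin n) (c : Fin (n + 1)) : ContDiffAt ℝ ∞ (fun v => gaussCoeff ε f i j v c) u := by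
  simp only [gaussCoeff, Matrix.vecMul, dotProduct]
  exact ContDiffAt.sum fun b _ => (contDiffAt_coord (contDiffAt_pd (contDiffAt_pd hf j) i) b).mul
    (contDiffAt_matrix_inv (contDiffAt_frame hf) hu b c)

theorem contDiffAt_metric (hf : ContDiffAt ℝ ∞ f u) (hu : IsUnit (frame ε f u).det)
    (i j : Fin n) : ContDiffAt ℝ ∞ (metric ε f i j) u :=
  contDiffAt_gaussCoeff hf hu i j _

theorem contDiffAt_inducedChristoffel (hf : ContDiffAt ℝ ∞ f u) (hu : IsUnit (frame ε f u).det)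
    (k i j : Fin n) : ContDiffAt ℝ ∞ (inducedChristoffel ε f k i j) u :=
  contDiffAt_gaussCoeff hf hu i j _

theorem contDiffAt_cubicForm (hf : ContDiffAt ℝ ∞ f u) (hu : IsUnit (frame ε f u).det)
    (i j k : Fin n) : ContDiffAt ℝ ∞ (cubicForm ε f i j k) u := by
  have h1 := contDiffAt_pd (contDiffAt_metric hf hu j k) i
  have h2 := fun l a b => contDiffAt_inducedChristoffel hf hu l a b
  have h3 := fun a b => contDiffAt_metric hf hu a b
  exact (h1.sub (ContDiffAt.sum fun l _ => (h2 l i j).mul (h3 l k))).sub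
    (ContDiffAt.sum fun l _ => (h2 l i k).mul (h3 j l))

theorem contDiffAt_leviCivitaChristoffel (hf : ContDiffAt ℝ ∞ f u)
    (hu : IsUnit (frame ε f u).det) (hh : IsUnit (metricMatrix ε f u).det) (k i j : Fin n) :
    ContDiffAt ℝ ∞ (leviCivitaChristoffel ε f k i j) u := by
  have h3 := fun a b c => contDiffAt_pd (contDiffAt_metric hf hu a b) c
  have h4 := fun a b => contDiffAt_matrix_inv
    (A := metricMatrix ε f) (v := u) (fun a b => contDiffAt_metric hf hu a b) hh a b
  exact contDiffAt_const.mul (ContDiffAt.sum fun l _ =>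
    (h4 k l).mul (((h3 j l i).add (h3 i l j)).sub (h3 i j l)))

theorem gaussCoeff_comm (hf : ContDiffAt ℝ ∞ f u) (i j : Fin n) :
    gaussCoeff ε f i j u = gaussCoeff ε f j i u := by
  rw [gaussCoeff, gaussCoeff, pd_comm hf]

theorem metric_comm (hf : ContDiffAt ℝ ∞ f u) (i j : Fin n) :
    metric ε f i j u = metric ε f j i u :=
  congrFun (gaussCoeff_comm hf i j) _

theorem inducedChristoffel_comm (hf : ContDiffAt ℝ ∞ f u) (k i j : Fin n) :
    inducedChristoffel ε f k i j u = inducedChristoffel ε f k j i u :=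
  congrFun (gaussCoeff_comm hf i j) _

/-- The third derivatives of `f` in the frame. -/
theorem pd_pd_pd_eq {Ω : Set (E n)} (hΩ : IsOpen Ω) (hf : ∀ v ∈ Ω, ContDiffAt ℝ ∞ f v)
    (hF : ∀ v ∈ Ω, IsUnit (frame ε f v).det) (hu : u ∈ Ω) (i j k : Fin n) :
    pd i (pd j (pd k f)) u =
      ∑ l, (pd i (inducedChristoffel ε f l j k) u
          + ∑ m, inducedChristoffel ε f m j k u * inducedChristoffel ε f l i m u
          - ε * metric ε f j k u * (if l = i then 1 else 0)) • pd l f u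
        + (pd i (metric ε f j k) u
          + ∑ m, inducedChristoffel ε f m j k u * metric ε f i m u) • ((-ε) • f u) := by
  have hev : pd j (pd k f) =ᶠ[𝓝 u] fun v => ∑ l, inducedChristoffel ε f l j k v • pd l f v
      + metric ε f j k v • ((-ε) • f v) := by
    filter_upwards [hΩ.mem_nhds hu] with v hv using gauss_formula ε f v (hF v hv) j k
  have d1 := fun l =>
    (contDiffAt_inducedChristoffel (hf u hu) (hF u hu) l j k).differentiableAt_infty
  have d2 := (contDiffAt_metric (hf u hu) (hF u hu) j k).differentiableAt_infty
  have d3 := (hf u hu).differentiableAt_infty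
  have d4 := fun l => (contDiffAt_pd (hf u hu) l).differentiableAt_infty
  have d5 : DifferentiableAt ℝ (fun v => (-ε) • f v) u := by fun_prop
  rw [pd_congr hev, pd_add (DifferentiableAt.fun_sum fun l _ => (d1 l).fun_smul (d4 l))
    (d2.fun_smul d5), pd_sum _ fun l _ => (d1 l).fun_smul (d4 l), pd_smul d2 d5, pd_const_smul d3]
  simp only [pd_smul (d1 _) (d4 _), gauss_formula ε f u (hF u hu) i]
  simp only [Finset.sum_add_distrib, smul_add, add_smul, sub_smul, Finset.smul_sum, smul_smul,
    Finset.sum_sub_distrib, Finset.sum_smul, mul_ite, mul_one, mul_zero, ite_smul, zero_smul,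
    Finset.sum_ite_eq', Finset.mem_univ, if_true]
  rw [Finset.sum_comm]
  simp only [mul_comm, mul_neg, neg_smul, mul_left_comm, mul_add, Finset.mul_sum, add_smul,
    Finset.sum_smul,
    Finset.sum_neg_distrib]
  abel

/-- The Codazzi equation, the `f`-component of the symmetry of the third derivatives. -/
theorem codazzi {Ω : Set (E n)} (hΩ : IsOpen Ω) (hf : ∀ v ∈ Ω, ContDiffAt ℝ ∞ f v)
    (hF : ∀ v ∈ Ω, IsUnit (frame ε f v).det) (hu : u ∈ Ω)
    (i j k : Fin n) :
    pd i (metric ε f j k) u + ∑ m, inducedChristoffel ε f m j k u * metric ε f i m u =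
      pd j (metric ε f i k) u + ∑ m, inducedChristoffel ε f m i k u * metric ε f j m u := by
  have h := pd_comm (contDiffAt_pd (hf u hu) k) i j
  rw [pd_pd_pd_eq hΩ hf hF hu, pd_pd_pd_eq hΩ hf hF hu] at h
  exact (frame_coeff_unique (hF u hu) h).2

/-- The Gauss equation, the tangential component of the symmetry of the third derivatives. -/
theorem gauss_equation {Ω : Set (E n)} (hΩ : IsOpen Ω) (hf : ∀ v ∈ Ω, ContDiffAt ℝ ∞ f v)
    (hF : ∀ v ∈ Ω, IsUnit (frame ε f v).det) (hu : u ∈ Ω)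
    (i j k l : Fin n) :
    pd i (inducedChristoffel ε f l j k) u
          + ∑ m, inducedChristoffel ε f m j k u * inducedChristoffel ε f l i m u
          - ε * metric ε f j k u * (if l = i then 1 else 0) =
      pd j (inducedChristoffel ε f l i k) u
          + ∑ m, inducedChristoffel ε f m i k u * inducedChristoffel ε f l j m u
          - ε * metric ε f i k u * (if l = j then 1 else 0) := by
  have h := pd_comm (contDiffAt_pd (hf u hu) k) i j
  rw [pd_pd_pd_eq hΩ hf hF hu, pd_pd_pd_eq hΩ hf hF hu] at h
  exact congrFun (frame_coeff_unique (hF u hu) h).1 l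

end Frame

/-! ### The structure equations of a locally strongly convex surface patch -/

/-- A parametrized centroaffine surface over the open set `Ω` whose centroaffine metric is positive
definite. -/
structure IsConvexPatch (ε : ℝ) (f : E 2 → E 3) (Ω : Set (E 2)) : Prop where
  isOpen : IsOpen Ω
  contDiffAt : ∀ u ∈ Ω, ContDiffAt ℝ ∞ f u
  posDef : ∀ u ∈ Ω, (metricMatrix ε f u).PosDef

/-- Component `Kᵏᵢⱼ = Γᵏᵢⱼ - Γ̂ᵏᵢⱼ` of the difference `K = ∇ - ∇̂` of the two connections. -/
noncomputable def connectionDifference (ε : ℝ) (f : E 2 → E 3) (k i j : Fin 2) (u : E 2) : ℝ :=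
  inducedChristoffel ε f k i j u - leviCivitaChristoffel ε f k i j u

/-- A singular frame has junk inverse `0`, hence metric `0`: positive definiteness of the metric
forces the frame to be a basis. -/
theorem isUnit_det_frame_of_posDef {ε : ℝ} {f : E 2 → E 3} {u : E 2}
    (h : (metricMatrix ε f u).PosDef) : IsUnit (frame ε f u).det := by
  by_contra hu
  have : metricMatrix ε f u 0 0 = 0 := by
    simp [metricMatrix, metric, gaussCoeff, Matrix.nonsing_inv_apply_not_isUnit _ hu]
  exact (h.diag_pos (i := 0)).ne' this

namespace IsConvexPatch

variable {ε : ℝ} {f : E 2 → E 3} {Ω : Set (E 2)} {u : E 2}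

theorem isUnit_frame (h : IsConvexPatch ε f Ω) (hu : u ∈ Ω) : IsUnit (frame ε f u).det :=
  isUnit_det_frame_of_posDef (h.posDef u hu)

theorem metric_comm (h : IsConvexPatch ε f Ω) (hu : u ∈ Ω) (i j : Fin 2) :
    metric ε f i j u = metric ε f j i u :=
  Centroaffine.metric_comm (h.contDiffAt u hu) i j

theorem isUnit_metric (h : IsConvexPatch ε f Ω) (hu : u ∈ Ω) :
    IsUnit (metricMatrix ε f u).det :=
  (h.posDef u hu).det_pos.ne'.isUnit

theorem contDiffAt_metric (h : IsConvexPatch ε f Ω) (hu : u ∈ Ω) (i j : Fin 2) :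
    ContDiffAt ℝ ∞ (metric ε f i j) u :=
  Centroaffine.contDiffAt_metric (h.contDiffAt u hu) (h.isUnit_frame hu) i j

theorem contDiffAt_cubicForm (h : IsConvexPatch ε f Ω) (hu : u ∈ Ω) (i j k : Fin 2) :
    ContDiffAt ℝ ∞ (cubicForm ε f i j k) u :=
  Centroaffine.contDiffAt_cubicForm (h.contDiffAt u hu) (h.isUnit_frame hu) i j k

theorem contDiffAt_leviCivita (h : IsConvexPatch ε f Ω) (hu : u ∈ Ω) (k i j : Fin 2) :
    ContDiffAt ℝ ∞ (leviCivitaChristoffel ε f k i j) u :=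
  contDiffAt_leviCivitaChristoffel (h.contDiffAt u hu) (h.isUnit_frame hu) (h.isUnit_metric hu)
    k i j

theorem contDiffAt_induced (h : IsConvexPatch ε f Ω) (hu : u ∈ Ω) (k i j : Fin 2) :
    ContDiffAt ℝ ∞ (inducedChristoffel ε f k i j) u :=
  contDiffAt_inducedChristoffel (h.contDiffAt u hu) (h.isUnit_frame hu) k i j

theorem contDiffAt_difference (h : IsConvexPatch ε f Ω) (hu : u ∈ Ω) (k i j : Fin 2) :
    ContDiffAt ℝ ∞ (connectionDifference ε f k i j) u :=
  (h.contDiffAt_induced hu k i j).sub (h.contDiffAt_leviCivita hu k i j)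

theorem pd_metric_comm (h : IsConvexPatch ε f Ω) (hu : u ∈ Ω) (l i j : Fin 2) :
    pd l (metric ε f i j) u = pd l (metric ε f j i) u := by
  refine pd_congr ?_ l
  filter_upwards [h.isOpen.mem_nhds hu] with v hv using h.metric_comm hv i j

theorem metric_det_ne_zero (h : IsConvexPatch ε f Ω) (hu : u ∈ Ω) :
    metric ε f 0 0 u * metric ε f 1 1 u - metric ε f 0 1 u * metric ε f 1 0 u ≠ 0 := by
  have := (h.isUnit_metric hu).ne_zero
  rwa [Matrix.det_fin_two] at this

/-- The metric is nondegenerate: vectors with the same lowered components agree. -/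
theorem eq_of_lower_eq (h : IsConvexPatch ε f Ω) (hu : u ∈ Ω) {a b : Fin 2 → ℝ}
    (hab : ∀ m, ∑ k, a k * metric ε f k m u = ∑ k, b k * metric ε f k m u) : a = b := by
  have hd := h.metric_det_ne_zero hu
  have h0 := hab 0
  have h1 := hab 1
  simp only [Fin.sum_univ_two] at h0 h1
  funext k
  apply mul_left_cancel₀ hd
  fin_cases k
  · simp only [Fin.zero_eta]
    linear_combination metric ε f 1 1 u * h0 - metric ε f 1 0 u * h1
  · simp only [Fin.mk_one]
    linear_combination metric ε f 0 0 u * h1 - metric ε f 0 1 u * h0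

theorem leviCivita_lower (h : IsConvexPatch ε f Ω) (hu : u ∈ Ω) (i j m : Fin 2) :
    ∑ k, leviCivitaChristoffel ε f k i j u * metric ε f k m u =
      (1 / 2) * (pd i (metric ε f j m) u + pd j (metric ε f i m) u - pd m (metric ε f i j) u) := by
  have e : ∀ l, ∑ k, metric ε f k m u * (metricMatrix ε f u)⁻¹ k l = if m = l then 1 else 0 := by
    intro l
    have := congrFun (congrFun (Matrix.mul_nonsing_inv _ (h.isUnit_metric hu)) m) l
    rw [Matrix.mul_apply, Matrix.one_apply] at this
    rw [← this]
    exact Finset.sum_congr rfl fun k _ => by rw [h.metric_comm hu k m]; rfl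
  have e0 := e 0
  have e1 := e 1
  simp only [leviCivitaChristoffel, Fin.sum_univ_two] at e0 e1 ⊢
  fin_cases m
  · simp at e0 e1 ⊢
    linear_combination (1 / 2) * (pd i (metric ε f j 0) u + pd j (metric ε f i 0) u
      - pd 0 (metric ε f i j) u) * e0 + (1 / 2) * (pd i (metric ε f j 1) u
      + pd j (metric ε f i 1) u - pd 1 (metric ε f i j) u) * e1
  · simp at e0 e1 ⊢
    linear_combination (1 / 2) * (pd i (metric ε f j 0) u + pd j (metric ε f i 0) u
      - pd 0 (metric ε f i j) u) * e0 + (1 / 2) * (pd i (metric ε f j 1) u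
      + pd j (metric ε f i 1) u - pd 1 (metric ε f i j) u) * e1

theorem leviCivita_comm (h : IsConvexPatch ε f Ω) (hu : u ∈ Ω) (k i j : Fin 2) :
    leviCivitaChristoffel ε f k i j u = leviCivitaChristoffel ε f k j i u := by
  refine congrFun (h.eq_of_lower_eq hu (a := fun k => leviCivitaChristoffel ε f k i j u)
    (b := fun k => leviCivitaChristoffel ε f k j i u) fun m => ?_) k
  rw [h.leviCivita_lower hu, h.leviCivita_lower hu, h.pd_metric_comm hu m i j]
  ring

theorem induced_comm (h : IsConvexPatch ε f Ω) (hu : u ∈ Ω) (k i j : Fin 2) :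
    inducedChristoffel ε f k i j u = inducedChristoffel ε f k j i u :=
  inducedChristoffel_comm (h.contDiffAt u hu) k i j

theorem difference_comm (h : IsConvexPatch ε f Ω) (hu : u ∈ Ω) (k i j : Fin 2) :
    connectionDifference ε f k i j u = connectionDifference ε f k j i u := by
  rw [connectionDifference, connectionDifference, h.induced_comm hu, h.leviCivita_comm hu]

theorem cubicForm_comm_right (h : IsConvexPatch ε f Ω) (hu : u ∈ Ω) (i j k : Fin 2) :
    cubicForm ε f i j k u = cubicForm ε f i k j u := by
  simp only [cubicForm, Fin.sum_univ_two, h.pd_metric_comm hu i j k, h.metric_comm hu 0 k,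
    h.metric_comm hu 1 k, h.metric_comm hu 0 j, h.metric_comm hu 1 j]
  ring

theorem cubicForm_comm_left (h : IsConvexPatch ε f Ω) (hu : u ∈ Ω) (i j k : Fin 2) :
    cubicForm ε f i j k u = cubicForm ε f j i k u := by
  have := codazzi h.isOpen h.contDiffAt (fun v hv => h.isUnit_frame hv) hu i j k
  simp only [cubicForm, Fin.sum_univ_two, h.induced_comm hu _ i j] at this ⊢
  linear_combination this

/-- The metric is parallel for its Levi-Civita connection. -/
theorem pd_metric (h : IsConvexPatch ε f Ω) (hu : u ∈ Ω) (l i j : Fin 2) :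
    pd l (metric ε f i j) u = ∑ m, leviCivitaChristoffel ε f m l i u * metric ε f m j u
      + ∑ m, leviCivitaChristoffel ε f m l j u * metric ε f m i u := by
  rw [h.leviCivita_lower hu, h.leviCivita_lower hu, h.pd_metric_comm hu l j i,
    h.pd_metric_comm hu j l i, h.pd_metric_comm hu i l j]
  ring

/-- Lowering an index turns `∇ - ∇̂` into `-C / 2`. -/
theorem difference_lower (h : IsConvexPatch ε f Ω) (hu : u ∈ Ω) (i j m : Fin 2) :
    ∑ k, connectionDifference ε f k i j u * metric ε f k m u =
      -(1 / 2) * cubicForm ε f i j m u := by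
  have h1 := h.leviCivita_lower hu i j m
  simp only [cubicForm, Fin.sum_univ_two, connectionDifference] at h1 ⊢
  have s1 := h.cubicForm_comm_left hu i j m
  have s2 := h.cubicForm_comm_left hu m i j
  simp only [cubicForm, Fin.sum_univ_two] at s1 s2
  rw [h.induced_comm hu 0 j i, h.induced_comm hu 1 j i, h.pd_metric_comm hu i m j] at *
  rw [h.induced_comm hu 0 m i, h.induced_comm hu 1 m i] at *
  rw [h.induced_comm hu 0 m j, h.induced_comm hu 1 m j] at *
  simp only [h.metric_comm hu i 0, h.metric_comm hu i 1, h.metric_comm hu j 0, h.metric_comm hu j 1,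
    h.metric_comm hu m 0, h.metric_comm hu m 1] at *
  linear_combination -h1 + (1/2) * s1 + (1/2) * s2

end IsConvexPatch

/-! ### Consequences of a parallel cubic form -/

/-- The components `R̂₀₁ₖˡ` of the curvature of the Levi-Civita connection. -/
noncomputable def leviCivitaCurvature (ε : ℝ) (f : E 2 → E 3) (k l : Fin 2) (u : E 2) : ℝ :=
  pd 0 (leviCivitaChristoffel ε f l 1 k) u - pd 1 (leviCivitaChristoffel ε f l 0 k) u
    + ∑ m, leviCivitaChristoffel ε f m 1 k u * leviCivitaChristoffel ε f l 0 m u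
    - ∑ m, leviCivitaChristoffel ε f m 0 k u * leviCivitaChristoffel ε f l 1 m u

/-- A convex patch whose cubic form is parallel. -/
structure IsParallelPatch (ε : ℝ) (f : E 2 → E 3) (Ω : Set (E 2)) : Prop
    extends IsConvexPatch ε f Ω where
  parallel : ∀ u ∈ Ω, ∀ l i j k, covDerivCubicForm ε f l i j k u = 0

namespace IsParallelPatch

variable {ε : ℝ} {f : E 2 → E 3} {Ω : Set (E 2)} {u : E 2}

theorem pd_cubicForm (h : IsParallelPatch ε f Ω) (hu : u ∈ Ω) (l i j k : Fin 2) :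
    pd l (cubicForm ε f i j k) u =
      ∑ m, leviCivitaChristoffel ε f m l i u * cubicForm ε f m j k u
      + ∑ m, leviCivitaChristoffel ε f m l j u * cubicForm ε f i m k u
      + ∑ m, leviCivitaChristoffel ε f m l k u * cubicForm ε f i j m u := by
  have := h.parallel u hu l i j k
  rw [covDerivCubicForm] at this
  linear_combination this

/-- Near a point where it vanishes, a parallel cubic form vanishes. -/
theorem eventually_cubicForm_eq_zero (h : IsParallelPatch ε f Ω) (hu : u ∈ Ω)
    (h0 : ∀ i j k, cubicForm ε f i j k u = 0) :
    ∀ᶠ v in 𝓝 u, ∀ i j k, cubicForm ε f i j k v = 0 := by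
  have := eventually_eq_zero_of_pd_eq (ι := Fin 2 × Fin 2 × Fin 2) h.isOpen hu
    (y := fun a => cubicForm ε f a.1 a.2.1 a.2.2)
    (m := fun l a b v =>
      (if b.2 = a.2 then leviCivitaChristoffel ε f b.1 l a.1 v else 0)
      + (if b.1 = a.1 ∧ b.2.2 = a.2.2 then leviCivitaChristoffel ε f b.2.1 l a.2.1 v else 0)
      + (if b.1 = a.1 ∧ b.2.1 = a.2.1 then leviCivitaChristoffel ε f b.2.2 l a.2.2 v else 0))
    (fun a v hv => (h.contDiffAt_cubicForm hv _ _ _).differentiableAt_infty)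
    (fun l a b v hv => by
      refine ((ContinuousAt.add ?_ ?_).add ?_) <;> split_ifs <;>
      first
      | exact (h.contDiffAt_leviCivita hv _ _ _).continuousAt
      | exact continuousAt_const)
    (fun l a v hv => by
      obtain ⟨i, j, k⟩ := a
      rw [h.pd_cubicForm hv]
      simp only [Fintype.sum_prod_type, Fin.sum_univ_two]
      fin_cases i <;> fin_cases j <;> fin_cases k <;> simp <;> ring)
    (fun a => h0 _ _ _)
  filter_upwards [this] with v hv i j k using hv (i, j, k)

theorem pd_pd_cubicForm (h : IsParallelPatch ε f Ω) (hu : u ∈ Ω) (n l i j k : Fin 2) :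
    pd n (pd l (cubicForm ε f i j k)) u =
      ∑ m, (pd n (leviCivitaChristoffel ε f m l i) u * cubicForm ε f m j k u
        + leviCivitaChristoffel ε f m l i u * pd n (cubicForm ε f m j k) u)
      + ∑ m, (pd n (leviCivitaChristoffel ε f m l j) u * cubicForm ε f i m k u
        + leviCivitaChristoffel ε f m l j u * pd n (cubicForm ε f i m k) u)
      + ∑ m, (pd n (leviCivitaChristoffel ε f m l k) u * cubicForm ε f i j m u
        + leviCivitaChristoffel ε f m l k u * pd n (cubicForm ε f i j m) u) := by
  have hev : pd l (cubicForm ε f i j k) =ᶠ[𝓝 u] fun v =>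
      ∑ m, leviCivitaChristoffel ε f m l i v * cubicForm ε f m j k v
      + ∑ m, leviCivitaChristoffel ε f m l j v * cubicForm ε f i m k v
      + ∑ m, leviCivitaChristoffel ε f m l k v * cubicForm ε f i j m v := by
    filter_upwards [h.isOpen.mem_nhds hu] with v hv using h.pd_cubicForm hv l i j k
  have dG := fun a b c => (h.contDiffAt_leviCivita hu a b c).differentiableAt_infty
  have dC := fun a b c => (h.contDiffAt_cubicForm hu a b c).differentiableAt_infty
  have d1 := fun m => (dG m l i).fun_mul (dC m j k)
  have d2 := fun m => (dG m l j).fun_mul (dC i m k)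
  have d3 := fun m => (dG m l k).fun_mul (dC i j m)
  have s1 := DifferentiableAt.fun_sum (u := Finset.univ) fun m _ => d1 m
  have s2 := DifferentiableAt.fun_sum (u := Finset.univ) fun m _ => d2 m
  have s3 := DifferentiableAt.fun_sum (u := Finset.univ) fun m _ => d3 m
  rw [pd_congr hev, pd_add (s1.fun_add s2) s3, pd_add s1 s2, pd_sum _ fun m _ => d1 m,
    pd_sum _ fun m _ => d2 m, pd_sum _ fun m _ => d3 m]
  simp only [pd_mul (dG _ _ _) (dC _ _ _)]

/-- The Ricci identity for the parallel cubic form: the curvature annihilates it. -/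
theorem ricci_identity (h : IsParallelPatch ε f Ω) (hu : u ∈ Ω) (i j k : Fin 2) :
    ∑ l, leviCivitaCurvature ε f i l u * cubicForm ε f l j k u
      + ∑ l, leviCivitaCurvature ε f j l u * cubicForm ε f i l k u
      + ∑ l, leviCivitaCurvature ε f k l u * cubicForm ε f i j l u = 0 := by
  have hc := pd_comm (h.contDiffAt_cubicForm hu i j k) 0 1
  rw [h.pd_pd_cubicForm hu, h.pd_pd_cubicForm hu] at hc
  simp only [h.pd_cubicForm hu, Fin.sum_univ_two] at hc
  simp only [leviCivitaCurvature, Fin.sum_univ_two]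
  linear_combination hc

/-- The difference tensor is parallel. -/
theorem pd_difference (h : IsParallelPatch ε f Ω) (hu : u ∈ Ω) (l k i j : Fin 2) :
    pd l (connectionDifference ε f k i j) u =
      ∑ m, leviCivitaChristoffel ε f m l i u * connectionDifference ε f k m j u
      + ∑ m, leviCivitaChristoffel ε f m l j u * connectionDifference ε f k i m u
      - ∑ m, leviCivitaChristoffel ε f k l m u * connectionDifference ε f m i j u := by
  refine congrFun (h.eq_of_lower_eq hu (a := fun k => pd l (connectionDifference ε f k i j) u)
    (b := fun k => ∑ m, leviCivitaChristoffel ε f m l i u * connectionDifference ε f k m j u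
      + ∑ m, leviCivitaChristoffel ε f m l j u * connectionDifference ε f k i m u
      - ∑ m, leviCivitaChristoffel ε f k l m u * connectionDifference ε f m i j u)
    fun p => ?_) k
  have hev : (fun v => ∑ k, connectionDifference ε f k i j v * metric ε f k p v) =ᶠ[𝓝 u]
      fun v => -(1 / 2) * cubicForm ε f i j p v := by
    filter_upwards [h.isOpen.mem_nhds hu] with v hv using h.difference_lower hv i j p
  have dK := fun a b c => (h.contDiffAt_difference hu a b c).differentiableAt_infty
  have dh := fun a b => (h.contDiffAt_metric hu a b).differentiableAt_infty
  have hpd := pd_congr hev l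
  rw [pd_sum _ fun m _ => (dK m i j).fun_mul (dh m p), pd_const_mul
    (h.contDiffAt_cubicForm hu i j p).differentiableAt_infty, h.pd_cubicForm hu] at hpd
  simp only [pd_mul (dK _ _ _) (dh _ _), h.pd_metric hu] at hpd
  have L := h.difference_lower hu
  have l1 := L 0 j p
  have l2 := L 1 j p
  have l3 := L i 0 p
  have l4 := L i 1 p
  have l5 := L i j 0
  have l6 := L i j 1
  simp only [Fin.sum_univ_two, h.metric_comm hu 1 0] at *
  let G := fun a b c => leviCivitaChristoffel ε f a b c u
  linear_combination hpd - G 0 l i * l1 - G 1 l i * l2 - G 0 l j * l3 - G 1 l j * l4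
    - G 0 l p * l5 - G 1 l p * l6

/-- The equation of Gauss: the terms linear in the difference tensor drop out, since it is
parallel. -/
theorem curvature_eq (h : IsParallelPatch ε f Ω) (hu : u ∈ Ω) (k l : Fin 2) :
    leviCivitaCurvature ε f k l u =
      ∑ m, connectionDifference ε f m 0 k u * connectionDifference ε f l 1 m u
      - ∑ m, connectionDifference ε f m 1 k u * connectionDifference ε f l 0 m u
      - ε * metric ε f 0 k u * (if l = 1 then 1 else 0)
      + ε * metric ε f 1 k u * (if l = 0 then 1 else 0) := by
  have hg := gauss_equation h.isOpen h.contDiffAt (fun v hv => h.isUnit_frame hv) hu 0 1 k l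
  have hpd : ∀ i j, pd i (inducedChristoffel ε f l j k) u =
      pd i (leviCivitaChristoffel ε f l j k) u + pd i (connectionDifference ε f l j k) u := by
    intro i j
    have : inducedChristoffel ε f l j k = fun v =>
        leviCivitaChristoffel ε f l j k v + connectionDifference ε f l j k v := by
      funext v; simp [connectionDifference]
    rw [this, pd_add (h.contDiffAt_leviCivita hu l j k).differentiableAt_infty
      (h.contDiffAt_difference hu l j k).differentiableAt_infty]
  have hΓ : ∀ a b c, inducedChristoffel ε f a b c u =
      leviCivitaChristoffel ε f a b c u + connectionDifference ε f a b c u := by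
    intro a b c; simp [connectionDifference]
  simp only [hpd, h.pd_difference hu, hΓ, Fin.sum_univ_two, h.leviCivita_comm hu 0 1 0,
    h.leviCivita_comm hu 1 1 0] at hg
  simp only [leviCivitaCurvature, Fin.sum_univ_two]
  linear_combination hg

/-- The lowered difference tensor is totally symmetric. -/
theorem _root_.Centroaffine.IsConvexPatch.difference_lower_comm (h : IsConvexPatch ε f Ω)
    (hu : u ∈ Ω) (i j m : Fin 2) :
    ∑ k, connectionDifference ε f k i j u * metric ε f k m u =
      ∑ k, connectionDifference ε f k i m u * metric ε f k j u := by
  rw [h.difference_lower hu, h.difference_lower hu, h.cubicForm_comm_right hu]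

/-- The lowered curvature is skew. -/
theorem curvature_skew (h : IsParallelPatch ε f Ω) (hu : u ∈ Ω) (k m : Fin 2) :
    ∑ l, leviCivitaCurvature ε f k l u * metric ε f l m u
      + ∑ l, leviCivitaCurvature ε f m l u * metric ε f l k u = 0 := by
  have L := h.difference_lower_comm hu
  have l1 := L 1 0 m
  have l2 := L 1 1 m
  have l3 := L 0 0 m
  have l4 := L 0 1 m
  have l5 := L 1 0 k
  have l6 := L 1 1 k
  have l7 := L 0 0 k
  have l8 := L 0 1 k
  simp only [h.curvature_eq hu, Fin.sum_univ_two] at *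
  have c1 := h.metric_comm hu 1 0
  have c2 := h.metric_comm hu k 0
  have c3 := h.metric_comm hu k 1
  have c4 := h.metric_comm hu m 0
  have c5 := h.metric_comm hu m 1
  simp only [c1] at *
  simp
  let K := fun a b c => connectionDifference ε f a b c u
  linear_combination K 0 0 k * l1 + K 1 0 k * l2 - K 0 1 k * l3 - K 1 1 k * l4
    + K 0 0 m * l5 + K 1 0 m * l6 - K 0 1 m * l7 - K 1 1 m * l8

/-- A nonzero infinitesimal rotation acts on the binary cubic forms with weights `±1, ±3`, hence
without kernel. Here the metric has components `A, B, D`, the rotation has rows `(-B, A)` and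
`(-D, B)`, and the cubic form has components `a, b, c, d`. -/
theorem _root_.Centroaffine.cubic_eq_zero_of_rotation {A B D a b c d : ℝ} (hA : A ≠ 0)
    (hdet : A * D - B * B ≠ 0) (h1 : -B * a + A * b = 0)
    (h2 : 2 * (-B * b + A * c) + (-D * a + B * b) = 0)
    (h3 : (-B * c + A * d) + 2 * (-D * b + B * c) = 0) (h4 : -D * c + B * d = 0) :
    a = 0 ∧ b = 0 ∧ c = 0 ∧ d = 0 := by
  have ha : a = 0 := by
    have : (A * D - B * B) ^ 2 * a = 0 := by
      linear_combination (3 * A * B * D - B ^ 3) * h1 - A * (A * D + B ^ 2) * h2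
        + 2 * A ^ 2 * B * h3 - 2 * A ^ 3 * h4
    exact (mul_eq_zero.1 this).resolve_left (pow_ne_zero 2 hdet)
  subst ha
  have hb : b = 0 := (mul_eq_zero.1 (by linear_combination h1)).resolve_left hA
  subst hb
  have hc : c = 0 := (mul_eq_zero.1 (by linear_combination h2 / 2)).resolve_left hA
  subst hc
  exact ⟨rfl, rfl, rfl, (mul_eq_zero.1 (by linear_combination h3)).resolve_left hA⟩

/-- A parallel cubic form that does not vanish makes the metric flat, since by the Ricci identity
the curvature, an infinitesimal rotation, annihilates it. -/
theorem curvature_eq_zero (h : IsParallelPatch ε f Ω) (hu : u ∈ Ω)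
    (hC : ∃ i j k, cubicForm ε f i j k u ≠ 0) (k l : Fin 2) :
    leviCivitaCurvature ε f k l u = 0 := by
  have hA : metric ε f 0 0 u ≠ 0 := ((h.posDef u hu).diag_pos (i := 0)).ne'
  have hD : metric ε f 1 1 u ≠ 0 := ((h.posDef u hu).diag_pos (i := 1)).ne'
  have hdet := h.metric_det_ne_zero hu
  have s1 := h.curvature_skew hu 0 0
  have s2 := h.curvature_skew hu 0 1
  have s3 := h.curvature_skew hu 1 1
  have hR := h.ricci_identity hu
  have r1 := hR 0 0 0
  have r2 := hR 0 0 1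
  have r3 := hR 0 1 1
  have r4 := hR 1 1 1
  have e1 : ∀ i, cubicForm ε f 1 0 i u = cubicForm ε f 0 1 i u := h.cubicForm_comm_left hu 1 0
  have e2 : cubicForm ε f 0 1 0 u = cubicForm ε f 0 0 1 u := h.cubicForm_comm_right hu 0 1 0
  have e3 : cubicForm ε f 1 1 0 u = cubicForm ε f 0 1 1 u := by rw [h.cubicForm_comm_right hu, e1]
  simp only [Fin.sum_univ_two, h.metric_comm hu 1 0, e1, e2, e3] at s1 s2 s3 hdet r1 r2 r3 r4
  set A := metric ε f 0 0 u
  set B := metric ε f 0 1 u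
  set D := metric ε f 1 1 u
  set p := leviCivitaCurvature ε f 0 0 u
  set q := leviCivitaCurvature ε f 0 1 u
  set r := leviCivitaCurvature ε f 1 0 u
  set s := leviCivitaCurvature ε f 1 1 u
  -- Skewness of the lowered curvature leaves the single parameter `κ`.
  obtain ⟨κ, hq⟩ : ∃ κ, q = κ * A := ⟨q / A, by field_simp⟩
  have hp : p = -κ * B := mul_right_cancel₀ hA (by linear_combination s1 / 2 - B * hq)
  have hr : r = -κ * D := by
    refine mul_right_cancel₀ hdet ?_
    linear_combination D * s2 - B * s3 / 2 - B * D * hp - D * D * hq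
  have hs : s = κ * B := mul_right_cancel₀ hD (by linear_combination s3 / 2 - B * hr)
  by_cases hκ : κ = 0
  · rw [hκ] at hp hq hr hs
    fin_cases k <;> fin_cases l <;> simp_all [p, q, r, s]
  · exfalso
    obtain ⟨ha, hb, hc, hd⟩ := cubic_eq_zero_of_rotation (A := A) (B := B) (D := D)
      (a := cubicForm ε f 0 0 0 u) (b := cubicForm ε f 0 0 1 u) (c := cubicForm ε f 0 1 1 u)
      (d := cubicForm ε f 1 1 1 u) hA hdet
      (mul_left_cancel₀ hκ (by rw [hp, hq] at r1; linear_combination r1 / 3))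
      (mul_left_cancel₀ hκ (by rw [hp, hq, hr, hs] at r2; linear_combination r2))
      (mul_left_cancel₀ hκ (by rw [hp, hq, hr, hs] at r3; linear_combination r3))
      (mul_left_cancel₀ hκ (by rw [hr, hs] at r4; linear_combination r4 / 3))
    obtain ⟨i, j, k, hijk⟩ := hC
    fin_cases i <;> fin_cases j <;> fin_cases k <;>
      exact hijk (by simp [e1, e2, e3, ha, hb, hc, hd])

end IsParallelPatch

/-! ### The operator algebra of a patch -/

/-- The entrywise partial derivative of a matrix-valued function. -/
noncomputable def pdMatrix {n : ℕ} {p q : Type*} (i : Fin n) (A : E n → Matrix p q ℝ) (u : E n) :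
    Matrix p q ℝ :=
  Matrix.of fun a b => pd i (fun v => A v a b) u

theorem pdMatrix_mul {n : ℕ} {p q r : Type*} [Fintype q] (i : Fin n) {A : E n → Matrix p q ℝ}
    {B : E n → Matrix q r ℝ} {u : E n} (hA : ∀ a b, DifferentiableAt ℝ (fun v => A v a b) u)
    (hB : ∀ a b, DifferentiableAt ℝ (fun v => B v a b) u) :
    pdMatrix i (fun v => A v * B v) u = pdMatrix i A u * B u + A u * pdMatrix i B u := by
  ext a b
  simp only [pdMatrix, Matrix.of_apply, Matrix.mul_apply, Matrix.add_apply]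
  rw [pd_sum _ fun k _ => (hA a k).fun_mul (hB k b)]
  simp only [pd_mul (hA _ _) (hB _ _), Finset.sum_add_distrib]

theorem pdMatrix_congr {n : ℕ} {p q : Type*} {i : Fin n} {A B : E n → Matrix p q ℝ} {u : E n}
    (h : A =ᶠ[𝓝 u] B) : pdMatrix i A u = pdMatrix i B u := by
  ext a b
  exact pd_congr (h.mono fun v hv => by simp [hv]) i

/-- The matrix, in the frame `(∂₁f, ∂₂f, -ε f)`, of the multiplication by `∂ᵢf` in the commutative
algebra on `ℝ³` with unit `f` and products `∂ᵢf · ∂ⱼf = ∑ₖ Kᵏᵢⱼ ∂ₖf - ε hᵢⱼ f`. Operators act on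
row vectors from the right. -/
noncomputable def multMatrix (ε : ℝ) (f : E 2 → E 3) (i : Fin 2) (u : E 2) :
    Matrix (Fin 3) (Fin 3) ℝ :=
  !![connectionDifference ε f 0 i 0 u, connectionDifference ε f 1 i 0 u, metric ε f i 0 u;
     connectionDifference ε f 0 i 1 u, connectionDifference ε f 1 i 1 u, metric ε f i 1 u;
     if i = 0 then -ε else 0, if i = 1 then -ε else 0, 0]

/-- The multiplication by `∂ᵢf`, as an operator on row vectors of `ℝ³`. -/
noncomputable def mult (ε : ℝ) (f : E 2 → E 3) (i : Fin 2) (u : E 2) : Matrix (Fin 3) (Fin 3) ℝ :=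
  (frame ε f u)⁻¹ * multMatrix ε f i u * frame ε f u

/-- The space of the multiplications by tangent vectors at a point of the patch. -/
noncomputable def multSpace (ε : ℝ) (f : E 2 → E 3) (u : E 2) :
    Submodule ℝ (Matrix (Fin 3) (Fin 3) ℝ) :=
  Submodule.span ℝ (Set.range fun i => mult ε f i u)

/-- The connection matrix of the Levi-Civita connection in the frame. -/
noncomputable def leviCivitaMatrix (ε : ℝ) (f : E 2 → E 3) (j : Fin 2) (u : E 2) :
    Matrix (Fin 3) (Fin 3) ℝ :=
  !![leviCivitaChristoffel ε f 0 j 0 u, leviCivitaChristoffel ε f 1 j 0 u, 0;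
     leviCivitaChristoffel ε f 0 j 1 u, leviCivitaChristoffel ε f 1 j 1 u, 0;
     0, 0, 0]

theorem frame_row (ε : ℝ) (f : E 2 → E 3) (u : E 2) (b : Fin 3) :
    frame ε f u 0 b = pd 0 f u b ∧ frame ε f u 1 b = pd 1 f u b ∧ frame ε f u 2 b = -ε * f u b :=
  ⟨rfl, rfl, rfl⟩

namespace IsConvexPatch

variable {ε : ℝ} {f : E 2 → E 3} {Ω : Set (E 2)} {u : E 2}

theorem frame_mul_mult (h : IsConvexPatch ε f Ω) (hu : u ∈ Ω) (i : Fin 2) :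
    frame ε f u * mult ε f i u = multMatrix ε f i u * frame ε f u := by
  rw [mult, ← Matrix.mul_assoc, ← Matrix.mul_assoc, Matrix.mul_nonsing_inv _ (h.isUnit_frame hu),
    Matrix.one_mul]

/-- An operator is determined by its matrix in the frame. -/
theorem eq_of_frame_mul_eq (h : IsConvexPatch ε f Ω) (hu : u ∈ Ω) {p : Type*}
    {A B : Matrix (Fin 3) p ℝ} (hAB : frame ε f u * A = frame ε f u * B) : A = B := by
  have := congrArg ((frame ε f u)⁻¹ * ·) hAB
  simpa [← Matrix.mul_assoc, Matrix.nonsing_inv_mul _ (h.isUnit_frame hu)] using this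

/-- The position vector is the unit of the multiplication. -/
theorem vecMul_mult (h : IsConvexPatch ε f Ω) (hε : ε * ε = 1) (hu : u ∈ Ω) (i : Fin 2) :
    f u ᵥ* mult ε f i u = pd i f u := by
  have hε0 : ε ≠ 0 := fun h0 => by simp [h0] at hε
  ext b
  have : ∑ x : Fin 3, frame ε f u 2 x * mult ε f i u x b =
      ∑ x : Fin 3, multMatrix ε f i u 2 x * frame ε f u x b :=
    congrFun (congrFun (h.frame_mul_mult hu i) 2) b
  simp only [Fin.sum_univ_three, frame_row, multMatrix] at this
  simp only [Matrix.vecMul, dotProduct, Fin.sum_univ_three]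
  fin_cases i <;> simp at this ⊢ <;> apply mul_left_cancel₀ hε0 <;> linear_combination -this

/-- The formulas of Gauss and Weingarten in matrix form, with `∇ = K + ∇̂`. -/
theorem pdMatrix_frame (h : IsConvexPatch ε f Ω) (hu : u ∈ Ω) (j : Fin 2) :
    pdMatrix j (frame ε f) u = (multMatrix ε f j u + leviCivitaMatrix ε f j u) * frame ε f u := by
  have hd := (h.contDiffAt u hu).differentiableAt_infty
  have hg : ∀ k b, pd j (fun v => pd k f v b) u = inducedChristoffel ε f 0 j k u * pd 0 f u b
      + inducedChristoffel ε f 1 j k u * pd 1 f u b + metric ε f j k u * (-ε * f u b) := by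
    intro k b
    rw [pd_coord (contDiffAt_pd (h.contDiffAt u hu) k).differentiableAt_infty,
      gauss_formula ε f u (h.isUnit_frame hu)]
    simp [Fin.sum_univ_two]
  ext a b
  rw [pdMatrix, Matrix.of_apply]
  simp only [Matrix.mul_apply, Fin.sum_univ_three, frame_row, Matrix.add_apply]
  fin_cases a
  · refine (hg 0 b).trans ?_
    simp [multMatrix, leviCivitaMatrix, connectionDifference]
  · refine (hg 1 b).trans ?_
    simp [multMatrix, leviCivitaMatrix, connectionDifference]
  · refine (pd_const_mul (a := fun v => f v b) (contDiffAt_coord (h.contDiffAt u hu)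
      b).differentiableAt_infty _ _).trans ?_
    rw [pd_coord hd]
    fin_cases j <;> simp [multMatrix, leviCivitaMatrix]

theorem contDiffAt_multMatrix (h : IsConvexPatch ε f Ω) (hu : u ∈ Ω) (i : Fin 2) (a b : Fin 3) :
    ContDiffAt ℝ ∞ (fun v => multMatrix ε f i v a b) u := by
  have h1 := h.contDiffAt_difference hu
  have h2 := h.contDiffAt_metric hu
  fin_cases a <;> fin_cases b <;> simp [multMatrix, h1, h2, contDiffAt_const]

theorem contDiffAt_frame (h : IsConvexPatch ε f Ω) (hu : u ∈ Ω) (a b : Fin 3) :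
    ContDiffAt ℝ ∞ (fun v => frame ε f v a b) u :=
  Centroaffine.contDiffAt_frame (h.contDiffAt u hu) a b

theorem contDiffAt_mult (h : IsConvexPatch ε f Ω) (hu : u ∈ Ω) (i : Fin 2) (a b : Fin 3) :
    ContDiffAt ℝ ∞ (fun v => mult ε f i v a b) u := by
  simp only [mult, Matrix.mul_apply]
  exact ContDiffAt.sum fun c _ => (ContDiffAt.sum fun d _ => (contDiffAt_matrix_inv
    (fun _ _ => h.contDiffAt_frame hu _ _) (h.isUnit_frame hu) a d).mul
    (h.contDiffAt_multMatrix hu i d c)).mul (h.contDiffAt_frame hu c b)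

/-- Tangent vectors act by linearly independent multiplications. -/
theorem linearIndependent_mult (h : IsConvexPatch ε f Ω) (hε : ε * ε = 1) (hu : u ∈ Ω) :
    LinearIndependent ℝ fun i => mult ε f i u := by
  rw [Fintype.linearIndependent_iff]
  intro g hg
  have key : ∑ k, g k • pd k f u + (0 : ℝ) • ((-ε) • f u) =
      ∑ k, (0 : Fin 2 → ℝ) k • pd k f u + (0 : ℝ) • ((-ε) • f u) := by
    have h0 := congrArg (fun A => f u ᵥ* A) hg
    simp only [Fin.sum_univ_two, Matrix.vecMul_add, Matrix.vecMul_smul, h.vecMul_mult hε hu,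
      Matrix.vecMul_zero] at h0
    ext b
    simpa [Fin.sum_univ_two] using congrFun h0 b
  exact congrFun (frame_coeff_unique (h.isUnit_frame hu) key).1

theorem finrank_multSpace (h : IsConvexPatch ε f Ω) (hε : ε * ε = 1) (hu : u ∈ Ω) :
    Module.finrank ℝ (multSpace ε f u) = 2 :=
  (finrank_span_eq_card (h.linearIndependent_mult hε hu)).trans (Fintype.card_fin 2)

end IsConvexPatch

namespace IsParallelPatch

variable {ε : ℝ} {f : E 2 → E 3} {Ω : Set (E 2)} {u : E 2}

/-- Without curvature, the multiplications commute and form with the identity an algebra. -/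
theorem multMatrix_mul (h : IsParallelPatch ε f Ω) (hu : u ∈ Ω)
    (hR : ∀ k l, leviCivitaCurvature ε f k l u = 0) (i j : Fin 2) :
    multMatrix ε f i u * multMatrix ε f j u =
      ∑ k, connectionDifference ε f k i j u • multMatrix ε f k u - (ε * metric ε f i j u) • 1 := by
  have h00 := hR 0 0
  have h01 := hR 0 1
  have h10 := hR 1 0
  have h11 := hR 1 1
  have L := h.difference_lower_comm hu
  have L0 := L 0 0 1
  have L1 := L 1 0 1
  have m10 := h.metric_comm hu 1 0
  have d0 := h.difference_comm hu 0 1 0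
  have d1 := h.difference_comm hu 1 1 0
  simp only [h.curvature_eq hu, Fin.sum_univ_two] at h00 h01 h10 h11 L0 L1
  simp only [m10, d0, d1] at h00 h01 h10 h11 L0 L1
  simp at h00 h01 h10 h11
  ext a b
  fin_cases i <;> fin_cases j <;> fin_cases a <;> fin_cases b <;>
    simp [multMatrix, Matrix.mul_apply, Fin.sum_univ_three, Fin.sum_univ_two, m10, d0, d1] <;>
    grind only

theorem mult_mul (h : IsParallelPatch ε f Ω) (hu : u ∈ Ω)
    (hR : ∀ k l, leviCivitaCurvature ε f k l u = 0) (i j : Fin 2) :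
    mult ε f i u * mult ε f j u =
      ∑ k, connectionDifference ε f k i j u • mult ε f k u - (ε * metric ε f i j u) • 1 := by
  apply h.eq_of_frame_mul_eq hu
  rw [← Matrix.mul_assoc, h.frame_mul_mult hu, Matrix.mul_assoc, h.frame_mul_mult hu,
    ← Matrix.mul_assoc, h.multMatrix_mul hu hR]
  simp only [Matrix.mul_sub, Matrix.sub_mul, Fin.sum_univ_two, Matrix.mul_add, Matrix.add_mul,
    Matrix.mul_smul, Matrix.smul_mul, h.frame_mul_mult hu, Matrix.mul_one, Matrix.one_mul]

/-- `∇̂K = 0` and `∇̂h = 0` in matrix form. -/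
theorem pdMatrix_multMatrix (h : IsParallelPatch ε f Ω) (hu : u ∈ Ω) (i j : Fin 2) :
    pdMatrix j (multMatrix ε f i) u =
      ∑ k, leviCivitaChristoffel ε f k j i u • multMatrix ε f k u
      + leviCivitaMatrix ε f j u * multMatrix ε f i u
      - multMatrix ε f i u * leviCivitaMatrix ε f j u := by
  ext a b
  simp only [Matrix.sub_apply, Matrix.add_apply, Matrix.mul_apply, Fin.sum_univ_three,
    Fin.sum_univ_two, Matrix.smul_apply, smul_eq_mul]
  have m10 := h.metric_comm hu 1 0
  fin_cases a <;> fin_cases b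
  · refine (h.pd_difference hu j 0 i 0).trans ?_
    simp [multMatrix, leviCivitaMatrix]; ring
  · refine (h.pd_difference hu j 1 i 0).trans ?_
    simp [multMatrix, leviCivitaMatrix]; ring
  · refine (h.pd_metric hu j i 0).trans ?_
    simp [multMatrix, leviCivitaMatrix, h.metric_comm hu i]
  · refine (h.pd_difference hu j 0 i 1).trans ?_
    simp [multMatrix, leviCivitaMatrix]; ring
  · refine (h.pd_difference hu j 1 i 1).trans ?_
    simp [multMatrix, leviCivitaMatrix]; ring
  · refine (h.pd_metric hu j i 1).trans ?_
    simp [multMatrix, leviCivitaMatrix, h.metric_comm hu i]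
  · refine (pd_const _ j u).trans ?_
    fin_cases i <;> simp [multMatrix, leviCivitaMatrix] <;> ring
  · refine (pd_const _ j u).trans ?_
    fin_cases i <;> simp [multMatrix, leviCivitaMatrix] <;> ring
  · refine (pd_const _ j u).trans ?_
    fin_cases i <;> simp [multMatrix, leviCivitaMatrix]

/-- Without curvature, the multiplications form a parallel one-form with values in the constant
matrices. -/
theorem pdMatrix_mult (h : IsParallelPatch ε f Ω) (hu : u ∈ Ω)
    (hR : ∀ k l, leviCivitaCurvature ε f k l u = 0) (i j : Fin 2) :
    pdMatrix j (mult ε f i) u = ∑ k, leviCivitaChristoffel ε f k j i u • mult ε f k u := by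
  apply h.eq_of_frame_mul_eq hu
  have hF := fun a b => (h.contDiffAt_frame hu a b).differentiableAt_infty
  have hX := fun a b => (h.contDiffAt_mult hu i a b).differentiableAt_infty
  have hm := fun a b => (h.contDiffAt_multMatrix hu i a b).differentiableAt_infty
  have hev : (fun v => frame ε f v * mult ε f i v) =ᶠ[𝓝 u]
      fun v => multMatrix ε f i v * frame ε f v := by
    filter_upwards [h.isOpen.mem_nhds hu] with v hv using h.frame_mul_mult hv i
  have key := pdMatrix_congr (i := j) hev
  rw [pdMatrix_mul j hF hX, pdMatrix_mul j hm hF, h.pdMatrix_frame hu, h.pdMatrix_multMatrix hu,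
    Matrix.mul_assoc, h.frame_mul_mult hu] at key
  have hcomm : multMatrix ε f i u * multMatrix ε f j u
      = multMatrix ε f j u * multMatrix ε f i u := by
    rw [h.multMatrix_mul hu hR, h.multMatrix_mul hu hR]
    simp only [Fin.sum_univ_two, h.difference_comm hu _ i j, h.metric_comm hu i j]
  rw [← eq_sub_iff_add_eq'] at key
  rw [key]
  simp only [Fin.sum_univ_two, Matrix.mul_add, Matrix.mul_smul, h.frame_mul_mult hu, ←
    Matrix.mul_assoc, ← Matrix.add_mul, ← Matrix.sub_mul, ← Matrix.smul_mul]
  congr 1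
  rw [hcomm]
  simp only [Matrix.add_mul]
  abel

/-- Where the metric is flat, the space of multiplications is locally constant. -/
theorem eventually_multSpace_eq (h : IsParallelPatch ε f Ω) (hε : ε * ε = 1)
    (hR : ∀ v ∈ Ω, ∀ k l, leviCivitaCurvature ε f k l v = 0) (hu : u ∈ Ω) :
    ∀ᶠ v in 𝓝 u, multSpace ε f v = multSpace ε f u := by
  set W := multSpace ε f u with hW
  -- The functionals `l a` cut out `W`. Their values on the multiplications solve a linear system
  -- and vanish at `u`.
  let bas := Module.finBasis ℝ (Matrix (Fin 3) (Fin 3) ℝ ⧸ W)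
  let l : Fin _ → Matrix (Fin 3) (Fin 3) ℝ →ₗ[ℝ] ℝ := fun a => bas.coord a ∘ₗ W.mkQ
  have hl : ∀ a A, l a A = ∑ p, ∑ q, A p q * l a (Matrix.single p q 1) := by
    intro a A
    conv_lhs => rw [Matrix.matrix_eq_sum_single A]
    simp only [map_sum]
    refine Finset.sum_congr rfl fun p _ => Finset.sum_congr rfl fun q _ => ?_
    rw [← smul_eq_mul, ← map_smul, Matrix.smul_single, smul_eq_mul, mul_one]
  have hd : ∀ i p q, ∀ v ∈ Ω, DifferentiableAt ℝ (fun v => mult ε f i v p q) v :=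
    fun i p q v hv => (h.contDiffAt_mult hv i p q).differentiableAt_infty
  have hd' : ∀ i p q c, ∀ v ∈ Ω, DifferentiableAt ℝ (fun v => mult ε f i v p q * c) v :=
    fun i p q c v hv => (hd i p q v hv).mul_const c
  have hpd : ∀ a i j, ∀ v ∈ Ω,
      pd j (fun v => l a (mult ε f i v)) v = l a (pdMatrix j (mult ε f i) v) := by
    intro a i j v hv
    rw [hl a (pdMatrix j (mult ε f i) v)]
    have : (fun v => l a (mult ε f i v)) =
      fun v => ∑ p, ∑ q, mult ε f i v p q * l a (Matrix.single p q 1) := funext fun v => hl a _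
    rw [this, pd_sum _ fun p _ => DifferentiableAt.fun_sum fun q _ => hd' i p q _ v hv]
    refine Finset.sum_congr rfl fun p _ => ?_
    rw [pd_sum _ fun q _ => hd' i p q _ v hv]
    refine Finset.sum_congr rfl fun q _ => ?_
    rw [pd_mul (hd i p q v hv) (by fun_prop), pd_const, mul_zero, add_zero]
    rfl
  have key := eventually_eq_zero_of_pd_eq (ι := Fin 2 × Fin _) h.isOpen hu
    (y := fun a v => l a.2 (mult ε f a.1 v))
    (m := fun j a b v => if b.2 = a.2 then leviCivitaChristoffel ε f b.1 j a.1 v else 0)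
    (fun a v hv => by
      have : (fun v => l a.2 (mult ε f a.1 v)) = fun v => ∑ p, ∑ q, mult ε f a.1 v p q *
        l a.2 (Matrix.single p q 1) := funext fun v => hl a.2 _
      rw [this]
      exact DifferentiableAt.fun_sum fun p _ => DifferentiableAt.fun_sum fun q _ =>
        hd' _ p q _ v hv)
    (fun j a b v hv => by
      split_ifs
      · exact (h.contDiffAt_leviCivita hv _ _ _).continuousAt
      · exact continuousAt_const)
    (fun j a v hv => by
      rw [hpd _ _ _ _ hv, h.pdMatrix_mult hv (hR v hv)]
      simp [Fintype.sum_prod_type, Fin.sum_univ_two])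
    (fun a => by
      have : mult ε f a.1 u ∈ W := Submodule.subset_span ⟨a.1, rfl⟩
      simp [l, (Submodule.Quotient.mk_eq_zero W).2 this])
  filter_upwards [key, h.isOpen.mem_nhds hu] with v hv hvΩ
  apply Submodule.eq_of_le_of_finrank_eq
  · refine Submodule.span_le.2 ?_
    rintro _ ⟨i, rfl⟩
    rw [SetLike.mem_coe, ← Submodule.Quotient.mk_eq_zero]
    refine bas.ext_elem fun a => ?_
    simpa [l] using hv (i, a)
  · rw [h.finrank_multSpace hε hvΩ, hW, h.finrank_multSpace hε hu]

end IsParallelPatch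

/-! ### Change of parameters -/

/-- The parametrization `f'` over `Ω'` is the reparametrization `f ∘ τ` of `f` over `Ω`. -/
structure IsReparametrization (f f' : E 2 → E 3) (τ : E 2 → E 2) (Ω Ω' : Set (E 2)) : Prop where
  contDiffAt : ∀ v ∈ Ω', ContDiffAt ℝ ∞ τ v
  mapsTo : ∀ v ∈ Ω', τ v ∈ Ω
  eq : ∀ v ∈ Ω', f' v = f (τ v)

namespace IsReparametrization

variable {ε : ℝ} {f f' : E 2 → E 3} {τ : E 2 → E 2} {Ω Ω' : Set (E 2)} {u : E 2}

theorem pd_comp {F : Type*} [NormedAddCommGroup F] [NormedSpace ℝ F]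
    (r : IsReparametrization f f' τ Ω Ω') (hu : u ∈ Ω') {g : E 2 → F}
    (hg : DifferentiableAt ℝ g (τ u)) (i : Fin 2) :
    pd i (fun v => g (τ v)) u = ∑ k, pd i τ u k • pd k g (τ u) :=
  Centroaffine.pd_comp hg (r.contDiffAt u hu).differentiableAt_infty i

theorem differentiableAt_jacobian (r : IsReparametrization f f' τ Ω Ω') (hu : u ∈ Ω')
    (i k : Fin 2) : DifferentiableAt ℝ (fun v => pd i τ v k) u :=
  (contDiffAt_coord (contDiffAt_pd (r.contDiffAt u hu) i) k).differentiableAt_infty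

theorem pd_eq (r : IsReparametrization f f' τ Ω Ω') (h : IsConvexPatch ε f Ω)
    (h' : IsConvexPatch ε f' Ω') (hu : u ∈ Ω') (i : Fin 2) :
    pd i f' u = ∑ k, pd i τ u k • pd k f (τ u) := by
  rw [← r.pd_comp hu (h.contDiffAt _ (r.mapsTo u hu)).differentiableAt_infty]
  refine pd_congr ?_ i
  filter_upwards [h'.isOpen.mem_nhds hu] with v hv using r.eq v hv

theorem pd_pd_eq (r : IsReparametrization f f' τ Ω Ω') (h : IsConvexPatch ε f Ω)
    (h' : IsConvexPatch ε f' Ω') (hu : u ∈ Ω') (i j : Fin 2) :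
    pd i (pd j f') u = ∑ k, (pd i (fun v => pd j τ v k) u • pd k f (τ u)
      + pd j τ u k • ∑ l, pd i τ u l • pd l (pd k f) (τ u)) := by
  have hev : pd j f' =ᶠ[𝓝 u] fun v => ∑ k, pd j τ v k • pd k f (τ v) := by
    filter_upwards [h'.isOpen.mem_nhds hu] with v hv using r.pd_eq h h' hv j
  have hd := fun k => (contDiffAt_pd (h.contDiffAt _ (r.mapsTo u hu)) k).differentiableAt_infty
  have hd' : ∀ k, DifferentiableAt ℝ (fun v => pd k f (τ v)) u := fun k =>
    (hd k).fun_comp' u (r.contDiffAt u hu).differentiableAt_infty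
  rw [pd_congr hev, pd_sum _ fun k _ => (r.differentiableAt_jacobian hu j k).fun_smul (hd' k)]
  refine Finset.sum_congr rfl fun k _ => ?_
  rw [pd_smul (r.differentiableAt_jacobian hu j k) (hd' k), r.pd_comp hu (hd k)]

/-- The transformation laws of `∇` and `h`, read off from the formula of Gauss in the frame of
`f`. -/
theorem christoffel_metric (r : IsReparametrization f f' τ Ω Ω') (h : IsConvexPatch ε f Ω)
    (h' : IsConvexPatch ε f' Ω') (hu : u ∈ Ω') (i j : Fin 2) :
    (fun k => ∑ l, inducedChristoffel ε f' l i j u * pd l τ u k) = (fun k =>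
      pd i (fun v => pd j τ v k) u
        + ∑ m, ∑ n, pd i τ u m * pd j τ u n * inducedChristoffel ε f k m n (τ u)) ∧
    metric ε f' i j u = ∑ m, ∑ n, pd i τ u m * pd j τ u n * metric ε f m n (τ u) := by
  have hτ := r.mapsTo u hu
  refine frame_coeff_unique (h.isUnit_frame hτ) ?_
  have e1 := r.pd_pd_eq h h' hu i j
  rw [gauss_formula ε f' u (h'.isUnit_frame hu)] at e1
  simp only [r.pd_eq h h' hu, r.eq u hu, gauss_formula ε f (τ u) (h.isUnit_frame hτ)] at e1
  simp only [Fin.sum_univ_two] at e1 ⊢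
  ext b
  have := congrArg (fun w : E 3 => w b) e1
  simp at this ⊢
  linear_combination this

theorem metric_eq (r : IsReparametrization f f' τ Ω Ω') (h : IsConvexPatch ε f Ω)
    (h' : IsConvexPatch ε f' Ω') (hu : u ∈ Ω') (i j : Fin 2) :
    metric ε f' i j u = ∑ m, ∑ n, pd i τ u m * pd j τ u n * metric ε f m n (τ u) :=
  (r.christoffel_metric h h' hu i j).2

theorem christoffel_eq (r : IsReparametrization f f' τ Ω Ω') (h : IsConvexPatch ε f Ω)
    (h' : IsConvexPatch ε f' Ω') (hu : u ∈ Ω') (i j k : Fin 2) :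
    ∑ l, inducedChristoffel ε f' l i j u * pd l τ u k = pd i (fun v => pd j τ v k) u
        + ∑ m, ∑ n, pd i τ u m * pd j τ u n * inducedChristoffel ε f k m n (τ u) :=
  congrFun (r.christoffel_metric h h' hu i j).1 k

theorem pd_metric_eq (r : IsReparametrization f f' τ Ω Ω') (h : IsConvexPatch ε f Ω)
    (h' : IsConvexPatch ε f' Ω') (hu : u ∈ Ω') (l i j : Fin 2) :
    pd l (metric ε f' i j) u = ∑ m, ∑ n,
      ((pd l (fun v => pd i τ v m) u * pd j τ u n + pd i τ u m * pd l (fun v => pd j τ v n) u)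
        * metric ε f m n (τ u)
      + pd i τ u m * pd j τ u n * ∑ p, pd l τ u p * pd p (metric ε f m n) (τ u)) := by
  have hev : metric ε f' i j =ᶠ[𝓝 u]
      fun v => ∑ m, ∑ n, pd i τ v m * pd j τ v n * metric ε f m n (τ v) := by
    filter_upwards [h'.isOpen.mem_nhds hu] with v hv using r.metric_eq h h' hv i j
  have hd := fun m n => (h.contDiffAt_metric (r.mapsTo u hu) m n).differentiableAt_infty
  have hd' : ∀ m n, DifferentiableAt ℝ (fun v => metric ε f m n (τ v)) u := fun m n =>
    (hd m n).fun_comp' u (r.contDiffAt u hu).differentiableAt_infty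
  have hJ := r.differentiableAt_jacobian hu
  have hJJ := fun m n => (hJ i m).fun_mul (hJ j n)
  have hall := fun m n => (hJJ m n).fun_mul (hd' m n)
  rw [pd_congr hev, pd_sum _ fun m _ => DifferentiableAt.fun_sum fun n _ => hall m n]
  refine Finset.sum_congr rfl fun m _ => ?_
  rw [pd_sum _ fun n _ => hall m n]
  refine Finset.sum_congr rfl fun n _ => ?_
  rw [pd_mul (hJJ m n) (hd' m n), pd_mul (hJ i m) (hJ j n), r.pd_comp hu (hd m n)]
  rfl

/-- The cubic form is a tensor. -/
theorem cubicForm_eq (r : IsReparametrization f f' τ Ω Ω') (h : IsConvexPatch ε f Ω)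
    (h' : IsConvexPatch ε f' Ω') (hu : u ∈ Ω') (i j k : Fin 2) :
    cubicForm ε f' i j k u =
      ∑ a, ∑ b, ∑ c, pd i τ u a * pd j τ u b * pd k τ u c * cubicForm ε f a b c (τ u) := by
  have g1 := r.christoffel_eq h h' hu i j
  have g2 := r.christoffel_eq h h' hu i k
  have a0 := g1 0
  have a1 := g1 1
  have b0 := g2 0
  have b1 := g2 1
  rw [cubicForm, r.pd_metric_eq h h' hu]
  simp only [r.metric_eq h h' hu, cubicForm, Fin.sum_univ_two] at a0 a1 b0 b1 ⊢
  let T := fun i k => pd i τ u k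
  let H := fun m n => metric ε f m n (τ u)
  linear_combination -(T k 0 * H 0 0 + T k 1 * H 0 1) * a0 - (T k 0 * H 1 0 + T k 1 * H 1 1) * a1
    - (T j 0 * H 0 0 + T j 1 * H 1 0) * b0 - (T j 0 * H 0 1 + T j 1 * H 1 1) * b1

theorem jacobian_ne_zero (r : IsReparametrization f f' τ Ω Ω') (h : IsConvexPatch ε f Ω)
    (h' : IsConvexPatch ε f' Ω') (hu : u ∈ Ω') :
    pd 0 τ u 0 * pd 1 τ u 1 - pd 0 τ u 1 * pd 1 τ u 0 ≠ 0 := by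
  intro h0
  apply h'.metric_det_ne_zero hu
  simp only [r.metric_eq h h' hu, Fin.sum_univ_two]
  linear_combination (pd 0 τ u 0 * pd 1 τ u 1 - pd 0 τ u 1 * pd 1 τ u 0) *
    (metric ε f 0 0 (τ u) * metric ε f 1 1 (τ u) - metric ε f 0 1 (τ u) * metric ε f 1 0 (τ u)) * h0

/-- The difference tensor is a tensor. -/
theorem difference_eq (r : IsReparametrization f f' τ Ω Ω') (h : IsConvexPatch ε f Ω)
    (h' : IsConvexPatch ε f' Ω') (hu : u ∈ Ω') (i j k : Fin 2) :
    ∑ l, connectionDifference ε f' l i j u * pd l τ u k =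
      ∑ m, ∑ n, pd i τ u m * pd j τ u n * connectionDifference ε f k m n (τ u) := by
  have hτ := r.mapsTo u hu
  have hJ := r.jacobian_ne_zero h h' hu
  refine congrFun (h.eq_of_lower_eq hτ
    (a := fun k => ∑ l, connectionDifference ε f' l i j u * pd l τ u k)
    (b := fun k => ∑ m, ∑ n, pd i τ u m * pd j τ u n * connectionDifference ε f k m n (τ u))
    fun m => ?_) k
  -- After contraction with the invertible Jacobian both sides become the cubic form.
  have key : ∀ p, ∑ m, pd p τ u m * (∑ k, (∑ l, connectionDifference ε f' l i j u * pd l τ u k)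
      * metric ε f k m (τ u)) = ∑ m, pd p τ u m * (∑ k, (∑ m, ∑ n, pd i τ u m * pd j τ u n *
      connectionDifference ε f k m n (τ u)) * metric ε f k m (τ u)) := by
    intro p
    have e1 := h'.difference_lower hu i j p
    rw [r.cubicForm_eq h h' hu] at e1
    have L := fun a b c => h.difference_lower hτ a b c
    simp only [r.metric_eq h h' hu, Fin.sum_univ_two] at e1 L ⊢
    let T := fun i k => pd i τ u k
    linear_combination e1 - T i 0 * T j 0 * T p 0 * L 0 0 0 - T i 0 * T j 0 * T p 1 * L 0 0 1
      - T i 0 * T j 1 * T p 0 * L 0 1 0 - T i 0 * T j 1 * T p 1 * L 0 1 1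
      - T i 1 * T j 0 * T p 0 * L 1 0 0 - T i 1 * T j 0 * T p 1 * L 1 0 1
      - T i 1 * T j 1 * T p 0 * L 1 1 0 - T i 1 * T j 1 * T p 1 * L 1 1 1
  have k0 := key 0
  have k1 := key 1
  simp only [Fin.sum_univ_two] at k0 k1 ⊢
  apply mul_left_cancel₀ hJ
  fin_cases m
  · simp only [Fin.zero_eta]
    linear_combination pd 1 τ u 1 * k0 - pd 0 τ u 1 * k1
  · simp only [Fin.mk_one]
    linear_combination pd 0 τ u 0 * k1 - pd 1 τ u 0 * k0

/-- The multiplications form a tensor. -/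
theorem mult_eq (r : IsReparametrization f f' τ Ω Ω') (h : IsConvexPatch ε f Ω)
    (h' : IsConvexPatch ε f' Ω') (hu : u ∈ Ω') (i : Fin 2) :
    mult ε f' i u = ∑ k, pd i τ u k • mult ε f k (τ u) := by
  have hτ := r.mapsTo u hu
  -- The frame of `f'` in the frame of `f`.
  let T : Matrix (Fin 3) (Fin 3) ℝ :=
    !![pd 0 τ u 0, pd 0 τ u 1, 0; pd 1 τ u 0, pd 1 τ u 1, 0; 0, 0, 1]
  have hT : frame ε f' u = T * frame ε f (τ u) := by
    ext a b
    have e : ∀ i, pd i f' u b = pd i τ u 0 * pd 0 f (τ u) b + pd i τ u 1 * pd 1 f (τ u) b := by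
      intro i
      rw [r.pd_eq h h' hu]
      simp [Fin.sum_univ_two]
    rw [Matrix.mul_apply]
    fin_cases a
    · refine (e 0).trans ?_
      simp [Fin.sum_univ_three, T, frame_row]
    · refine (e 1).trans ?_
      simp [Fin.sum_univ_three, T, frame_row]
    · simp [Fin.sum_univ_three, T, frame_row, r.eq u hu]
  apply h'.eq_of_frame_mul_eq hu
  rw [h'.frame_mul_mult hu, hT, ← Matrix.mul_assoc]
  simp only [Fin.sum_univ_two, Matrix.mul_add, Matrix.mul_smul]
  rw [Matrix.mul_assoc T, h.frame_mul_mult hτ, Matrix.mul_assoc T, h.frame_mul_mult hτ,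
    ← Matrix.mul_assoc, ← Matrix.mul_assoc]
  suffices hs : multMatrix ε f' i u * T = pd i τ u 0 • (T * multMatrix ε f 0 (τ u))
      + pd i τ u 1 • (T * multMatrix ε f 1 (τ u)) by
    rw [hs, Matrix.add_mul, Matrix.smul_mul, Matrix.smul_mul]
  have K := r.difference_eq h h' hu i
  have H := r.metric_eq h h' hu i
  simp only [Fin.sum_univ_two] at K H
  ext a b
  simp only [Matrix.mul_apply, Fin.sum_univ_three, Matrix.add_apply, Matrix.smul_apply]
  fin_cases a <;> fin_cases b <;> simp [multMatrix, T]
  · linear_combination K 0 0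
  · linear_combination K 0 1
  · linear_combination H 0
  · linear_combination K 1 0
  · linear_combination K 1 1
  · linear_combination H 1
  · fin_cases i <;> simp <;> ring
  · fin_cases i <;> simp <;> ring

theorem multSpace_le (r : IsReparametrization f f' τ Ω Ω') (h : IsConvexPatch ε f Ω)
    (h' : IsConvexPatch ε f' Ω') (hu : u ∈ Ω') : multSpace ε f' u ≤ multSpace ε f (τ u) := by
  refine Submodule.span_le.2 ?_
  rintro _ ⟨i, rfl⟩
  rw [SetLike.mem_coe]
  simp only [r.mult_eq h h' hu]
  exact Submodule.sum_mem _ fun k _ => Submodule.smul_mem _ _ (Submodule.subset_span ⟨k, rfl⟩)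

/-- The space of the multiplications does not depend on the parametrization. -/
theorem multSpace_eq (r : IsReparametrization f f' τ Ω Ω') (hε : ε * ε = 1)
    (h : IsConvexPatch ε f Ω) (h' : IsConvexPatch ε f' Ω') (hu : u ∈ Ω') :
    multSpace ε f' u = multSpace ε f (τ u) :=
  Submodule.eq_of_le_of_finrank_eq (r.multSpace_le h h' hu) <| by
    rw [h'.finrank_multSpace hε hu, h.finrank_multSpace hε (r.mapsTo u hu)]

end IsReparametrization

/-! ### From a parametrization inside a surface to local equivalence -/

/-- If a centroaffine parametrization lies in a set `S` that meets each ray from the origin at most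
once, then locally it is onto a relatively open piece of `S`: by the inverse function theorem the
map `(u, s) ↦ eˢ f(u)` is a local diffeomorphism, and its values in `S` are those with `s = 0`. -/
theorem exists_image_eq_inter {ε : ℝ} {f : E 2 → E 3} {u₀ : E 2} (hf : ContDiffAt ℝ ∞ f u₀)
    (hF : IsUnit (frame ε f u₀).det) {S : Set (E 3)}
    (hS : ∀ y ∈ S, ∀ s : ℝ, Real.exp s • y ∈ S → s = 0) (A : E 3 ≃L[ℝ] E 3)
    (hA : ∀ᶠ u in 𝓝 u₀, A (f u) ∈ S) {T : Set (E 2)} (hT : T ∈ 𝓝 u₀) :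
    ∃ (N : Set (E 2)) (V : Set (E 3)), IsOpen N ∧ u₀ ∈ N ∧ N ⊆ T ∧ IsOpen V ∧ Set.InjOn f N ∧
      (fun u => A (f u)) '' N = S ∩ V := by
  let G : E 2 × ℝ → E 3 := fun p => Real.exp p.2 • f p.1
  let p₀ : E 2 × ℝ := (u₀, 0)
  let L : E 2 × ℝ →L[ℝ] E 3 :=
    Real.exp p₀.2 • (fderiv ℝ f u₀ ∘L ContinuousLinearMap.fst ℝ (E 2) ℝ) +
      (Real.exp p₀.2 • ContinuousLinearMap.snd ℝ (E 2) ℝ).smulRight (f p₀.1)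
  have hG : HasStrictFDerivAt G L p₀ := by
    have h1 : HasStrictFDerivAt f (fderiv ℝ f u₀) p₀.1 := hf.hasStrictFDerivAt (by simp)
    have h2 : HasStrictFDerivAt (fun p : E 2 × ℝ => f p.1) _ p₀ :=
      h1.comp p₀ hasStrictFDerivAt_fst
    have h3 : HasStrictFDerivAt (fun p : E 2 × ℝ => Real.exp p.2) _ p₀ :=
      (hasStrictFDerivAt_snd (𝕜 := ℝ) (E := E 2) (F := ℝ) (p := p₀)).exp
    exact h3.fun_smul h2
  have hL : ∀ p : E 2 × ℝ, L p = fderiv ℝ f u₀ p.1 + p.2 • f u₀ := by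
    intro p
    simp [L, p₀]
  have hinj : Function.Injective L := by
    rw [injective_iff_map_eq_zero]
    rintro ⟨v, s⟩ h0
    rw [hL, fderiv_eq_sum_pd] at h0
    by_cases hε : ε = 0
    · exfalso
      refine hF.ne_zero (Matrix.det_eq_zero_of_row_eq_zero (Fin.last 2) fun b => ?_)
      exact (frame_row ε f u₀ b).2.2.trans (by simp [hε])
    have := frame_coeff_unique hF (a := fun i => v i) (a' := 0) (b := -s / ε) (b' := 0) (by
      have e : (-s / ε) • (-ε) • f u₀ = s • f u₀ := by
        rw [smul_smul]; congr 1; field_simp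
      rw [e]
      simpa using h0)
    have hs : s = 0 := by simpa [hε] using this.2
    have hv : v = 0 := by
      ext i
      simpa using congrFun this.1 i
    rw [hs, hv]; rfl
  have hfin : Module.finrank ℝ (E 2 × ℝ) = Module.finrank ℝ (E 3) := by simp
  have hbij : Function.Bijective L.toLinearMap :=
    ⟨hinj, (LinearMap.injective_iff_surjective_of_finrank_eq_finrank hfin).1 hinj⟩
  let e : (E 2 × ℝ) ≃L[ℝ] E 3 :=
    (LinearEquiv.ofBijective L.toLinearMap hbij).toContinuousLinearEquiv
  have he : (e : E 2 × ℝ →L[ℝ] E 3) = L := by ext p <;> rfl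
  have hG' : HasStrictFDerivAt G (e : E 2 × ℝ →L[ℝ] E 3) p₀ := he ▸ hG
  let Φ := hG'.toOpenPartialHomeomorph G
  obtain ⟨N, I, hN, hu₀, hI, h0, hsub⟩ := mem_nhds_prod_iff'.1
    (Φ.open_source.mem_nhds hG'.mem_toOpenPartialHomeomorph_source)
  obtain ⟨N', hN'sub, hN', hu₀'⟩ := mem_nhds_iff.1 (inter_mem hT hA)
  have hsub' : (N ∩ N') ×ˢ I ⊆ Φ.source := fun p hp => hsub ⟨hp.1.1, hp.2⟩
  refine ⟨N ∩ N', A '' (Φ '' ((N ∩ N') ×ˢ I)), hN.inter hN', ⟨hu₀, hu₀'⟩,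
    fun u hu => (hN'sub hu.2).1, ?_, ?_, ?_⟩
  · exact A.toHomeomorph.isOpenMap _
      (Φ.isOpen_image_of_subset_source ((hN.inter hN').prod hI) hsub')
  · intro u hu v hv huv
    have : ((u, 0) : E 2 × ℝ) = (v, 0) := Φ.injOn (hsub' ⟨hu, h0⟩) (hsub' ⟨hv, h0⟩) (by
      change G (u, 0) = G (v, 0)
      simp [G, huv])
    exact congrArg Prod.fst this
  · ext y
    constructor
    · rintro ⟨u, hu, rfl⟩
      refine ⟨(hN'sub hu.2).2, f u, ⟨(u, 0), ⟨hu, h0⟩, ?_⟩, rfl⟩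
      change G (u, 0) = _
      simp [G]
    · rintro ⟨hy, _, ⟨⟨u, s⟩, ⟨hu, _⟩, rfl⟩, rfl⟩
      change A (Real.exp s • f u) ∈ S at hy
      rw [map_smul] at hy
      have hs := hS _ (hN'sub hu.2).2 s hy
      subst hs
      refine ⟨u, hu, ?_⟩
      change _ = A (G (u, 0))
      simp [G]

/-- The linear automorphism of `ℝ³` given by an invertible matrix acting on row vectors. -/
theorem exists_equiv_vecMul {N : Matrix (Fin 3) (Fin 3) ℝ} (hN : IsUnit N.det) :
    ∃ A : E 3 ≃L[ℝ] E 3, ∀ v k, A v k = (v ᵥ* N) k := by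
  let e : E 3 ≃ₗ[ℝ] E 3 :=
    { toFun := fun v => WithLp.toLp 2 (v ᵥ* N)
      invFun := fun v => WithLp.toLp 2 (v ᵥ* N⁻¹)
      map_add' := fun v w => by ext k; simp [Matrix.add_vecMul]
      map_smul' := fun c v => by ext k; simp [Matrix.smul_vecMul]
      left_inv := fun v => by
        ext k; simp [Matrix.vecMul_vecMul, Matrix.mul_nonsing_inv _ hN]
      right_inv := fun v => by
        ext k; simp [Matrix.vecMul_vecMul, Matrix.nonsing_inv_mul _ hN] }
  exact ⟨e.toContinuousLinearEquiv, fun v k => rfl⟩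

/-! ### Vanishing cubic form: quadrics -/

/-- A positive definite symmetric form on the plane has an orthonormal basis. -/
theorem exists_orthonormal {h : Fin 2 → Fin 2 → ℝ} (hs : h 1 0 = h 0 1) (hpos : 0 < h 0 0)
    (hdet : 0 < h 0 0 * h 1 1 - h 0 1 * h 1 0) :
    ∃ P : Fin 2 → Fin 2 → ℝ, ∀ a b, ∑ i, ∑ j, P a i * P b j * h i j = if a = b then 1 else 0 := by
  rw [hs] at hdet
  set s := √(h 0 0) with hs'
  set t := √(h 0 0 * h 1 1 - h 0 1 * h 0 1) with ht'
  have hs2 : s ^ 2 = h 0 0 := Real.sq_sqrt hpos.le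
  have ht2 : t ^ 2 = h 0 0 * h 1 1 - h 0 1 * h 0 1 := Real.sq_sqrt hdet.le
  have hs0 : s ≠ 0 := (Real.sqrt_pos.2 hpos).ne'
  have ht0 : t ≠ 0 := (Real.sqrt_pos.2 hdet).ne'
  refine ⟨![![1 / s, 0], ![-h 0 1 / (s * t), h 0 0 / (s * t)]], fun a b => ?_⟩
  fin_cases a <;> fin_cases b <;> simp [Fin.sum_univ_two, hs] <;> field_simp <;> grind only

/-- The Gram matrix, in the frame `(∂₁f, ∂₂f, -ε f)`, of the quadratic form that takes the value
one on `f`. -/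
noncomputable def gramMatrix (ε : ℝ) (f : E 2 → E 3) (u : E 2) : Matrix (Fin 3) (Fin 3) ℝ :=
  !![ε * metric ε f 0 0 u, ε * metric ε f 0 1 u, 0;
     ε * metric ε f 1 0 u, ε * metric ε f 1 1 u, 0;
     0, 0, 1]

namespace IsConvexPatch

variable {ε : ℝ} {f : E 2 → E 3} {Ω : Set (E 2)} {u : E 2}

theorem exists_orthonormal (h : IsConvexPatch ε f Ω) (hu : u ∈ Ω) :
    ∃ P : Fin 2 → Fin 2 → ℝ,
      ∀ a b, ∑ i, ∑ j, P a i * P b j * metric ε f i j u = if a = b then 1 else 0 := by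
  refine Centroaffine.exists_orthonormal (h.metric_comm hu 1 0) (h.posDef u hu).diag_pos ?_
  have := (h.posDef u hu).det_pos
  rwa [Matrix.det_fin_two] at this

/-- If the cubic form vanishes, the Gram matrix is parallel. -/
theorem pdMatrix_gramMatrix (h : IsConvexPatch ε f Ω) (hε : ε * ε = 1) (hu : u ∈ Ω)
    (hC : ∀ i j k, cubicForm ε f i j k u = 0) (j : Fin 2) :
    pdMatrix j (gramMatrix ε f) u = (multMatrix ε f j u + leviCivitaMatrix ε f j u) *
      gramMatrix ε f u + gramMatrix ε f u * (multMatrix ε f j u + leviCivitaMatrix ε f j u)ᵀ := by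
  have hK : ∀ i j k, connectionDifference ε f k i j u = 0 := by
    intro i j k
    refine congrFun (h.eq_of_lower_eq hu (a := fun k => connectionDifference ε f k i j u)
      (b := 0) fun m => ?_) k
    rw [h.difference_lower hu, hC]
    simp
  have hd := fun a b => (h.contDiffAt_metric hu a b).differentiableAt_infty
  have e : ∀ a b, pd j (fun v => ε * metric ε f a b v) u = ε * (
      ∑ m, leviCivitaChristoffel ε f m j a u * metric ε f m b u
      + ∑ m, leviCivitaChristoffel ε f m j b u * metric ε f m a u) := fun a b => by
    rw [pd_const_mul (hd a b), h.pd_metric hu]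
  have m10 := h.metric_comm hu 1 0
  simp only [Fin.sum_univ_two] at e
  ext a b
  rw [pdMatrix, Matrix.of_apply]
  simp only [Matrix.add_apply, Matrix.mul_apply, Fin.sum_univ_three, Matrix.transpose_apply]
  fin_cases a <;> fin_cases b
  · refine (e 0 0).trans ?_
    simp [multMatrix, leviCivitaMatrix, gramMatrix, hK, m10]; ring
  · refine (e 0 1).trans ?_
    simp [multMatrix, leviCivitaMatrix, gramMatrix, hK, m10]; ring
  · refine (pd_const _ j u).trans ?_
    fin_cases j <;> simp [multMatrix, leviCivitaMatrix, gramMatrix, hK, m10] <;> grind only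
  · refine (e 1 0).trans ?_
    simp [multMatrix, leviCivitaMatrix, gramMatrix, hK, m10]; ring
  · refine (e 1 1).trans ?_
    simp [multMatrix, leviCivitaMatrix, gramMatrix, hK, m10]; ring
  · refine (pd_const _ j u).trans ?_
    fin_cases j <;> simp [multMatrix, leviCivitaMatrix, gramMatrix, hK, m10] <;> grind only
  · refine (pd_const _ j u).trans ?_
    fin_cases j <;> simp [multMatrix, leviCivitaMatrix, gramMatrix, hK, m10] <;> grind only
  · refine (pd_const _ j u).trans ?_
    fin_cases j <;> simp [multMatrix, leviCivitaMatrix, gramMatrix, hK, m10] <;> grind only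
  · refine (pd_const _ j u).trans ?_
    simp [multMatrix, leviCivitaMatrix, gramMatrix]

theorem contDiffAt_gramMatrix (h : IsConvexPatch ε f Ω) (hu : u ∈ Ω) (a b : Fin 3) :
    ContDiffAt ℝ ∞ (fun v => gramMatrix ε f v a b) u := by
  have h2 := fun a b => (contDiffAt_const (c := ε)).mul (h.contDiffAt_metric hu a b)
  fin_cases a <;> fin_cases b <;> simp [gramMatrix, contDiffAt_const] <;> exact h2 _ _

/-- If the cubic form vanishes, a constant quadratic form whose Gram matrix in the frame is the
right one at a point has the right Gram matrix near the point. -/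
theorem eventually_frame_mul_eq_gramMatrix (h : IsConvexPatch ε f Ω) (hε : ε * ε = 1) (hu : u ∈ Ω)
    (hC : ∀ v ∈ Ω, ∀ i j k, cubicForm ε f i j k v = 0) {Q : Matrix (Fin 3) (Fin 3) ℝ}
    (hQ : frame ε f u * Q * (frame ε f u)ᵀ = gramMatrix ε f u) :
    ∀ᶠ v in 𝓝 u, frame ε f v * Q * (frame ε f v)ᵀ = gramMatrix ε f v := by
  let M : Fin 2 → E 2 → Matrix (Fin 3) (Fin 3) ℝ :=
    fun j v => multMatrix ε f j v + leviCivitaMatrix ε f j v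
  let Y : E 2 → Matrix (Fin 3) (Fin 3) ℝ :=
    fun v => frame ε f v * Q * (frame ε f v)ᵀ - gramMatrix ε f v
  have hF := fun v hv a b => (h.contDiffAt_frame (u := v) hv a b).differentiableAt_infty
  have hFQ : ∀ v ∈ Ω, ∀ a b, DifferentiableAt ℝ (fun v => (frame ε f v * Q) a b) v := by
    intro v hv a b
    simp only [Matrix.mul_apply]
    exact DifferentiableAt.fun_sum fun c _ => (hF v hv a c).mul_const _
  have hFQF : ∀ v ∈ Ω, ∀ a b,
      DifferentiableAt ℝ (fun v => (frame ε f v * Q * (frame ε f v)ᵀ) a b) v := by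
    intro v hv a b
    simp only [Matrix.mul_apply (M := frame ε f _ * Q)]
    exact DifferentiableAt.fun_sum fun c _ => (hFQ v hv a c).fun_mul (hF v hv b c)
  have hG := fun v hv a b => (h.contDiffAt_gramMatrix (u := v) hv a b).differentiableAt_infty
  have hY : ∀ v ∈ Ω, ∀ j, pdMatrix j Y v = M j v * Y v + Y v * (M j v)ᵀ := by
    intro v hv j
    have e1 : pdMatrix j Y v = pdMatrix j (fun v => frame ε f v * Q * (frame ε f v)ᵀ) v
        - pdMatrix j (gramMatrix ε f) v := by
      ext a b
      exact pd_sub (hFQF v hv a b) (hG v hv a b) j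
    have e2 : pdMatrix j (fun v => (frame ε f v)ᵀ) v = (pdMatrix j (frame ε f) v)ᵀ := rfl
    have e3 : pdMatrix j (fun v => frame ε f v * Q) v = pdMatrix j (frame ε f) v * Q := by
      rw [pdMatrix_mul j (B := fun _ => Q) (hF v hv) fun a b => by fun_prop]
      have : pdMatrix j (fun _ : E 2 => Q) v = 0 := by
        ext a b; exact pd_const _ _ _
      rw [this, Matrix.mul_zero, add_zero]
    rw [e1, pdMatrix_mul j (hFQ v hv) (B := fun v => (frame ε f v)ᵀ) fun a b => hF v hv b a, e2, e3,
      h.pdMatrix_frame hv, h.pdMatrix_gramMatrix hε hv (hC v hv)]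
    simp only [Y, M, Matrix.transpose_mul]
    noncomm_ring
  have key := eventually_eq_zero_of_pd_eq (ι := Fin 3 × Fin 3) h.isOpen hu
    (y := fun a v => Y v a.1 a.2)
    (m := fun j a b v => (if b.2 = a.2 then M j v a.1 b.1 else 0)
      + (if b.1 = a.1 then M j v a.2 b.2 else 0))
    (fun a v hv => (hFQF v hv a.1 a.2).sub (hG v hv a.1 a.2))
    (fun j a b v hv => by
      have hM : ∀ a b, ContinuousAt (fun v => M j v a b) v := by
        intro a b
        refine (h.contDiffAt_multMatrix hv j a b).continuousAt.add ?_
        have := fun a b => (h.contDiffAt_leviCivita hv a j b).continuousAt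
        fin_cases a <;> fin_cases b <;> simp [leviCivitaMatrix, continuousAt_const] <;>
          exact this _ _
      refine ContinuousAt.add ?_ ?_ <;> split_ifs
      · exact hM _ _
      · exact continuousAt_const
      · exact hM _ _
      · exact continuousAt_const)
    (fun j a v hv => by
      have : pd j (fun v => Y v a.1 a.2) v = pdMatrix j Y v a.1 a.2 := rfl
      rw [this, hY v hv]
      simp only [Matrix.add_apply, Matrix.mul_apply, Matrix.transpose_apply, add_mul, ite_mul,
        zero_mul, Finset.sum_add_distrib, Fintype.sum_prod_type, Finset.sum_ite_eq',
        Finset.mem_univ, if_true]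
      congr 1
      rw [Finset.sum_comm]
      simp [mul_comm])
    (fun a => by simp [Y, hQ])
  filter_upwards [key] with v hv
  ext a b
  exact sub_eq_zero.1 (hv (a, b))

/-- A patch with vanishing cubic form is linearly equivalent to a piece of the quadric
`x₁² + ε x₂² + ε x₃² = 1`. -/
theorem exists_mem_quadric (h : IsConvexPatch ε f Ω) (hε : ε * ε = 1) (hu : u ∈ Ω)
    (hC : ∀ v ∈ Ω, ∀ i j k, cubicForm ε f i j k v = 0) :
    ∃ A : E 3 ≃L[ℝ] E 3, ∀ᶠ v in 𝓝 u, A (f v) ∈ quadric (Matrix.diagonal ![1, ε, ε]) := by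
  obtain ⟨P, hP⟩ := h.exists_orthonormal hu
  -- The rows of `T` are the coordinates, in the frame, of `f` and of an orthonormal basis of the
  -- tangent plane; the coordinates of `A` are those with respect to this basis of `ℝ³`.
  let T : Matrix (Fin 3) (Fin 3) ℝ := !![0, 0, -ε; P 0 0, P 0 1, 0; P 1 0, P 1 1, 0]
  let D : Matrix (Fin 3) (Fin 3) ℝ := Matrix.diagonal ![1, ε, ε]
  have hTD : T * gramMatrix ε f u * Tᵀ = D := by
    have p00 := hP 0 0
    have p01 := hP 0 1
    have p10 := hP 1 0
    have p11 := hP 1 1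
    simp [Fin.sum_univ_two] at p00 p01 p10 p11
    ext a b
    simp only [Matrix.mul_apply, Fin.sum_univ_three, Matrix.transpose_apply]
    fin_cases a <;> fin_cases b <;> simp [T, D, gramMatrix]
    · exact hε
    · linear_combination ε * p00
    · linear_combination ε * p01
    · linear_combination ε * p10
    · linear_combination ε * p11
  have hdetD : D.det = 1 := by
    simp [D, Matrix.det_diagonal, Fin.prod_univ_three, hε]
  have hdetT : IsUnit T.det := by
    rw [← hTD, Matrix.det_mul, Matrix.det_mul] at hdetD
    exact IsUnit.mk0 _ fun h0 => by simp [h0] at hdetD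
  let R := T * frame ε f u
  have hR : IsUnit R.det := by
    rw [Matrix.det_mul]; exact hdetT.mul (h.isUnit_frame hu)
  have hRi : IsUnit R⁻¹.det := (Matrix.isUnit_nonsing_inv_det_iff).2 hR
  obtain ⟨A, hA⟩ := exists_equiv_vecMul hRi
  refine ⟨A, ?_⟩
  have hQ : frame ε f u * (R⁻¹ * D * R⁻¹ᵀ) * (frame ε f u)ᵀ = gramMatrix ε f u := by
    have hF : frame ε f u * R⁻¹ = T⁻¹ := by
      rw [Matrix.mul_inv_rev, ← Matrix.mul_assoc, Matrix.mul_nonsing_inv _ (h.isUnit_frame hu),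
        Matrix.one_mul]
    calc frame ε f u * (R⁻¹ * D * R⁻¹ᵀ) * (frame ε f u)ᵀ
        = (frame ε f u * R⁻¹) * D * (frame ε f u * R⁻¹)ᵀ := by
          simp only [Matrix.transpose_mul, Matrix.mul_assoc]
      _ = (T⁻¹ * T) * gramMatrix ε f u * (T⁻¹ * T)ᵀ := by
          rw [hF, ← hTD]; simp only [Matrix.transpose_mul, Matrix.mul_assoc]
      _ = gramMatrix ε f u := by rw [Matrix.nonsing_inv_mul _ hdetT]; simp
  filter_upwards [h.eventually_frame_mul_eq_gramMatrix hε hu hC hQ] with v hv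
  -- The last diagonal entry is the value of the quadratic form on `-ε f`.
  have h22 := congrFun (congrFun hv 2) 2
  have hrow : (frame ε f v * R⁻¹) 2 = fun k => -ε * A (f v) k := by
    funext k
    have e : (frame ε f v * R⁻¹) 2 k = ∑ x : Fin 3, frame ε f v 2 x * R⁻¹ x k := rfl
    rw [hA, e]
    simp only [Matrix.vecMul, dotProduct, frame_row, Finset.mul_sum, mul_assoc]
  have e : (frame ε f v * (R⁻¹ * D * R⁻¹ᵀ) * (frame ε f v)ᵀ) 2 2
      = ((frame ε f v * R⁻¹) * D * (frame ε f v * R⁻¹)ᵀ) 2 2 := by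
    simp only [Matrix.transpose_mul, Matrix.mul_assoc]
  rw [e, Matrix.mul_apply] at h22
  simp only [D, Matrix.mul_diagonal, Matrix.transpose_apply, hrow, gramMatrix,
    Fin.sum_univ_three] at h22
  rw [quadric, Set.mem_ofPred_eq]
  simp [Fin.sum_univ_three, Matrix.diagonal_apply] at h22 ⊢
  linear_combination h22 - (A (f v) 0 ^ 2 + ε * A (f v) 1 ^ 2 + ε * A (f v) 2 ^ 2) * hε

end IsConvexPatch

/-! ### Normal form of the operator algebra -/

/-- A pair of matrices with the multiplication table of an `h`-orthonormal pair of tangent vectors,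
turned so that the cubic form vanishes on `(E₁, E₁, E₂)`. -/
structure IsNormalPair (ε a c d : ℝ) (E₁ E₂ : Matrix (Fin 3) (Fin 3) ℝ) : Prop where
  mul_self_left : E₁ * E₁ = a • E₁ - ε • 1
  mul_left_right : E₁ * E₂ = c • E₂
  mul_right_left : E₂ * E₁ = c • E₂
  mul_self_right : E₂ * E₂ = c • E₁ + d • E₂ - ε • 1
  rel : a * c = c ^ 2 + ε

/-- An orthonormal basis can be turned so that a given cubic form vanishes on `(e₁, e₁, e₂)`: that
value is an odd continuous function of the direction. -/
theorem exists_rotation {h : Fin 2 → Fin 2 → ℝ} (hs : h 1 0 = h 0 1) {P : Fin 2 → Fin 2 → ℝ}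
    (hP : ∀ a b, ∑ i, ∑ j, P a i * P b j * h i j = if a = b then 1 else 0)
    (κ : Fin 2 → Fin 2 → Fin 2 → ℝ) :
    ∃ P' : Fin 2 → Fin 2 → ℝ,
      (∀ a b, ∑ i, ∑ j, P' a i * P' b j * h i j = if a = b then 1 else 0) ∧
      ∑ i, ∑ j, ∑ k, P' 0 i * P' 0 j * P' 1 k * κ i j k = 0 := by
  let R : ℝ → Fin 2 → Fin 2 → ℝ := fun θ =>
    ![fun i => Real.cos θ * P 0 i + Real.sin θ * P 1 i,
      fun i => -Real.sin θ * P 0 i + Real.cos θ * P 1 i]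
  let g : ℝ → ℝ := fun θ => ∑ i, ∑ j, ∑ k, R θ 0 i * R θ 0 j * R θ 1 k * κ i j k
  have hg : Continuous g := by
    simp only [g, R, Fin.sum_univ_two, Matrix.cons_val_zero, Matrix.cons_val_one]
    fun_prop
  have hodd : g Real.pi = -g 0 := by
    simp [g, R, Fin.sum_univ_two]
    ring
  obtain ⟨θ, hθ⟩ : (0 : ℝ) ∈ Set.range g := by
    rcases le_total (g 0) 0 with h0 | h0
    · exact mem_range_of_exists_le_of_exists_ge hg ⟨0, h0⟩ ⟨Real.pi, by rw [hodd]; linarith⟩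
    · exact mem_range_of_exists_le_of_exists_ge hg ⟨Real.pi, by rw [hodd]; linarith⟩ ⟨0, h0⟩
  refine ⟨R θ, fun a b => ?_, hθ⟩
  have p00 := hP 0 0
  have p01 := hP 0 1
  have p11 := hP 1 1
  have hcs := Real.sin_sq_add_cos_sq θ
  simp only [Fin.sum_univ_two, hs] at p00 p01 p11
  simp at p00 p01 p11
  fin_cases a <;> fin_cases b <;> simp [R, Fin.sum_univ_two, hs] <;> grind only

/-- The products of orthonormal combinations of operators that multiply by the table
`Xᵢ Xⱼ = ∑ₖ Kᵏᵢⱼ Xₖ - ε hᵢⱼ`. -/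
theorem mul_of_orthonormal {ε : ℝ} {h : Fin 2 → Fin 2 → ℝ} {K : Fin 2 → Fin 2 → Fin 2 → ℝ}
    {X : Fin 2 → Matrix (Fin 3) (Fin 3) ℝ} {P : Fin 2 → Fin 2 → ℝ}
    (hX : ∀ i j, X i * X j = ∑ k, K k i j • X k - (ε * h i j) • 1)
    (hP : ∀ a b, ∑ i, ∑ j, P a i * P b j * h i j = if a = b then 1 else 0)
    (hX' : ∀ k, X k = ∑ c, (∑ l, h k l * P c l) • ∑ i, P c i • X i) (a b : Fin 2) :
    (∑ i, P a i • X i) * (∑ j, P b j • X j) =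
      ∑ c, (∑ i, ∑ j, ∑ l, P a i * P b j * P c l * ∑ k, K k i j * h k l) • ∑ i, P c i • X i
        - (ε * if a = b then 1 else 0) • 1 := by
  have e1 : (∑ i, P a i • X i) * (∑ j, P b j • X j) =
      ∑ k, (∑ i, ∑ j, P a i * P b j * K k i j) • X k
        - (ε * ∑ i, ∑ j, P a i * P b j * h i j) • 1 := by
    simp only [Fin.sum_univ_two, Matrix.add_mul, Matrix.mul_add, Matrix.smul_mul, Matrix.mul_smul,
      hX]
    module
  rw [e1, hP]
  congr 1
  have e2 : ∀ w : Fin 2 → ℝ, ∑ k, w k • X k =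
      ∑ c, (∑ k, ∑ l, w k * (h k l * P c l)) • ∑ i, P c i • X i := by
    intro w
    calc ∑ k, w k • X k = w 0 • (∑ c, (∑ l, h 0 l * P c l) • ∑ i, P c i • X i)
          + w 1 • (∑ c, (∑ l, h 1 l * P c l) • ∑ i, P c i • X i) := by
          rw [← hX' 0, ← hX' 1, Fin.sum_univ_two]
      _ = _ := by
          simp only [Fin.sum_univ_two]
          module
  rw [e2]
  refine Finset.sum_congr rfl fun c _ => ?_
  congr 1
  simp only [Fin.sum_univ_two]
  ring

namespace IsParallelPatch

variable {ε : ℝ} {f : E 2 → E 3} {Ω : Set (E 2)} {u : E 2}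

/-- Where the metric is flat, the multiplications by tangent vectors are spanned by a pair in
normal form. -/
theorem exists_isNormalPair (h : IsParallelPatch ε f Ω) (hε : ε * ε = 1) (hu : u ∈ Ω)
    (hR : ∀ k l, leviCivitaCurvature ε f k l u = 0) :
    ∃ (a c d : ℝ) (E₁ E₂ : Matrix (Fin 3) (Fin 3) ℝ), IsNormalPair ε a c d E₁ E₂ ∧
      Submodule.span ℝ {E₁, E₂} = multSpace ε f u := by
  obtain ⟨P₀, hP₀⟩ := h.exists_orthonormal hu
  obtain ⟨P, hP, hκ⟩ := exists_rotation (h.metric_comm hu 1 0) hP₀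
    fun i j k => ∑ l, connectionDifference ε f l i j u * metric ε f l k u
  set X := fun i => mult ε f i u with hXdef
  set H := fun i j => metric ε f i j u with hH
  -- `P H Pᵀ = 1` gives `H Pᵀ P = 1`.
  have hinv : ∀ k m, ∑ c, (∑ l, H k l * P c l) * P c m = if k = m then 1 else 0 := by
    have e1 : (Matrix.of P) * ((Matrix.of H) * (Matrix.of P)ᵀ) = 1 := by
      ext a b
      rw [Matrix.one_apply, ← hP a b]
      simp only [Matrix.mul_apply, Fin.sum_univ_two, Matrix.transpose_apply, Matrix.of_apply, hH]
      ring
    have e2 := mul_eq_one_comm.1 e1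
    intro k m
    have := congrFun (congrFun e2 k) m
    rw [Matrix.one_apply] at this
    rw [← this]
    simp only [Matrix.mul_apply, Fin.sum_univ_two, Matrix.transpose_apply, Matrix.of_apply]
  have hX' : ∀ k, X k = ∑ c, (∑ l, H k l * P c l) • ∑ i, P c i • X i := by
    intro k
    have e : ∑ c, (∑ l, H k l * P c l) • ∑ i, P c i • X i =
        ∑ i, (∑ c, (∑ l, H k l * P c l) * P c i) • X i := by
      simp only [Fin.sum_univ_two]
      module
    rw [e]
    simp only [hinv, ite_smul, one_smul, zero_smul, Finset.sum_ite_eq, Finset.mem_univ, if_true]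
  have hmul := mul_of_orthonormal (ε := ε) (h := H)
    (K := fun k i j => connectionDifference ε f k i j u) (X := X) (P := P)
    (fun i j => h.mult_mul hu hR i j) hP hX'
  -- The lowered difference tensor, in the parameters and in the orthonormal basis `P`.
  set t : Fin 2 → Fin 2 → Fin 2 → ℝ := fun i j l =>
    ∑ k, connectionDifference ε f k i j u * H k l with htdef
  set κ : Fin 2 → Fin 2 → Fin 2 → ℝ := fun a b c => ∑ i, ∑ j, ∑ l, P a i * P b j * P c l *
    t i j l with hκdef
  have hκ' : κ 0 0 1 = 0 := hκ
  have t1 : ∀ i j l, t i j l = t i l j := h.difference_lower_comm hu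
  have t2 : ∀ i j l, t i j l = t j i l := fun i j l =>
    Finset.sum_congr rfl fun k _ => by rw [h.difference_comm hu k i j]
  have sym₁ : ∀ a b c, κ a b c = κ a c b := by
    intro a b c
    simp only [hκdef, Fin.sum_univ_two, t1 _ 1 0]
    ring
  have sym₂ : ∀ a b c, κ a b c = κ b a c := by
    intro a b c
    simp only [hκdef, Fin.sum_univ_two, t2 1 0]
    ring
  have s1 : κ 0 1 0 = 0 := by rw [sym₁, hκ']
  have s2 : κ 1 0 0 = 0 := by rw [sym₂, s1]
  have s3 : κ 1 0 1 = κ 0 1 1 := sym₂ _ _ _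
  have s4 : κ 1 1 0 = κ 0 1 1 := by rw [sym₁, s3]
  set F : Fin 2 → Matrix (Fin 3) (Fin 3) ℝ := fun c => ∑ i, P c i • X i with hF
  have hmul' : ∀ a b, F a * F b = κ a b 0 • F 0 + κ a b 1 • F 1
      - (ε * if a = b then 1 else 0) • 1 := by
    intro a b
    rw [hF, hmul a b, Fin.sum_univ_two]
  have hF1 : F 1 ≠ 0 := by
    intro h0
    have := Fintype.linearIndependent_iff.1 (h.linearIndependent_mult hε hu) (P 1) h0
    have h11 := hP 1 1
    simp [this] at h11
  have hN : IsNormalPair ε (κ 0 0 0) (κ 0 1 1) (κ 1 1 1) (F 0) (F 1) := by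
    have m1 : F 0 * F 0 = κ 0 0 0 • F 0 - ε • 1 := by simpa [hκ'] using hmul' 0 0
    have m2 : F 0 * F 1 = κ 0 1 1 • F 1 := by simpa [s1] using hmul' 0 1
    refine ⟨m1, m2, by simpa [s2, s3] using hmul' 1 0, by simpa [s4] using hmul' 1 1, ?_⟩
    -- `(E₁ E₁) E₂ = E₁ (E₁ E₂)` gives the relation.
    have assoc := Matrix.mul_assoc (F 0) (F 0) (F 1)
    rw [m1, m2, Matrix.sub_mul, Matrix.smul_mul, Matrix.smul_mul, Matrix.mul_smul, m2,
      Matrix.one_mul, smul_smul, smul_smul, ← sub_smul] at assoc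
    have : (κ 0 0 0 * κ 0 1 1 - ε - κ 0 1 1 * κ 0 1 1) • F 1 = 0 := by
      rw [sub_smul, assoc, sub_self]
    have := (smul_eq_zero.1 this).resolve_right hF1
    linear_combination this
  refine ⟨_, _, _, F 0, F 1, hN, le_antisymm ?_ ?_⟩
  · rw [Submodule.span_le]
    have hmem : ∀ c, F c ∈ multSpace ε f u := fun c =>
      Submodule.sum_mem _ fun i _ => Submodule.smul_mem _ _ (Submodule.subset_span ⟨i, rfl⟩)
    rintro A (rfl | rfl)
    · exact hmem 0
    · exact hmem 1
  · refine Submodule.span_le.2 ?_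
    rintro _ ⟨i, rfl⟩
    have := hX' i
    rw [Fin.sum_univ_two] at this
    rw [SetLike.mem_coe, Submodule.mem_span_pair]
    exact ⟨_, _, this.symm⟩

end IsParallelPatch

/-! ### Parametrizations tangent to an operator algebra lie in a model surface -/

/-- The rows `v, v E₁, v E₂`; they form a basis when `v` is a cyclic vector of the algebra. -/
def cyclicMatrix (E₁ E₂ : Matrix (Fin 3) (Fin 3) ℝ) (v : Fin 3 → ℝ) : Matrix (Fin 3) (Fin 3) ℝ :=
  Matrix.of ![v, v ᵥ* E₁, v ᵥ* E₂]

/-- Near `u₀` the tangent vectors of `f` are obtained from its position vector by operators in the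
span of `E₁` and `E₂`, and the position vector at `u₀` is cyclic. -/
structure IsOrbitPatch (E₁ E₂ : Matrix (Fin 3) (Fin 3) ℝ) (f : E 2 → E 3) (u₀ : E 2) : Prop where
  differentiableAt : ∀ᶠ u in 𝓝 u₀, DifferentiableAt ℝ f u
  pd_eq : ∀ᶠ u in 𝓝 u₀, ∀ i, ∃ s t : ℝ, ∀ b, pd i f u b = (f u ᵥ* (s • E₁ + t • E₂)) b
  isUnit_cyclic : IsUnit (cyclicMatrix E₁ E₂ (f u₀)).det

/-- The matrix of the multiplication by `E₁`: its rows are the coordinates of the products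
`E₁, E₁ E₁, E₂ E₁` in the basis `1, E₁, E₂`. -/
def tableLeft (ε a c : ℝ) : Matrix (Fin 3) (Fin 3) ℝ := !![0, 1, 0; -ε, a, 0; 0, 0, c]

/-- The matrix of the multiplication by `E₂`: its rows are the coordinates of the products
`E₂, E₁ E₂, E₂ E₂` in the basis `1, E₁, E₂`. -/
def tableRight (ε c d : ℝ) : Matrix (Fin 3) (Fin 3) ℝ := !![0, 0, 1; 0, 0, c; -ε, c, d]

/-- `S` is a local model for the pair `E₁, E₂`: it meets each ray at most once, and every
orbit patch of the pair can be moved into it. -/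
def IsModel (E₁ E₂ : Matrix (Fin 3) (Fin 3) ℝ) (S : Set (E 3)) : Prop :=
  (∀ y ∈ S, ∀ s : ℝ, Real.exp s • y ∈ S → s = 0) ∧
  ∀ (f : E 2 → E 3) (u₀ : E 2), IsOrbitPatch E₁ E₂ f u₀ →
    ∃ A : E 3 ≃L[ℝ] E 3, ∀ᶠ u in 𝓝 u₀, A (f u) ∈ S

section Models

variable {ε a c d : ℝ} {E₁ E₂ : Matrix (Fin 3) (Fin 3) ℝ} {f : E 2 → E 3} {u₀ : E 2}

theorem cyclicMatrix_mul_left (hN : IsNormalPair ε a c d E₁ E₂) (v : Fin 3 → ℝ) :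
    cyclicMatrix E₁ E₂ v * E₁ = tableLeft ε a c * cyclicMatrix E₁ E₂ v := by
  have h1 : (v ᵥ* E₁) ᵥ* E₁ = a • (v ᵥ* E₁) - ε • v := by
    rw [Matrix.vecMul_vecMul, hN.mul_self_left, Matrix.vecMul_sub, Matrix.vecMul_smul,
      Matrix.vecMul_smul, Matrix.vecMul_one]
  have h2 : (v ᵥ* E₂) ᵥ* E₁ = c • (v ᵥ* E₂) := by
    rw [Matrix.vecMul_vecMul, hN.mul_right_left, Matrix.vecMul_smul]
  ext i b
  rw [Matrix.mul_apply, Matrix.mul_apply,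
    Fin.sum_univ_three (f := fun j => tableLeft ε a c i j * _)]
  fin_cases i
  · simp [cyclicMatrix, tableLeft, Matrix.vecMul, dotProduct]
  · refine (congrFun h1 b).trans ?_
    simp [cyclicMatrix, tableLeft]; ring
  · refine (congrFun h2 b).trans ?_
    simp [cyclicMatrix, tableLeft]

theorem cyclicMatrix_mul_right (hN : IsNormalPair ε a c d E₁ E₂) (v : Fin 3 → ℝ) :
    cyclicMatrix E₁ E₂ v * E₂ = tableRight ε c d * cyclicMatrix E₁ E₂ v := by
  have h1 : (v ᵥ* E₁) ᵥ* E₂ = c • (v ᵥ* E₂) := by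
    rw [Matrix.vecMul_vecMul, hN.mul_left_right, Matrix.vecMul_smul]
  have h2 : (v ᵥ* E₂) ᵥ* E₂ = c • (v ᵥ* E₁) + d • (v ᵥ* E₂) - ε • v := by
    rw [Matrix.vecMul_vecMul, hN.mul_self_right, Matrix.vecMul_sub, Matrix.vecMul_add,
      Matrix.vecMul_smul, Matrix.vecMul_smul, Matrix.vecMul_smul, Matrix.vecMul_one]
  ext i b
  rw [Matrix.mul_apply, Matrix.mul_apply,
    Fin.sum_univ_three (f := fun j => tableRight ε c d i j * _)]
  fin_cases i
  · simp [cyclicMatrix, tableRight, Matrix.vecMul, dotProduct]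
  · refine (congrFun h1 b).trans ?_
    simp [cyclicMatrix, tableRight]
  · refine (congrFun h2 b).trans ?_
    simp [cyclicMatrix, tableRight]; ring

/-- Linear coordinates adapted to a representation of the algebra with basis `1, E₁, E₂`: the rows
of `N₀` are the images of `1, E₁, E₂`, on which `E₁` and `E₂` act by `Y₁` and `Y₂`. In these
coordinates the patch starts at the image of `1`. -/
theorem IsOrbitPatch.exists_coordinates (hf : IsOrbitPatch E₁ E₂ f u₀)
    (hN : IsNormalPair ε a c d E₁ E₂) {N₀ Y₁ Y₂ : Matrix (Fin 3) (Fin 3) ℝ}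
    (hdet : N₀.det ≠ 0) (h₁ : tableLeft ε a c * N₀ = N₀ * Y₁)
    (h₂ : tableRight ε c d * N₀ = N₀ * Y₂) :
    ∃ A : E 3 ≃L[ℝ] E 3, (∀ k, A (f u₀) k = N₀ 0 k) ∧
      ∀ᶠ u in 𝓝 u₀, (∀ k, DifferentiableAt ℝ (fun v => A (f v) k) u) ∧
        ∀ i, ∃ s t : ℝ, ∀ k, pd i (fun v => A (f v) k) u =
          ∑ l, A (f u) l * (s * Y₁ l k + t * Y₂ l k) := by
  set B := cyclicMatrix E₁ E₂ (f u₀) with hB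
  have hBu : IsUnit B.det := hf.isUnit_cyclic
  set N := B⁻¹ * N₀ with hNdef
  have hNdet : IsUnit N.det := by
    rw [hNdef, Matrix.det_mul]
    exact (Matrix.isUnit_nonsing_inv_det_iff.2 hBu).mul hdet.isUnit
  have hconj : ∀ {X T Y : Matrix (Fin 3) (Fin 3) ℝ}, B * X = T * B → T * N₀ = N₀ * Y →
      X * N = N * Y := by
    intro X T Y hX hT
    have e : X = B⁻¹ * (T * B) := by
      rw [← hX, ← Matrix.mul_assoc, Matrix.nonsing_inv_mul _ hBu, Matrix.one_mul]
    calc X * N = B⁻¹ * T * (B * B⁻¹) * N₀ := by rw [e, hNdef]; simp only [Matrix.mul_assoc]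
      _ = N * Y := by
        rw [Matrix.mul_nonsing_inv _ hBu, Matrix.mul_one, Matrix.mul_assoc, hT, hNdef,
          Matrix.mul_assoc]
  have c₁ := hconj (cyclicMatrix_mul_left hN (f u₀)) h₁
  have c₂ := hconj (cyclicMatrix_mul_right hN (f u₀)) h₂
  obtain ⟨A, hA⟩ := exists_equiv_vecMul hNdet
  refine ⟨A, fun k => ?_, ?_⟩
  · have : B * N = N₀ := by
      rw [hNdef, ← Matrix.mul_assoc, Matrix.mul_nonsing_inv _ hBu, Matrix.one_mul]
    rw [hA, ← this]
    rfl
  · filter_upwards [hf.differentiableAt, hf.pd_eq] with u hd hpd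
    have hdb : ∀ b, DifferentiableAt ℝ (fun v => f v b) u := fun b =>
      differentiableAt_coord hd b
    have hAf : ∀ k, (fun v => A (f v) k) = fun v => ∑ b, f v b * N b k := fun k => by
      funext v; rw [hA]; rfl
    refine ⟨fun k => ?_, fun i => ?_⟩
    · rw [hAf]
      exact DifferentiableAt.fun_sum fun b _ => (hdb b).mul_const _
    · obtain ⟨s, t, hst⟩ := hpd i
      refine ⟨s, t, fun k => ?_⟩
      have e1 : pd i (fun v => A (f v) k) u = ((f u ᵥ* (s • E₁ + t • E₂)) ᵥ* N) k := by
        rw [hAf, pd_sum _ fun b _ => (hdb b).mul_const _]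
        change _ = ∑ b, (f u ᵥ* (s • E₁ + t • E₂)) b * N b k
        refine Finset.sum_congr rfl fun b _ => ?_
        rw [pd_mul (hdb b) (by fun_prop), pd_const, pd_coord hd, hst]
        simp
      rw [e1, Matrix.vecMul_vecMul, Matrix.add_mul, Matrix.smul_mul, Matrix.smul_mul, c₁, c₂,
        ← Matrix.mul_smul, ← Matrix.mul_smul, ← Matrix.mul_add, ← Matrix.vecMul_vecMul]
      simp only [Matrix.vecMul, dotProduct, Matrix.add_apply, Matrix.smul_apply, smul_eq_mul, hA]

/-- The power surfaces are the models of the algebras with three real characters `χₖ`, with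
`χₖ(E₁) = pₖ` and `χₖ(E₂) = qₖ`. -/
theorem isModel_powerSurface (hN : IsNormalPair ε a c d E₁ E₂) {p q α : Fin 3 → ℝ}
    (hp : ∀ k, p k ^ 2 = a * p k - ε) (hpq : ∀ k, p k * q k = c * q k)
    (hq : ∀ k, q k ^ 2 = c * p k + d * q k - ε) (hdet : (Matrix.of ![1, p, q]).det ≠ 0)
    (hαp : ∑ k, α k * p k = 0) (hαq : ∑ k, α k * q k = 0) (hα : ∑ k, α k ≠ 0) :
    IsModel E₁ E₂ (powerSurface (α 0) (α 1) (α 2)) := by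
  rw [Fin.sum_univ_three] at hαp hαq hα
  refine ⟨?_, fun f u₀ hf => ?_⟩
  · rintro y ⟨h0, h1, h2, h⟩ s ⟨-, -, -, h'⟩
    have e : ∀ k, 0 < y k → ∀ β : ℝ, (Real.exp s • y) k ^ β = Real.exp (s * β) * y k ^ β := by
      intro k hk β
      rw [PiLp.smul_apply, smul_eq_mul, Real.mul_rpow (Real.exp_pos s).le hk.le, ← Real.exp_mul]
    rw [e 0 h0, e 1 h1, e 2 h2] at h'
    have : Real.exp (s * (α 0 + α 1 + α 2)) = 1 := by
      rw [mul_add, mul_add, Real.exp_add, Real.exp_add]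
      linear_combination h' - Real.exp (s * α 0) * Real.exp (s * α 1) * Real.exp (s * α 2) * h
    exact (mul_eq_zero.1 (Real.exp_eq_one_iff _ |>.1 this)).resolve_right hα
  · obtain ⟨A, hA0, hA⟩ := hf.exists_coordinates hN (N₀ := Matrix.of ![1, p, q])
      (Y₁ := Matrix.diagonal p) (Y₂ := Matrix.diagonal q) hdet
      (by
        ext i k
        rw [Matrix.mul_diagonal, Matrix.mul_apply, Fin.sum_univ_three]
        fin_cases i <;> simp [tableLeft]
        · linear_combination -hp k
        · linear_combination -hpq k)
      (by
        ext i k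
        rw [Matrix.mul_diagonal, Matrix.mul_apply, Fin.sum_univ_three]
        fin_cases i <;> simp [tableRight, -mul_eq_mul_right_iff]
        · linear_combination -hpq k
        · linear_combination -hq k)
    refine ⟨A, ?_⟩
    have hA0' : ∀ k, A (f u₀) k = 1 := fun k => hA0 k
    have hpos : ∀ᶠ u in 𝓝 u₀, ∀ k, 0 < A (f u) k := by
      rw [eventually_all]
      intro k
      exact (hA.self_of_nhds.1 k).continuousAt.eventually_const_lt (by simp [hA0'])
    have hlog : ∀ᶠ u in 𝓝 u₀, ∀ k, DifferentiableAt ℝ (fun v => Real.log (A (f v) k)) u := by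
      filter_upwards [hA, hpos] with u hu hup k using (hu.1 k).log (hup k).ne'
    -- The defining function of the model, in logarithmic form, is constant along the patch.
    have hρ := eventually_eq_of_pd_eq_zero
      (y := fun v => α 0 * Real.log (A (f v) 0) + α 1 * Real.log (A (f v) 1)
        + α 2 * Real.log (A (f v) 2)) (u₀ := u₀)
      (by
        filter_upwards [hlog] with u hu
        exact (((hu 0).const_mul _).add ((hu 1).const_mul _)).add ((hu 2).const_mul _))
      (by
        filter_upwards [hA, hpos, hlog] with u hu hup hul i
        obtain ⟨s, t, hst⟩ := hu.2 i
        have e : ∀ k, pd i (fun v => Real.log (A (f v) k)) u = s * p k + t * q k := by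
          intro k
          rw [pd_log (hu.1 k) (hup k).ne', hst, div_eq_iff (hup k).ne']
          simp [Matrix.diagonal_apply, mul_add, Finset.sum_add_distrib]
          ring
        rw [pd_add (((hul 0).const_mul _).fun_add ((hul 1).const_mul _)) ((hul 2).const_mul _),
          pd_add ((hul 0).const_mul _) ((hul 1).const_mul _), pd_const_mul (hul 0),
          pd_const_mul (hul 1), pd_const_mul (hul 2), e, e, e]
        linear_combination s * hαp + t * hαq)
    filter_upwards [hρ, hpos] with u hu hup
    refine ⟨hup 0, hup 1, hup 2, ?_⟩
    rw [Real.rpow_def_of_pos (hup 0), Real.rpow_def_of_pos (hup 1), Real.rpow_def_of_pos (hup 2),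
      ← Real.exp_add, ← Real.exp_add, Real.exp_eq_one_iff]
    simp only [hA0', Real.log_one] at hu
    linear_combination hu

/-- The spiral surfaces are the models of the algebras with one real character, with values `p₀`
and `0`, and one complex character, with values `c` and `σ + τ i`. -/
theorem isModel_spiralSurface (hN : IsNormalPair ε a c d E₁ E₂) {p₀ σ τ α₁ α₂ α₃ : ℝ}
    (hp₀ : p₀ ^ 2 = a * p₀ - ε) (hc : c ^ 2 = a * c - ε) (hpc : c * p₀ = ε)
    (hσ : σ ^ 2 - τ ^ 2 = c ^ 2 + d * σ - ε) (hστ : 2 * σ * τ = d * τ) (hτ : τ ≠ 0) (hne : p₀ ≠ c)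
    (h1 : α₁ * p₀ + 2 * α₂ * c = 0) (h2 : 2 * α₂ * σ + α₃ * τ = 0) (hα : α₁ + 2 * α₂ ≠ 0) :
    IsModel E₁ E₂ (spiralSurface α₁ α₂ α₃) := by
  refine ⟨?_, fun f u₀ hf => ?_⟩
  · rintro y ⟨h0, hy2, h⟩ s ⟨-, -, h'⟩
    have hes := (Real.exp_pos s).ne'
    have hsq : 0 < y 1 ^ 2 + y 2 ^ 2 := by positivity
    simp only [PiLp.smul_apply, smul_eq_mul] at h'
    rw [mul_div_mul_left _ _ hes, show (Real.exp s * y 1) ^ 2 + (Real.exp s * y 2) ^ 2 =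
      Real.exp (s * 2) * (y 1 ^ 2 + y 2 ^ 2) by rw [Real.exp_mul]; norm_cast; ring,
      Real.mul_rpow (Real.exp_pos _).le hsq.le, Real.mul_rpow (Real.exp_pos _).le h0.le,
      ← Real.exp_mul, ← Real.exp_mul] at h'
    have : Real.exp (s * (α₁ + 2 * α₂)) = 1 := by
      rw [mul_add, Real.exp_add, ← mul_assoc s 2 α₂]
      linear_combination h' - Real.exp (s * α₁) * Real.exp (s * 2 * α₂) * h
    exact (mul_eq_zero.1 (Real.exp_eq_one_iff _ |>.1 this)).resolve_right hα
  · obtain ⟨A, hA0, hA⟩ := hf.exists_coordinates hN (N₀ := !![1, 0, 1; p₀, 0, c; 0, τ, σ])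
      (Y₁ := !![p₀, 0, 0; 0, c, 0; 0, 0, c]) (Y₂ := !![0, 0, 0; 0, σ, -τ; 0, τ, σ])
      (by
        simp [Matrix.det_fin_three]
        intro h0
        have : (p₀ - c) * τ = 0 := by linear_combination h0
        rcases mul_eq_zero.1 this with h | h
        · exact hne (by linear_combination h)
        · exact hτ h)
      (by
        ext i k
        fin_cases i <;> fin_cases k <;>
          simp [tableLeft, Matrix.mul_apply, Fin.sum_univ_three] <;> grind only)
      (by
        ext i k
        fin_cases i <;> fin_cases k <;>
          simp [tableRight, Matrix.mul_apply, Fin.sum_univ_three] <;> grind only)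
    refine ⟨A, ?_⟩
    have h00 : A (f u₀) 0 = 1 := by rw [hA0]; rfl
    have h01 : A (f u₀) 1 = 0 := by rw [hA0]; rfl
    have h02 : A (f u₀) 2 = 1 := by rw [hA0]; rfl
    have hpos0 : ∀ᶠ u in 𝓝 u₀, 0 < A (f u) 0 :=
      (hA.self_of_nhds.1 0).continuousAt.eventually_const_lt (by simp [h00])
    have hpos2 : ∀ᶠ u in 𝓝 u₀, 0 < A (f u) 2 :=
      (hA.self_of_nhds.1 2).continuousAt.eventually_const_lt (by simp [h02])
    have hsq : ∀ {u}, 0 < A (f u) 2 → A (f u) 1 * A (f u) 1 + A (f u) 2 * A (f u) 2 ≠ 0 := by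
      intro u hu
      have := mul_pos hu hu
      have := mul_self_nonneg (A (f u) 1)
      linarith
    have hd : ∀ᶠ u in 𝓝 u₀, DifferentiableAt ℝ (fun v => Real.log (A (f v) 0)) u ∧
        DifferentiableAt ℝ (fun v => Real.log (A (f v) 1 * A (f v) 1 + A (f v) 2 * A (f v) 2)) u ∧
        DifferentiableAt ℝ (fun v => Real.arctan (A (f v) 1 / A (f v) 2)) u := by
      filter_upwards [hA, hpos0, hpos2] with u hu hu0 hu2
      exact ⟨(hu.1 0).log hu0.ne', (((hu.1 1).fun_mul (hu.1 1)).fun_add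
        ((hu.1 2).fun_mul (hu.1 2))).log (hsq hu2),
        (differentiableAt_div (hu.1 1) (hu.1 2) hu2.ne').arctan⟩
    -- The defining function of the model, in logarithmic form, is constant along the patch.
    have hρ := eventually_eq_of_pd_eq_zero
      (y := fun v => α₁ * Real.log (A (f v) 0)
        + α₂ * Real.log (A (f v) 1 * A (f v) 1 + A (f v) 2 * A (f v) 2)
        + α₃ * Real.arctan (A (f v) 1 / A (f v) 2)) (u₀ := u₀)
      (by
        filter_upwards [hd] with u hu
        exact ((hu.1.const_mul _).add (hu.2.1.const_mul _)).add (hu.2.2.const_mul _))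
      (by
        filter_upwards [hA, hpos0, hpos2, hd] with u hu hu0 hu2 hud i
        obtain ⟨s, t, hst⟩ := hu.2 i
        have e0 := hst 0
        have e1 := hst 1
        have e2 := hst 2
        simp [Fin.sum_univ_three] at e0 e1 e2
        have hdq := ((hu.1 1).fun_mul (hu.1 1)).fun_add ((hu.1 2).fun_mul (hu.1 2))
        have l0 : pd i (fun v => Real.log (A (f v) 0)) u = s * p₀ := by
          rw [pd_log (hu.1 0) hu0.ne', e0, div_eq_iff hu0.ne']; ring
        have l1 : pd i (fun v => Real.log (A (f v) 1 * A (f v) 1 + A (f v) 2 * A (f v) 2)) u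
            = 2 * (s * c + t * σ) := by
          rw [pd_log hdq (hsq hu2), pd_add ((hu.1 1).fun_mul (hu.1 1)) ((hu.1 2).fun_mul (hu.1 2)),
            pd_mul (hu.1 1) (hu.1 1), pd_mul (hu.1 2) (hu.1 2), e1, e2, div_eq_iff (hsq hu2)]
          ring
        have l2 : pd i (fun v => Real.arctan (A (f v) 1 / A (f v) 2)) u = t * τ := by
          rw [pd_comp_real (Real.hasDerivAt_arctan _)
              (differentiableAt_div (hu.1 1) (hu.1 2) hu2.ne'),
            pd_div (hu.1 1) (hu.1 2) hu2.ne', e1, e2]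
          have h2 := hu2.ne'
          have h3 : A (f u) 2 ^ 2 + A (f u) 1 ^ 2 ≠ 0 := by
            have := hsq hu2
            intro h0
            exact this (by linear_combination h0)
          field_simp
          ring
        rw [pd_add ((hud.1.const_mul _).fun_add (hud.2.1.const_mul _)) (hud.2.2.const_mul _),
          pd_add (hud.1.const_mul _) (hud.2.1.const_mul _), pd_const_mul hud.1,
          pd_const_mul hud.2.1, pd_const_mul hud.2.2, l0, l1, l2]
        linear_combination s * h1 + t * h2)
    filter_upwards [hρ, hpos0, hpos2] with u hu hu0 hu2
    refine ⟨hu0, hu2.ne', ?_⟩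
    have hsq' : 0 < A (f u) 1 ^ 2 + A (f u) 2 ^ 2 := by positivity
    rw [Real.rpow_def_of_pos hu0, Real.rpow_def_of_pos hsq', ← Real.exp_add, ← Real.exp_add,
      Real.exp_eq_one_iff]
    simp [h00, h01, h02] at hu
    rw [sq, sq]
    linear_combination hu

/-- The surfaces `x₃ = x₁ (ln x₁ - α ln x₂)` are the models of the algebras with two real
characters, with values `p₀, q₀` and `p₁, q₁`, and a derivation along the first, with values
`p₀ - α p₁, q₀ - α q₁`. -/
theorem isModel_logSurface (hN : IsNormalPair ε a c d E₁ E₂) {p₀ q₀ p₁ q₁ p₂ q₂ α : ℝ}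
    (hdet : (!![1, 1, 0; p₀, p₁, p₂; q₀, q₁, q₂] : Matrix (Fin 3) (Fin 3) ℝ).det ≠ 0)
    (hY₁ : tableLeft ε a c * !![1, 1, 0; p₀, p₁, p₂; q₀, q₁, q₂] =
      !![1, 1, 0; p₀, p₁, p₂; q₀, q₁, q₂] * !![p₀, 0, p₂; 0, p₁, 0; 0, 0, p₀])
    (hY₂ : tableRight ε c d * !![1, 1, 0; p₀, p₁, p₂; q₀, q₁, q₂] =
      !![1, 1, 0; p₀, p₁, p₂; q₀, q₁, q₂] * !![q₀, 0, q₂; 0, q₁, 0; 0, 0, q₀])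
    (hp : p₂ = p₀ - α * p₁) (hq : q₂ = q₀ - α * q₁) (hα : α ≠ 1) :
    IsModel E₁ E₂ (logSurface α) := by
  refine ⟨?_, fun f u₀ hf => ?_⟩
  · rintro y ⟨h0, h1, h⟩ s ⟨-, -, h'⟩
    have hes := (Real.exp_pos s).ne'
    simp only [PiLp.smul_apply, smul_eq_mul] at h'
    rw [Real.log_mul hes h0.ne', Real.log_mul hes h1.ne', Real.log_exp, h] at h'
    have : (Real.exp s * y 0 * (1 - α)) * s = 0 := by linear_combination -h'
    exact (mul_eq_zero.1 this).resolve_left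
      (mul_ne_zero (mul_ne_zero hes h0.ne') (sub_ne_zero.2 hα.symm))
  · obtain ⟨A, hA0, hA⟩ := hf.exists_coordinates hN hdet hY₁ hY₂
    refine ⟨A, ?_⟩
    have h00 : A (f u₀) 0 = 1 := by rw [hA0]; rfl
    have h01 : A (f u₀) 1 = 1 := by rw [hA0]; rfl
    have h02 : A (f u₀) 2 = 0 := by rw [hA0]; rfl
    have hpos0 : ∀ᶠ u in 𝓝 u₀, 0 < A (f u) 0 :=
      (hA.self_of_nhds.1 0).continuousAt.eventually_const_lt (by simp [h00])
    have hpos1 : ∀ᶠ u in 𝓝 u₀, 0 < A (f u) 1 :=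
      (hA.self_of_nhds.1 1).continuousAt.eventually_const_lt (by simp [h01])
    have hd : ∀ᶠ u in 𝓝 u₀, DifferentiableAt ℝ (fun v => A (f v) 2 / A (f v) 0) u ∧
        DifferentiableAt ℝ (fun v => Real.log (A (f v) 0)) u ∧
        DifferentiableAt ℝ (fun v => Real.log (A (f v) 1)) u := by
      filter_upwards [hA, hpos0, hpos1] with u hu hu0 hu1
      exact ⟨differentiableAt_div (hu.1 2) (hu.1 0) hu0.ne', (hu.1 0).log hu0.ne',
        (hu.1 1).log hu1.ne'⟩
    -- The defining function of the model, in logarithmic form, is constant along the patch.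
    have hρ := eventually_eq_of_pd_eq_zero
      (y := fun v => A (f v) 2 / A (f v) 0 - Real.log (A (f v) 0) + α * Real.log (A (f v) 1))
      (u₀ := u₀)
      (by
        filter_upwards [hd] with u hu
        exact (hu.1.sub hu.2.1).add (hu.2.2.const_mul _))
      (by
        filter_upwards [hA, hpos0, hpos1, hd] with u hu hu0 hu1 hud i
        obtain ⟨s, t, hst⟩ := hu.2 i
        have e0 := hst 0
        have e1 := hst 1
        have e2 := hst 2
        simp [Fin.sum_univ_three] at e0 e1 e2
        have l0 : pd i (fun v => A (f v) 2 / A (f v) 0) u = s * p₂ + t * q₂ := by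
          rw [pd_div (hu.1 2) (hu.1 0) hu0.ne', e0, e2, div_eq_iff (pow_ne_zero 2 hu0.ne')]
          ring
        have l1 : pd i (fun v => Real.log (A (f v) 0)) u = s * p₀ + t * q₀ := by
          rw [pd_log (hu.1 0) hu0.ne', e0, div_eq_iff hu0.ne']; ring
        have l2 : pd i (fun v => Real.log (A (f v) 1)) u = s * p₁ + t * q₁ := by
          rw [pd_log (hu.1 1) hu1.ne', e1, div_eq_iff hu1.ne']; ring
        rw [pd_add (hud.1.fun_sub hud.2.1) (hud.2.2.const_mul _), pd_sub hud.1 hud.2.1,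
          pd_const_mul hud.2.2, l0, l1, l2]
        linear_combination s * hp + t * hq)
    filter_upwards [hρ, hpos0, hpos1] with u hu hu0 hu1
    refine ⟨hu0, hu1, ?_⟩
    simp [h00, h01, h02] at hu
    have h0 := hu0.ne'
    field_simp at hu
    linear_combination hu

/-- The surface `x₃ = x₂² / (2 x₁) + x₁ ln x₁` is the model of the algebra `ℝ[η] / η³`, where
`E₁ = c + c η²` and `E₂ = η`. -/
theorem isModel_logParaboloid (hN : IsNormalPair 1 a c 0 E₁ E₂) (hc : c ^ 2 = 1)
    (ha : a = 2 * c) : IsModel E₁ E₂ logParaboloid := by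
  refine ⟨?_, fun f u₀ hf => ?_⟩
  · rintro y ⟨h0, h⟩ s ⟨-, h'⟩
    have hes := (Real.exp_pos s).ne'
    have hy := h0.ne'
    simp only [PiLp.smul_apply, smul_eq_mul] at h'
    rw [Real.log_mul hes h0.ne', Real.log_exp, h] at h'
    field_simp at h'
    have : y 0 ^ 2 * s = 0 := by linear_combination -h' / 2
    exact (mul_eq_zero.1 this).resolve_left (pow_ne_zero 2 hy)
  · obtain ⟨A, hA0, hA⟩ := hf.exists_coordinates hN (N₀ := !![1, 0, 0; c, 0, c; 0, 1, 0])
      (Y₁ := !![c, 0, c; 0, c, 0; 0, 0, c]) (Y₂ := !![0, 1, 0; 0, 0, 1; 0, 0, 0])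
      (by
        simp [Matrix.det_fin_three]
        rintro rfl
        norm_num at hc)
      (by
        ext i k
        fin_cases i <;> fin_cases k <;>
          simp [tableLeft, Matrix.mul_apply, Fin.sum_univ_three] <;> grind only)
      (by
        ext i k
        fin_cases i <;> fin_cases k <;>
          simp [tableRight, Matrix.mul_apply, Fin.sum_univ_three] <;> grind only)
    refine ⟨A, ?_⟩
    have h00 : A (f u₀) 0 = 1 := by rw [hA0]; rfl
    have h01 : A (f u₀) 1 = 0 := by rw [hA0]; rfl
    have h02 : A (f u₀) 2 = 0 := by rw [hA0]; rfl
    have hpos0 : ∀ᶠ u in 𝓝 u₀, 0 < A (f u) 0 :=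
      (hA.self_of_nhds.1 0).continuousAt.eventually_const_lt (by simp [h00])
    have hd : ∀ᶠ u in 𝓝 u₀, DifferentiableAt ℝ (fun v => A (f v) 2 / A (f v) 0) u ∧
        DifferentiableAt ℝ (fun v => A (f v) 1 / A (f v) 0) u ∧
        DifferentiableAt ℝ (fun v => Real.log (A (f v) 0)) u := by
      filter_upwards [hA, hpos0] with u hu hu0
      exact ⟨differentiableAt_div (hu.1 2) (hu.1 0) hu0.ne',
        differentiableAt_div (hu.1 1) (hu.1 0) hu0.ne',
        (hu.1 0).log hu0.ne'⟩
    -- The defining function of the model, in logarithmic form, is constant along the patch.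
    have hρ := eventually_eq_of_pd_eq_zero
      (y := fun v => A (f v) 2 / A (f v) 0 - Real.log (A (f v) 0)
        - 1 / 2 * (A (f v) 1 / A (f v) 0 * (A (f v) 1 / A (f v) 0)))
      (u₀ := u₀)
      (by
        filter_upwards [hd] with u hu
        exact (hu.1.sub hu.2.2).sub ((hu.2.1.fun_mul hu.2.1).const_mul _))
      (by
        filter_upwards [hA, hpos0, hd] with u hu hu0 hud i
        obtain ⟨s, t, hst⟩ := hu.2 i
        have e0 := hst 0
        have e1 := hst 1
        have e2 := hst 2
        simp [Fin.sum_univ_three] at e0 e1 e2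
        have l0 : pd i (fun v => A (f v) 2 / A (f v) 0) u
            = s * c + t * (A (f u) 1 / A (f u) 0) := by
          rw [pd_div (hu.1 2) (hu.1 0) hu0.ne', e0, e2]
          have h0 := hu0.ne'
          field_simp
          ring
        have l1 : pd i (fun v => Real.log (A (f v) 0)) u = s * c := by
          rw [pd_log (hu.1 0) hu0.ne', e0, div_eq_iff hu0.ne']; ring
        have l2 : pd i (fun v => A (f v) 1 / A (f v) 0) u = t := by
          rw [pd_div (hu.1 1) (hu.1 0) hu0.ne', e0, e1, div_eq_iff (pow_ne_zero 2 hu0.ne')]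
          ring
        rw [pd_sub (hud.1.fun_sub hud.2.2) ((hud.2.1.fun_mul hud.2.1).const_mul _),
          pd_sub hud.1 hud.2.2, pd_const_mul (hud.2.1.fun_mul hud.2.1), pd_mul hud.2.1 hud.2.1,
          l0, l1, l2]
        ring)
    filter_upwards [hρ, hpos0] with u hu hu0
    refine ⟨hu0, ?_⟩
    simp [h00, h01, h02] at hu
    have h0 := hu0.ne'
    field_simp at hu ⊢
    linear_combination hu

end Models

/-! ### Classification of the operator algebras -/

section Classification

variable {ε a c d : ℝ} {E₁ E₂ : Matrix (Fin 3) (Fin 3) ℝ}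

/-- A pair with three real characters, whose values on `(E₁, E₂)` are `(p, 0)`, `(c, l)` and
`(c, m)`. The exponents are a linear relation between the characters, scaled by `t`; two orders of
the coordinates are recorded. -/
theorem isModel_powerSurface_of_roots (hN : IsNormalPair ε a c d E₁ E₂) (hε : ε * ε = 1)
    {p l m : ℝ} (hcp : c * p = ε) (ha : a = c + p) (hne : c ≠ p) (hl : l ^ 2 = d * l + (c ^ 2 - ε))
    (hm : m ^ 2 = d * m + (c ^ 2 - ε)) (hlm : l ≠ m) {t : ℝ} (ht : t ≠ 0) :
    IsModel E₁ E₂ (powerSurface (t * (ε * c ^ 2 * (m - l))) (t * -m) (t * l)) ∧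
      IsModel E₁ E₂ (powerSurface (t * -m) (t * l) (t * (ε * c ^ 2 * (m - l)))) := by
  have hsum : t * ((l - m) * ((p - c) * (ε * c))) ≠ 0 := by
    have hc : c ≠ 0 := by rintro rfl; rw [zero_mul] at hcp; simp [← hcp] at hε
    have hε0 : ε ≠ 0 := by rintro rfl; simp at hε
    exact mul_ne_zero ht (mul_ne_zero (sub_ne_zero.2 hlm)
      (mul_ne_zero (sub_ne_zero.2 hne.symm) (mul_ne_zero hε0 hc)))
  constructor
  · refine isModel_powerSurface hN (p := ![p, c, c]) (q := ![0, l, m])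
      (α := ![t * (ε * c ^ 2 * (m - l)), t * -m, t * l]) ?_ ?_ ?_ ?_ ?_ ?_ ?_
    · intro k; fin_cases k <;> simp <;> grind only
    · intro k; fin_cases k <;> simp
    · intro k; fin_cases k <;> simp <;> grind only
    · simp only [Matrix.det_fin_three]
      have : (c - p) * (m - l) ≠ 0 := mul_ne_zero (sub_ne_zero.2 hne) (sub_ne_zero.2 hlm.symm)
      intro h0
      apply this
      simp at h0
      linear_combination h0
    · simp [Fin.sum_univ_three]
      linear_combination t * ε * c * (m - l) * hcp + t * c * (m - l) * hε
    · simp [Fin.sum_univ_three]; ring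
    · rw [Fin.sum_univ_three]
      refine fun h0 => hsum ?_
      simp at h0
      linear_combination h0 + t * (l - m) * ε * hcp + t * (l - m) * hε
  · refine isModel_powerSurface hN (p := ![c, c, p]) (q := ![l, m, 0])
      (α := ![t * -m, t * l, t * (ε * c ^ 2 * (m - l))]) ?_ ?_ ?_ ?_ ?_ ?_ ?_
    · intro k; fin_cases k <;> simp <;> grind only
    · intro k; fin_cases k <;> simp
    · intro k; fin_cases k <;> simp <;> grind only
    · simp only [Matrix.det_fin_three]
      have : (c - p) * (m - l) ≠ 0 := mul_ne_zero (sub_ne_zero.2 hne) (sub_ne_zero.2 hlm.symm)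
      intro h0
      apply this
      simp at h0
      linear_combination h0
    · simp [Fin.sum_univ_three]
      linear_combination t * ε * c * (m - l) * hcp + t * c * (m - l) * hε
    · simp [Fin.sum_univ_three]; ring
    · rw [Fin.sum_univ_three]
      refine fun h0 => hsum ?_
      simp at h0
      linear_combination h0 + t * (l - m) * ε * hcp + t * (l - m) * hε

/-- Three real characters: the signs of the exponents follow from `l m = ε - c²`. -/
theorem exists_powerSurface (hN : IsNormalPair ε a c d E₁ E₂) (hε : ε = 1 ∨ ε = -1) {p : ℝ}
    (hcp : c * p = ε) (ha : a = c + p) (hne : c ≠ p) (hΔ : 0 < d ^ 2 + 4 * (c ^ 2 - ε)) :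
    ∃ α₁ α₂ α₃ : ℝ, ((0 < α₁ ∧ 0 < α₂ ∧ 0 < α₃) ∨
      (α₁ < 0 ∧ 0 < α₂ ∧ 0 < α₃ ∧ α₁ + α₂ + α₃ < 0)) ∧
      IsModel E₁ E₂ (powerSurface α₁ α₂ α₃) := by
  have hεε : ε * ε = 1 := by rcases hε with rfl | rfl <;> norm_num
  set r := √(d ^ 2 + 4 * (c ^ 2 - ε)) with hr
  have hr0 : 0 < r := Real.sqrt_pos.2 hΔ
  have hr2 : r ^ 2 = d ^ 2 + 4 * (c ^ 2 - ε) := Real.sq_sqrt hΔ.le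
  obtain ⟨l, hl⟩ : ∃ l, l = (d + r) / 2 := ⟨_, rfl⟩
  obtain ⟨m, hm⟩ : ∃ m, m = (d - r) / 2 := ⟨_, rfl⟩
  have hml : m < l := by linarith
  have hlm : l * m = ε - c ^ 2 := by rw [hl, hm]; linear_combination -hr2 / 4
  have hl2 : l ^ 2 = d * l + (c ^ 2 - ε) := by rw [hl]; linear_combination hr2 / 4
  have hm2 : m ^ 2 = d * m + (c ^ 2 - ε) := by rw [hm]; linear_combination hr2 / 4
  have hc : c ≠ 0 := by rintro rfl; rw [zero_mul] at hcp; simp [← hcp] at hεε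
  have hc2 : 0 < c ^ 2 := by positivity
  have key := fun t ht =>
    isModel_powerSurface_of_roots hN hεε hcp ha hne hl2 hm2 hml.ne' (t := t) ht
  have key' := fun t ht =>
    isModel_powerSurface_of_roots hN hεε hcp ha hne hm2 hl2 hml.ne (t := t) ht
  have hcε : c ^ 2 ≠ ε := fun h0 => hne (mul_left_cancel₀ hc (by linear_combination h0 - hcp))
  rcases lt_or_gt_of_ne hcε with h1 | h1
  · obtain rfl : ε = 1 := hε.resolve_right fun h0 => by linarith
    have hpos : 0 < l * m := by linarith
    rcases pos_and_pos_or_neg_and_neg_of_mul_pos hpos with ⟨hl0, hm0⟩ | ⟨hl0, hm0⟩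
    · refine ⟨_, _, _, Or.inr ?_, (key' 1 one_ne_zero).2⟩
      refine ⟨by linarith, by linarith, ?_, ?_⟩
      · have := mul_pos hc2 (sub_pos.2 hml); linarith
      · have := mul_pos (sub_pos.2 h1) (sub_pos.2 hml); linarith
    · refine ⟨_, _, _, Or.inr ?_, (key (-1) (by norm_num)).2⟩
      refine ⟨by linarith, by linarith, ?_, ?_⟩
      · have := mul_pos hc2 (sub_pos.2 hml); linarith
      · have := mul_pos (sub_pos.2 h1) (sub_pos.2 hml); linarith
  · have hneg : l * m < 0 := by linarith
    have hl0 : 0 < l := by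
      by_contra! h0
      exact hneg.not_ge (mul_nonneg_of_nonpos_of_nonpos h0 (hml.le.trans h0))
    have hm0 : m < 0 := neg_of_mul_neg_right hneg hl0.le
    refine ⟨_, _, _, ?_, (key 1 one_ne_zero).1⟩
    have h2 := mul_pos hc2 (sub_pos.2 hml)
    rcases hε with rfl | rfl
    · refine Or.inr ⟨by linarith, by linarith, by linarith, ?_⟩
      have := mul_pos (sub_pos.2 h1) (sub_pos.2 hml); linarith
    · exact Or.inl ⟨by linarith, by linarith, by linarith⟩

/-- Every normal pair has a model. The characters of the algebra take the values `(ε/c, 0)` and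
`(c, l)` on `(E₁, E₂)`, where `l² = d l + (c² - ε)`; the equation for `l` has the discriminant
`d² + 4 (c² - ε)`, and for `c² = ε` the root `l = 0` gives the first character again. -/
theorem exists_isModel (hN : IsNormalPair ε a c d E₁ E₂) (hε : ε = 1 ∨ ε = -1) :
    (∃ α₁ α₂ α₃ : ℝ, ((0 < α₁ ∧ 0 < α₂ ∧ 0 < α₃) ∨
      (α₁ < 0 ∧ 0 < α₂ ∧ 0 < α₃ ∧ α₁ + α₂ + α₃ < 0)) ∧
      IsModel E₁ E₂ (powerSurface α₁ α₂ α₃)) ∨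
    (∃ α₁ α₂ α₃ : ℝ, α₁ < 0 ∧ 0 < α₁ + 2 * α₂ ∧ IsModel E₁ E₂ (spiralSurface α₁ α₂ α₃)) ∨
    (∃ α₂ : ℝ, 0 < α₂ ∧ α₂ < 1 ∧ IsModel E₁ E₂ (logSurface α₂)) ∨
    IsModel E₁ E₂ logParaboloid := by
  have hε0 : ε ≠ 0 := by rcases hε with rfl | rfl <;> norm_num
  have hc : c ≠ 0 := by
    rintro rfl
    have := hN.rel
    exact hε0 (by linear_combination -this)
  obtain ⟨p, hp⟩ : ∃ p, p = ε / c := ⟨_, rfl⟩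
  have hcp : c * p = ε := by rw [hp]; field_simp
  have ha : a = c + p := mul_right_cancel₀ hc (by linear_combination hN.rel - hcp)
  have hc2 : 0 < c ^ 2 := by positivity
  by_cases hcε : c ^ 2 = ε
  · obtain rfl : ε = 1 := hε.resolve_right fun h0 => by linarith
    obtain rfl : p = c := mul_left_cancel₀ hc (by linear_combination hcp - hcε)
    by_cases hd : d = 0
    · subst hd
      exact Or.inr (Or.inr (Or.inr (isModel_logParaboloid hN hcε (by linear_combination ha))))
    · refine Or.inr (Or.inr (Or.inl ?_))
      have hd2 : 0 < d ^ 2 := by positivity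
      -- The roots are `0` and `d`, and `(c, 0)` is the double character; `α` is chosen so that
      -- `(p₂, q₂) = (c (1 - α), -α d)` is a derivation along it.
      obtain ⟨α, hα⟩ : ∃ α, α = 1 / (1 + d ^ 2) := ⟨_, rfl⟩
      have hαd : α * (1 + d ^ 2) = 1 := by rw [hα]; field_simp
      have hα0 : 0 < α := by rw [hα]; positivity
      have hα1 : α < 1 := by nlinarith
      refine ⟨α, hα0, hα1, isModel_logSurface hN (p₀ := p) (q₀ := 0) (p₁ := p) (q₁ := d)
        (p₂ := p * (1 - α)) (q₂ := -α * d) ?_ ?_ ?_ (by ring) (by ring) hα1.ne⟩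
      · simp [Matrix.det_fin_three]
        have : p * d ≠ 0 := mul_ne_zero hc hd
        grind only
      · ext i k
        fin_cases i <;> fin_cases k <;>
          simp [tableLeft, Matrix.mul_apply, Fin.sum_univ_three] <;> grind only
      · ext i k
        fin_cases i <;> fin_cases k <;>
          simp [tableRight, Matrix.mul_apply, Fin.sum_univ_three] <;> grind only
  · have hne : c ≠ p := fun h0 => hcε (by rw [← hcp, ← h0]; ring)
    rcases lt_or_ge 0 (d ^ 2 + 4 * (c ^ 2 - ε)) with hΔ | hΔ
    · exact Or.inl (exists_powerSurface hN hε hcp ha hne hΔ)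
    obtain rfl : ε = 1 := hε.resolve_right fun h0 => by nlinarith
    have hc1 : c ^ 2 < 1 := lt_of_le_of_ne (by nlinarith) hcε
    rcases hΔ.lt_or_eq with hΔ | hΔ
    · -- The roots are `(d ± r i) / 2`; the exponents are a linear relation between the characters.
      refine Or.inr (Or.inl ?_)
      set r := √(-(d ^ 2 + 4 * (c ^ 2 - 1))) with hr
      have hr0 : 0 < r := Real.sqrt_pos.2 (by linarith)
      have hr2 : r ^ 2 = -(d ^ 2 + 4 * (c ^ 2 - 1)) := Real.sq_sqrt (by linarith)
      refine ⟨-2 * c ^ 2, 1, -2 * d / r, by linarith, by linarith,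
        isModel_spiralSurface hN (p₀ := p) (σ := d / 2) (τ := r / 2) ?_ ?_ hcp ?_ (by ring)
        (by positivity) hne.symm ?_ ?_ (by linarith)⟩
      · rw [ha]; linear_combination -hcp
      · rw [ha]; linear_combination -hcp
      · linear_combination -hr2 / 4
      · linear_combination -2 * c * hcp
      · field_simp; ring
    · -- The double root is `d / 2`.
      refine Or.inr (Or.inr (Or.inl ?_))
      have hd0 : d ≠ 0 := by rintro rfl; linarith
      refine ⟨c ^ 2, hc2, hc1, isModel_logSurface hN (p₀ := c) (q₀ := d / 2) (p₁ := p) (q₁ := 0)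
        (p₂ := 0) (q₂ := d / 2) ?_ ?_ ?_ ?_ (by ring) hc1.ne⟩
      · simp [Matrix.det_fin_three]
        have : (p - c) * d ≠ 0 := mul_ne_zero (sub_ne_zero.2 hne.symm) hd0
        grind only
      · ext i k
        fin_cases i <;> fin_cases k <;>
          simp [tableLeft, Matrix.mul_apply, Fin.sum_univ_three] <;> grind only
      · ext i k
        fin_cases i <;> fin_cases k <;>
          simp [tableRight, Matrix.mul_apply, Fin.sum_univ_three] <;> grind only
      · linear_combination c * hcp

end Classification

/-! ### Restriction of patches, and patches with constant multiplications -/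

section Patches

variable {ε : ℝ} {f : E 2 → E 3} {Ω : Set (E 2)} {u : E 2}

theorem IsConvexPatch.mono (h : IsConvexPatch ε f Ω) {Ω' : Set (E 2)} (hΩ' : IsOpen Ω')
    (hsub : Ω' ⊆ Ω) : IsConvexPatch ε f Ω' :=
  ⟨hΩ', fun u hu => h.contDiffAt u (hsub hu), fun u hu => h.posDef u (hsub hu)⟩

theorem IsParallelPatch.mono (h : IsParallelPatch ε f Ω) {Ω' : Set (E 2)} (hΩ' : IsOpen Ω')
    (hsub : Ω' ⊆ Ω) : IsParallelPatch ε f Ω' :=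
  ⟨h.toIsConvexPatch.mono hΩ' hsub, fun u hu => h.parallel u (hsub hu)⟩

/-- A ray meets the quadric at most once. -/
theorem quadric_ray {ε : ℝ} :
    ∀ y ∈ quadric (Matrix.diagonal ![1, ε, ε]), ∀ s : ℝ,
      Real.exp s • y ∈ quadric (Matrix.diagonal ![1, ε, ε]) → s = 0 := by
  intro y hy s hs
  simp only [quadric, Set.mem_ofPred_eq, PiLp.smul_apply, smul_eq_mul] at hy hs
  have h1 : Real.exp (s + s) = 1 := by
    refine Eq.trans ?_ hs
    refine (mul_one _).symm.trans ((congrArg _ hy.symm).trans ?_)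
    rw [Finset.mul_sum, Real.exp_add]
    refine Finset.sum_congr rfl fun i _ => ?_
    rw [Finset.mul_sum]
    exact Finset.sum_congr rfl fun j _ => by ring
  linarith [(Real.exp_eq_one_iff _).1 h1]

/-- The position vector and the tangent vectors form a basis, so the position vector is cyclic. -/
theorem IsConvexPatch.isOrbitPatch (h : IsConvexPatch ε f Ω) (hε : ε * ε = 1) (hu : u ∈ Ω)
    {E₁ E₂ : Matrix (Fin 3) (Fin 3) ℝ}
    (hW : ∀ᶠ v in 𝓝 u, multSpace ε f v = Submodule.span ℝ {E₁, E₂}) :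
    IsOrbitPatch E₁ E₂ f u := by
  have hpd : ∀ᶠ v in 𝓝 u, ∀ i, ∃ s t : ℝ, ∀ b,
      pd i f v b = (f v ᵥ* (s • E₁ + t • E₂)) b := by
    filter_upwards [hW, h.isOpen.mem_nhds hu] with v hv hvΩ i
    have hi : mult ε f i v ∈ Submodule.span ℝ {E₁, E₂} := hv ▸ Submodule.subset_span ⟨i, rfl⟩
    obtain ⟨s, t, hst⟩ := Submodule.mem_span_pair.1 hi
    refine ⟨s, t, fun b => ?_⟩
    rw [hst, h.vecMul_mult hε hvΩ]
  refine ⟨?_, hpd, ?_⟩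
  · filter_upwards [h.isOpen.mem_nhds hu] with v hv using
      (h.contDiffAt v hv).differentiableAt_infty
  · obtain ⟨s₀, t₀, h₀⟩ := hpd.self_of_nhds 0
    obtain ⟨s₁, t₁, h₁⟩ := hpd.self_of_nhds 1
    have hF : frame ε f u = !![0, s₀, t₀; 0, s₁, t₁; -ε, 0, 0] * cyclicMatrix E₁ E₂ (f u) := by
      ext a b
      rw [Matrix.mul_apply, Fin.sum_univ_three]
      simp only [Matrix.vecMul_add, Matrix.vecMul_smul, Pi.add_apply, Pi.smul_apply,
        smul_eq_mul] at h₀ h₁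
      fin_cases a
      · refine (h₀ b).trans ?_
        simp [cyclicMatrix]
      · refine (h₁ b).trans ?_
        simp [cyclicMatrix]
      · simp [cyclicMatrix, frame_row]
    have := h.isUnit_frame hu
    rw [hF, Matrix.det_mul] at this
    exact isUnit_of_mul_isUnit_right this

/-- A locally strongly convex patch with constant multiplications lies in the model surface. -/
theorem IsConvexPatch.exists_mem_model (h : IsConvexPatch ε f Ω) (hε : ε * ε = 1) (hu : u ∈ Ω)
    {E₁ E₂ : Matrix (Fin 3) (Fin 3) ℝ} {S : Set (E 3)} (hS : IsModel E₁ E₂ S)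
    (hW : ∀ᶠ v in 𝓝 u, multSpace ε f v = Submodule.span ℝ {E₁, E₂}) :
    ∃ A : E 3 ≃L[ℝ] E 3, ∀ᶠ v in 𝓝 u, A (f v) ∈ S :=
  hS.2 f u (h.isOrbitPatch hε hu hW)

end Patches

/-! ### Surfaces -/

section Surface

variable {M : Type*} [TopologicalSpace M] [ChartedSpace (E 2) M] [IsManifold (𝓡 2) ∞ M]
  {x : M → E 3} {ε : ℝ}

theorem isParallelPatch_chart (hx : IsCentroaffine x) (hconv : MetricPosDef ε x)
    (hpar : HasParallelCubicForm ε x) {φ : OpenPartialHomeomorph M (E 2)}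
    (hφ : φ ∈ atlas (E 2) M) : IsParallelPatch ε (x ∘ φ.symm) φ.target := by
  refine ⟨⟨φ.open_target, fun u hu => ?_, hconv φ hφ⟩, hpar φ hφ⟩
  have h1 : ContMDiffOn (𝓡 2) (𝓡 2) ∞ φ.symm φ.target :=
    contMDiffOn_symm_of_mem_maximalAtlas (IsManifold.subset_maximalAtlas hφ)
  have h2 := (hx.smooth.comp_contMDiffOn h1).contDiffOn
  exact h2.contDiffAt (φ.open_target.mem_nhds hu)

/-- Charts are related by a reparametrization over the overlap, as a set of parameters of `φ'`. -/
theorem isReparametrization_chart {φ φ' : OpenPartialHomeomorph M (E 2)}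
    (hφ : φ ∈ atlas (E 2) M) (hφ' : φ' ∈ atlas (E 2) M) :
    IsReparametrization (x ∘ φ.symm) (x ∘ φ'.symm) (φ'.symm.trans φ) φ.target
      (φ'.symm.trans φ).source := by
  refine ⟨fun v hv => ?_, fun v hv => ?_, fun v hv => ?_⟩
  · have h1 := (contMDiffOn_of_mem_contDiffGroupoid
      ((contDiffGroupoid ∞ (𝓡 2)).compatible hφ' hφ)).contDiffOn
    exact h1.contDiffAt ((φ'.symm.trans φ).open_source.mem_nhds hv)
  · exact φ.map_source (by simpa using hv.2)
  · have : φ'.symm v ∈ φ.source := by simpa using hv.2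
    simp [φ.left_inv this]

open Classical in
/-- The space of the multiplications at a parameter where the cubic form does not vanish, and `none`
where it vanishes. -/
noncomputable def multType (ε : ℝ) (f : E 2 → E 3) (u : E 2) :
    Option (Submodule ℝ (Matrix (Fin 3) (Fin 3) ℝ)) :=
  if ∀ i j k, cubicForm ε f i j k u = 0 then none else some (multSpace ε f u)

theorem multType_eq_none_iff {f : E 2 → E 3} {u : E 2} :
    multType ε f u = none ↔ ∀ i j k, cubicForm ε f i j k u = 0 := by
  rw [multType]
  split_ifs with h
  · exact ⟨fun _ => h, fun _ => rfl⟩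
  · exact ⟨fun h0 => by simp at h0, fun h0 => absurd h0 h⟩

theorem multType_eq_some_iff {f : E 2 → E 3} {u : E 2}
    {W : Submodule ℝ (Matrix (Fin 3) (Fin 3) ℝ)} :
    multType ε f u = some W ↔ (∃ i j k, cubicForm ε f i j k u ≠ 0) ∧ multSpace ε f u = W := by
  rw [multType]
  split_ifs with h
  · simp only [false_iff, not_and]
    rintro ⟨i, j, k, hC⟩
    exact absurd (h i j k) hC
  · push Not at h
    simp only [Option.some.injEq, h, true_and]

theorem IsParallelPatch.eventually_multType_eq {f : E 2 → E 3} {Ω : Set (E 2)} {u : E 2}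
    (h : IsParallelPatch ε f Ω) (hε : ε * ε = 1) (hu : u ∈ Ω) :
    ∀ᶠ v in 𝓝 u, multType ε f v = multType ε f u := by
  rcases hT : multType ε f u with _ | W
  · filter_upwards [h.eventually_cubicForm_eq_zero hu (multType_eq_none_iff.1 hT)] with v hv using
      multType_eq_none_iff.2 hv
  · -- The cubic form does not vanish near `u` either, so the metric is flat there.
    obtain ⟨⟨i, j, k, h0⟩, rfl⟩ := multType_eq_some_iff.1 hT
    have hev := ((h.contDiffAt_cubicForm hu i j k).continuousAt.eventually_ne h0).and
      (h.isOpen.mem_nhds hu)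
    obtain ⟨Ω', hΩ', ho, hu'⟩ := mem_nhds_iff.1 hev
    have h' := h.mono ho fun v hv => (hΩ' hv).2
    filter_upwards [ho.mem_nhds hu', h'.eventually_multSpace_eq hε
      (fun v hv => h'.curvature_eq_zero hv ⟨i, j, k, (hΩ' hv).1⟩) hu'] with v hv hW using
      multType_eq_some_iff.2 ⟨⟨i, j, k, (hΩ' hv).1⟩, hW⟩

theorem IsReparametrization.multType_eq_none {f f' : E 2 → E 3} {τ : E 2 → E 2}
    {Ω Ω' : Set (E 2)} {u : E 2} (r : IsReparametrization f f' τ Ω Ω') (h : IsConvexPatch ε f Ω)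
    (h' : IsConvexPatch ε f' Ω') (hu : u ∈ Ω') (h0 : multType ε f (τ u) = none) :
    multType ε f' u = none := by
  rw [multType_eq_none_iff] at h0 ⊢
  intro i j k
  simp [r.cubicForm_eq h h' hu, h0]

/-- Whether the cubic form vanishes at a point, and the space of the multiplications there, do not
depend on the chart. -/
theorem multType_chart_eq (hx : IsCentroaffine x) (hε : ε * ε = 1) (hconv : MetricPosDef ε x)
    (hpar : HasParallelCubicForm ε x) {φ φ' : OpenPartialHomeomorph M (E 2)}
    (hφ : φ ∈ atlas (E 2) M) (hφ' : φ' ∈ atlas (E 2) M) {q : M} (hq : q ∈ φ.source)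
    (hq' : q ∈ φ'.source) :
    multType ε (x ∘ φ'.symm) (φ' q) = multType ε (x ∘ φ.symm) (φ q) := by
  have key : ∀ {φ φ' : OpenPartialHomeomorph M (E 2)}, φ ∈ atlas (E 2) M → φ' ∈ atlas (E 2) M →
      q ∈ φ.source → q ∈ φ'.source →
      (multType ε (x ∘ φ.symm) (φ q) = none → multType ε (x ∘ φ'.symm) (φ' q) = none) ∧
      multSpace ε (x ∘ φ'.symm) (φ' q) = multSpace ε (x ∘ φ.symm) (φ q) := by
    intro φ φ' hφ hφ' hq hq'
    have r := isReparametrization_chart (x := x) hφ hφ'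
    have h := (isParallelPatch_chart hx hconv hpar hφ).toIsConvexPatch
    have h' := (isParallelPatch_chart hx hconv hpar hφ').toIsConvexPatch.mono
      (φ'.symm.trans φ).open_source (by simp)
    have hu : φ' q ∈ (φ'.symm.trans φ).source := by simp [hq, hq']
    have e : (φ'.symm.trans φ) (φ' q) = φ q := by simp [hq']
    have := r.multSpace_eq hε h h' hu
    rw [e] at this
    refine ⟨fun h0 => r.multType_eq_none h h' hu (by rwa [e]), this⟩
  obtain ⟨k1, k2⟩ := key hφ hφ' hq hq'
  have k3 := (key hφ' hφ hq' hq).1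
  rcases h1 : multType ε (x ∘ φ.symm) (φ q) with _ | W
  · exact k1 h1
  · rcases h2 : multType ε (x ∘ φ'.symm) (φ' q) with _ | W'
    · exact absurd (h1.symm.trans (k3 h2)) (by simp)
    · rw [← (multType_eq_some_iff.1 h1).2, ← (multType_eq_some_iff.1 h2).2, k2]

/-- The space of the multiplications is constant on the connected components of the surface, and the
cubic form vanishes either everywhere or nowhere on a component. -/
theorem multType_eq_of_mem_connectedComponent (hx : IsCentroaffine x) (hε : ε * ε = 1)
    (hconv : MetricPosDef ε x) (hpar : HasParallelCubicForm ε x)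
    {φ φ' : OpenPartialHomeomorph M (E 2)} (hφ : φ ∈ atlas (E 2) M) (hφ' : φ' ∈ atlas (E 2) M)
    {p q : M} (hp : p ∈ φ.source) (hq : q ∈ φ'.source) (hpq : q ∈ connectedComponent p) :
    multType ε (x ∘ φ'.symm) (φ' q) = multType ε (x ∘ φ.symm) (φ p) := by
  let g : M → Option (Submodule ℝ (Matrix (Fin 3) (Fin 3) ℝ)) := fun q =>
    multType ε (x ∘ (chartAt (E 2) q).symm) (chartAt (E 2) q q)
  have hg : ∀ {φ : OpenPartialHomeomorph M (E 2)} {q : M}, φ ∈ atlas (E 2) M → q ∈ φ.source →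
      g q = multType ε (x ∘ φ.symm) (φ q) := fun hφ hq =>
    multType_chart_eq hx hε hconv hpar hφ (chart_mem_atlas _ _) hq (mem_chart_source _ _)
  have hloc : IsLocallyConstant g := by
    refine (IsLocallyConstant.iff_eventually_eq g).2 fun q => ?_
    set ψ := chartAt (E 2) q
    have hψ : ψ ∈ atlas (E 2) M := chart_mem_atlas _ _
    have hqψ : q ∈ ψ.source := mem_chart_source _ _
    have hev := (isParallelPatch_chart hx hconv hpar hψ).eventually_multType_eq hε
      (ψ.map_source hqψ)
    filter_upwards [(ψ.continuousAt hqψ).eventually hev, ψ.open_source.mem_nhds hqψ] with y hy hyψ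
    rw [hg hψ hyψ, hy]
  rw [← hg hφ' hq, ← hg hφ hp]
  exact hloc.apply_eq_of_isPreconnected isPreconnected_connectedComponent hpq
    mem_connectedComponent

/-- The surface is locally equivalent to `S`, which meets each ray at most once, if each of its
local parametrizations can locally be mapped into `S`; by `exists_image_eq_inter` the image is then
open in `S`. -/
theorem locallyEquivalentOn_of_eventually_mem (hx : IsCentroaffine x) (hconv : MetricPosDef ε x)
    (hpar : HasParallelCubicForm ε x) {W : Set M} {S : Set (E 3)}
    (hS : ∀ y ∈ S, ∀ s : ℝ, Real.exp s • y ∈ S → s = 0)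
    (H : ∀ φ ∈ atlas (E 2) M, ∀ u ∈ φ.target, φ.symm u ∈ W →
      ∃ A : E 3 ≃L[ℝ] E 3, ∀ᶠ v in 𝓝 u, A ((x ∘ φ.symm) v) ∈ S) :
    LocallyEquivalentOn x W S := by
  intro q hq
  set φ := chartAt (E 2) q
  have hφ : φ ∈ atlas (E 2) M := chart_mem_atlas _ _
  have hqφ : q ∈ φ.source := mem_chart_source _ _
  have hu : φ q ∈ φ.target := φ.map_source hqφ
  have h := isParallelPatch_chart hx hconv hpar hφ
  obtain ⟨A, hA⟩ := H φ hφ _ hu (by rwa [φ.left_inv hqφ])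
  obtain ⟨N, V, hN, hqN, hNT, hV, hinj, him⟩ := exists_image_eq_inter (h.contDiffAt _ hu)
    (h.isUnit_frame hu) hS A hA (φ.open_target.mem_nhds hu)
  refine ⟨φ.symm '' N, V, A, φ.symm.isOpen_image_of_subset_source hN hNT,
    ⟨_, hqN, φ.left_inv hqφ⟩, hV, ?_, ?_⟩
  · rintro _ ⟨u, hu, rfl⟩ _ ⟨v, hv, rfl⟩ huv
    rw [hinj hu hv huv]
  · rw [Set.image_image]
    exact him

end Surface

end Centroaffine

open Centroaffine in
theorem theorem6p1 {M : Type*} [TopologicalSpace M] [ChartedSpace (E 2) M]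
    [IsManifold (𝓡 2) ∞ M] (x : M → E 3) (hx : IsCentroaffine x)
    (ε : ℝ) (hε : ε = 1 ∨ ε = -1) (hconv : MetricPosDef ε x)
    (hpar : HasParallelCubicForm ε x) (p : M) :
    (CubicFormVanishesOn ε x (connectedComponent p) ∧
      ∃ Q : Matrix (Fin 3) (Fin 3) ℝ, Q.IsSymm ∧ Q.det ≠ 0 ∧
        LocallyEquivalentOn x (connectedComponent p) (quadric Q)) ∨
    (∃ α₁ α₂ α₃ : ℝ,
      ((0 < α₁ ∧ 0 < α₂ ∧ 0 < α₃) ∨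
        (α₁ < 0 ∧ 0 < α₂ ∧ 0 < α₃ ∧ α₁ + α₂ + α₃ < 0)) ∧
      LocallyEquivalentOn x (connectedComponent p) (powerSurface α₁ α₂ α₃)) ∨
    (∃ α₁ α₂ α₃ : ℝ, α₁ < 0 ∧ 0 < α₁ + 2 * α₂ ∧
      LocallyEquivalentOn x (connectedComponent p) (spiralSurface α₁ α₂ α₃)) ∨
    (∃ α₂ : ℝ, 0 < α₂ ∧ α₂ < 1 ∧
      LocallyEquivalentOn x (connectedComponent p) (logSurface α₂)) ∨
    LocallyEquivalentOn x (connectedComponent p) logParaboloid := by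
  have hεε : ε * ε = 1 := by rcases hε with rfl | rfl <;> norm_num
  set φ := chartAt (E 2) p
  have hφ : φ ∈ atlas (E 2) M := chart_mem_atlas _ _
  have hp : p ∈ φ.source := mem_chart_source _ _
  have hpatch : ∀ {φ}, φ ∈ atlas (E 2) M → IsParallelPatch ε (x ∘ φ.symm) φ.target :=
    fun hφ => isParallelPatch_chart hx hconv hpar hφ
  have hconst : ∀ ψ ∈ atlas (E 2) M, ∀ u ∈ ψ.target, ψ.symm u ∈ connectedComponent p →
      multType ε (x ∘ ψ.symm) u = multType ε (x ∘ φ.symm) (φ p) := by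
    intro ψ hψ u hu hup
    have := multType_eq_of_mem_connectedComponent hx hεε hconv hpar hφ hψ hp (ψ.map_target hu) hup
    rwa [ψ.right_inv hu] at this
  rcases hT : multType ε (x ∘ φ.symm) (φ p) with _ | W
  · have hC : CubicFormVanishesOn ε x (connectedComponent p) := fun ψ hψ u hu hup =>
      multType_eq_none_iff.1 ((hconst ψ hψ u hu hup).trans hT)
    refine Or.inl ⟨hC, Matrix.diagonal ![1, ε, ε], Matrix.isSymm_diagonal _, ?_,
      locallyEquivalentOn_of_eventually_mem hx hconv hpar quadric_ray fun ψ hψ u hu hup => ?_⟩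
    · simp [Matrix.det_diagonal, Fin.prod_univ_three, hεε]
    · have h0 := (hpatch hψ).eventually_cubicForm_eq_zero hu (hC ψ hψ u hu hup)
      obtain ⟨Ω, hΩ, ho, huΩ⟩ := mem_nhds_iff.1
        (h0.and ((hpatch hψ).isOpen.mem_nhds hu))
      exact ((hpatch hψ).toIsConvexPatch.mono ho fun v hv => (hΩ hv).2).exists_mem_quadric hεε huΩ
        fun v hv => (hΩ hv).1
  · obtain ⟨hne, hW⟩ := multType_eq_some_iff.1 hT
    obtain ⟨a, c, d, E₁, E₂, hN, hspan⟩ := (hpatch hφ).exists_isNormalPair hεε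
      (φ.map_source hp) ((hpatch hφ).curvature_eq_zero (φ.map_source hp) hne)
    have key : ∀ {S : Set (E 3)}, IsModel E₁ E₂ S →
        LocallyEquivalentOn x (connectedComponent p) S := by
      intro S hS
      refine locallyEquivalentOn_of_eventually_mem hx hconv hpar hS.1 fun ψ hψ u hu hup => ?_
      refine (hpatch hψ).exists_mem_model hεε hu hS ?_
      filter_upwards [(hpatch hψ).eventually_multType_eq hεε hu] with v hv
      rw [hconst ψ hψ u hu hup, hT, multType_eq_some_iff] at hv
      rw [hv.2, hspan, hW]
    right
    rcases exists_isModel hN hε with ⟨α₁, α₂, α₃, h, hS⟩ | ⟨α₁, α₂, α₃, h1, h2, hS⟩ |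
      ⟨α₂, h1, h2, hS⟩ | hS
    · exact Or.inl ⟨α₁, α₂, α₃, h, key hS⟩
    · exact Or.inr (Or.inl ⟨α₁, α₂, α₃, h1, h2, key hS⟩)
    · exact Or.inr (Or.inr (Or.inl ⟨α₂, h1, h2, key hS⟩))
    · exact Or.inr (Or.inr (Or.inr (key hS)))
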